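/- Let $G$ be a locally compact (Hausdorff) group with left Haar measure $dt$ and modular function $\Delta$ (so that $\int_G f(t^{-1})\Delta(t)^{-1}\,dt=\int_G f(t)\,dt$), and let $\alpha\colon G\to\mathrm{Aut}(A)$ be a strongly continuous action on a C*-algebra $A$. Let $A\rtimes_{\alpha,r}G$ be the reduced crossed product, realised as the C*-algebra generated by the operators $\lambda_\varphi$, $\varphi\in C_c(G,A)$, $(\lambda_\varphi f)(t)=\int_G\pi(\alpha_{t^{-1}}(\varphi(s)))f(s^{-1}t)\,ds$ on $L^2(G,H)$ for a faithful representation $\pi\colon A\to\mathcal B(H)$, and regard $L^1(G,A)$ as a subspace of it by $\varphi\mapsto\lambda_\varphi$. For $\xi,\eta\in A$ and suitable measurable $\varphi\colon G\to A$ put $$\langle\!\langle\xi,\eta\rangle\!\rangle(t)=\Delta(t)^{-1/2}\,\xi^*\alpha_t(\eta),\qquad \xi*\varphi=\int_G\Delta(t)^{-1/2}\alpha_t(\xi\,\varphi(t^{-1}))\,dt,$$ $${}_{A^G}\langle\xi,\eta\rangle=\int_G^{\mathrm{su}}\alpha_t(\xi\eta^*)\,dt\in\mathcal M(A),$$ the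 last being the limit in the strict topology of the multiplier algebra $\mathcal M(A)$ of the integrals over compact subsets of $G$, when this limit exists. Let $L^1_\Delta(G,A)=\{f\in L^1(G,A):\Delta^{-1/2}f,\ \Delta^{1/2}f\in L^1(G,A)\}$. For a subspace $S\subseteq A$ let $A^G_S\subseteq\mathcal M(A)$ be the C*-algebra generated by the elements ${}_{A^G}\langle\xi,\eta\rangle$, $\xi,\eta\in S$. Let $\mathcal F(S)$ denote the completion of $S$ to a Hilbert $A^G_S$-$A\rtimes_{\alpha,r}G$-bimodule: a complete Hilbert bimodule with a linear map $\iota_S$ from $S$ onto a dense subspace such that the right and left inner products of $\iota_S(\xi),\iota_S(\eta)$ are $\langle\!\langle\xi,\eta\rangle\!\rangle$ and ${}_{A^G}\langle\xi,\eta\rangle$, and such that $\iota_S(\xi)\cdot\varphi=\iota_S(\xi*\varphi)$ for $\varphi\in L^1_\Delta(G,A)$ with $\xi*\varphi\in S$, and $m\cdot\iota_S(\xi)=\iota_S(m\xi)$ for $m\in A^G_S$ with $m\xi\in S$. (A Hilbert $B$-$C$-bimodule is a left Hilbert $B$-module and right Hilbert $C$-module with commuting actions, satisfying ${}_B\langle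 x,y\rangle z=x\langle y,z\rangle_C$, both inner products defining the same norm.) **Proposition.** Let $\mathcal R\subseteq A$ be a dense subspace with $\langle\!\langle\mathcal R,\mathcal R\rangle\!\rangle\subseteq L^1_\Delta(G,A)$ and $\mathcal R*L^1_\Delta(G,A)\subseteq\mathcal R$. Put $\tilde{\mathcal R}=\mathrm{span}(\mathcal R*L^1_\Delta(G,A))$ and $A_0=\mathrm{span}(\tilde{\mathcal R}\tilde{\mathcal R}^*)$. Then $A_0\subseteq\tilde{\mathcal R}\subseteq\mathcal R$; the Hilbert bimodules $\mathcal F(\mathcal R)$, $\mathcal F(\tilde{\mathcal R})$ and $\mathcal F(A_0)$ exist, and for $S\in\{\mathcal R,\tilde{\mathcal R},A_0\}$ the algebra $A^G_S$ is the closed linear span of ${}_{A^G}\langle S,S\rangle$; and the three bimodules are canonically isomorphic: one has $A^G_{A_0}=A^G_{\tilde{\mathcal R}}=A^G_{\mathcal R}$, and the inclusions $A_0\subseteq\tilde{\mathcal R}\subseteq\mathcal R$ extend uniquely to surjective linear isometries $\mathcal F(A_0)\cong\mathcal F(\tilde{\mathcal R})\cong\mathcal F(\mathcal R)$ which preserve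 both actions and both inner products. -/

import Mathlib

open MeasureTheory Filter Topology TopologicalSpace
open scoped MultiplierAlgebra

universe uG uA uH uM uL

noncomputable section

namespace RieffelProper

section CrossedProduct

variable {G : Type uG} [Group G] [TopologicalSpace G] [IsTopologicalGroup G]
  [LocallyCompactSpace G] [MeasurableSpace G] [BorelSpace G]
variable {A : Type uA} [NonUnitalCStarAlgebra A]
variable {H : Type uH} [NormedAddCommGroup H] [InnerProductSpace ℂ H] [CompleteSpace H]

/-- The modular function `Δ` of `G`, in the convention `μ (E t) = Δ(t) μ(E)` for a left Haar
measure `μ`, that is `∫ f(s⁻¹) Δ(s)⁻¹ ds = ∫ f(s) ds`. (Mathlib's `modularCharacterFun t`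
is the factor of `E ↦ μ (E t⁻¹)`, whence the inverse.) -/
def modular (t : G) : ℝ := (Measure.modularCharacterFun t⁻¹ : ℝ)

/-- The function `⟨⟨ξ, η⟩⟩ : t ↦ Δ(t)^{-1/2} ξ* α_t(η)`. -/
def braket (α : G →* (A ≃⋆ₐ[ℂ] A)) (ξ η : A) (t : G) : A :=
  (modular t ^ (-1 / 2 : ℝ)) • (star ξ * α t η)

/-- The (representatives of the) elements of
`L¹_Δ(G, A) = {f ∈ L¹(G, A) | Δ^{-1/2} f ∈ L¹(G, A) and Δ^{1/2} f ∈ L¹(G, A)}`. -/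
def MemL1Δ (μ : Measure G) (φ : G → A) : Prop :=
  Integrable φ μ ∧ Integrable (fun t => (modular t ^ (-1 / 2 : ℝ)) • φ t) μ ∧
    Integrable (fun t => (modular t ^ (1 / 2 : ℝ)) • φ t) μ

/-- The element `ξ * φ = ∫ Δ(t)^{-1/2} α_t(ξ φ(t⁻¹)) dt` of `A`. -/
def conv (α : G →* (A ≃⋆ₐ[ℂ] A)) (μ : Measure G) (ξ : A) (φ : G → A) : A :=
  ∫ t, (modular t ^ (-1 / 2 : ℝ)) • α t (ξ * φ t⁻¹) ∂μ

/-- `IsRegularOp α μ π φ T` : the bounded operator `T` on `L²(G, H)` is the image `λ_φ` of the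
function `φ : G → A` under the regular representation induced by the representation `π` of `A`
on `H`, namely
`(λ_φ f)(t) = ∫ π(α_{t⁻¹}(φ(s))) f(s⁻¹ t) ds = ∫ Δ(s)⁻¹ π(α_{t⁻¹}(φ(t s⁻¹))) f(s) ds`
for `f` in the dense subspace `C_c(G, H)`. There is at most one such `T`. -/
def IsRegularOp (α : G →* (A ≃⋆ₐ[ℂ] A)) (μ : Measure G) (π : A →⋆ₙₐ[ℂ] (H →L[ℂ] H))
    (φ : G → A) (T : Lp H 2 μ →L[ℂ] Lp H 2 μ) : Prop :=
  ∀ (f : G → H) (F : Lp H 2 μ), Continuous f → HasCompactSupport f → (F : G → H) =ᵐ[μ] f →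
    (T F : G → H) =ᵐ[μ] fun t => ∫ s, π (α t⁻¹ (φ s)) (f (s⁻¹ * t)) ∂μ

/-- The reduced crossed product `A ⋊_{α,r} G`: the C*-subalgebra of `B(L²(G, H))` generated by the
operators `λ_φ`, `φ ∈ C_c(G, A)`, for the regular representation induced by a
faithful representation `π` of `A` on `H`. -/
def reducedCrossedProduct (α : G →* (A ≃⋆ₐ[ℂ] A)) (μ : Measure G)
    (π : A →⋆ₙₐ[ℂ] (H →L[ℂ] H)) :
    NonUnitalStarSubalgebra ℂ (Lp H 2 μ →L[ℂ] Lp H 2 μ) :=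
  (NonUnitalStarAlgebra.adjoin ℂ {T : Lp H 2 μ →L[ℂ] Lp H 2 μ | ∃ φ : G → A,
    Continuous φ ∧ HasCompactSupport φ ∧ IsRegularOp α μ π φ T}).topologicalClosure

/-- `HasStrictIntegral μ f m` : the net of the integrals `∫_K f(t) dt`, `K ⊆ G` compact, converges
in the strict topology of the multiplier algebra of `A` to `m`, that is `m = ∫^su f(t) dt`.
(For `m : 𝓜(ℂ, A)`, `m.fst a` is the product `m a` and `m.snd a` is the product `a m`.) -/
def HasStrictIntegral (μ : Measure G) (f : G → A) (m : 𝓜(ℂ, A)) : Prop :=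
  ∀ a : A,
    Tendsto (fun K : Compacts G => (∫ t in (K : Set G), f t ∂μ) * a) atTop (𝓝 (m.fst a)) ∧
    Tendsto (fun K : Compacts G => a * (∫ t in (K : Set G), f t ∂μ)) atTop (𝓝 (m.snd a))

/-- The set of the multipliers `∫^su α_t(ξ η*) dt` with `ξ, η ∈ S`. -/
def leftInners (α : G →* (A ≃⋆ₐ[ℂ] A)) (μ : Measure G) (S : Submodule ℂ A) :
    Set 𝓜(ℂ, A) :=
  {m | ∃ ξ ∈ S, ∃ η ∈ S, HasStrictIntegral μ (fun t => α t (ξ * star η)) m}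

/-- The generalised fixed-point algebra `A^G` of `S`: the C*-subalgebra of the multiplier algebra
generated by the elements `∫^su α_t(ξ η*) dt` with `ξ, η ∈ S`. -/
def fixedPointAlgebra (α : G →* (A ≃⋆ₐ[ℂ] A)) (μ : Measure G) (S : Submodule ℂ A) :
    NonUnitalStarSubalgebra ℂ 𝓜(ℂ, A) :=
  (NonUnitalStarAlgebra.adjoin ℂ (leftInners α μ S)).topologicalClosure

/-- `span (S * L¹_Δ(G, A))`. -/
def spanConv (α : G →* (A ≃⋆ₐ[ℂ] A)) (μ : Measure G) (S : Submodule ℂ A) : Submodule ℂ A :=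
  Submodule.span ℂ {a | ∃ ξ ∈ S, ∃ φ : G → A, MemL1Δ μ φ ∧ a = conv α μ ξ φ}

end CrossedProduct

/-- `span (S S*)`. -/
def spanMulStar {A : Type uA} [NonUnitalCStarAlgebra A] (S : Submodule ℂ A) : Submodule ℂ A :=
  Submodule.span ℂ {a | ∃ ξ ∈ S, ∃ η ∈ S, a = ξ * star η}

/-- A Hilbert `B`-`C`-bimodule structure on the Banach space `E`, for C*-algebras `B` and `C`
(given as C*-subalgebras of ambient C*-algebras): a left Hilbert `B`-module and a right
Hilbert `C`-module with `(b x) c = b (x c)` and `_B⟨x, y⟩ z = x ⟨y, z⟩_C`, the norm of `E` being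
the one defined by either inner product. -/
structure HilbertBimodule {M : Type uM} {L : Type uL} [NonUnitalCStarAlgebra M]
    [NonUnitalCStarAlgebra L] (B : NonUnitalStarSubalgebra ℂ M) (C : NonUnitalStarSubalgebra ℂ L)
    (E : Type uA) [NormedAddCommGroup E] [NormedSpace ℂ E] where
  /-- the left action of `B` -/
  lsmul : B →ₗ[ℂ] E →ₗ[ℂ] E
  /-- the right action of `C` -/
  rsmul : E →ₗ[ℂ] C →ₗ[ℂ] E
  /-- the `B`-valued inner product, linear in the first variable -/
  linner : E →ₗ[ℂ] E →ₗ⋆[ℂ] B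
  /-- the `C`-valued inner product, linear in the second variable -/
  rinner : E →ₗ⋆[ℂ] E →ₗ[ℂ] C
  mul_lsmul : ∀ b b' x, lsmul (b * b') x = lsmul b (lsmul b' x)
  rsmul_mul : ∀ x c c', rsmul x (c * c') = rsmul (rsmul x c) c'
  lsmul_rsmul : ∀ b x c, rsmul (lsmul b x) c = lsmul b (rsmul x c)
  linner_lsmul : ∀ b x y, linner (lsmul b x) y = b * linner x y
  rinner_rsmul : ∀ x y c, rinner x (rsmul y c) = rinner x y * c
  star_linner : ∀ x y, star (linner x y) = linner y x
  star_rinner : ∀ x y, star (rinner x y) = rinner y x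
  linner_self_nonneg : ∀ x, ∃ b : B, linner x x = b * star b
  rinner_self_nonneg : ∀ x, ∃ c : C, rinner x x = star c * c
  norm_linner_self : ∀ x, ‖linner x x‖ = ‖x‖ ^ 2
  norm_rinner_self : ∀ x, ‖rinner x x‖ = ‖x‖ ^ 2
  lsmul_linner : ∀ x y z, lsmul (linner x y) z = rsmul x (rinner y z)

section Module

variable {G : Type uG} [Group G] [TopologicalSpace G] [IsTopologicalGroup G]
  [LocallyCompactSpace G] [MeasurableSpace G] [BorelSpace G]
variable {A : Type uA} [NonUnitalCStarAlgebra A]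
variable {H : Type uH} [NormedAddCommGroup H] [InnerProductSpace ℂ H] [CompleteSpace H]

/-- The Hilbert `A^G`-`A ⋊_{α,r} G`-bimodule `𝓕(S)`: a completion of the subspace `S` of `A` with
respect to the bimodule structure
`⟨⟨ξ, η⟩⟩(t) = Δ(t)^{-1/2} ξ* α_t(η)`, `ξ * φ = ∫ Δ(t)^{-1/2} α_t(ξ φ(t⁻¹)) dt`,
`_{A^G}⟨ξ, η⟩ = ∫^su α_t(ξ η*) dt`, `m · ξ = m ξ`,
i.e. a complete Hilbert bimodule together with a linear map of `S` onto a dense subspace which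
intertwines these operations (the actions as far as they do not lead out of `S`). -/
structure FModule (α : G →* (A ≃⋆ₐ[ℂ] A)) (μ : Measure G) (π : A →⋆ₙₐ[ℂ] (H →L[ℂ] H))
    (S : Submodule ℂ A) where
  /-- the completed space -/
  E : Type uA
  [normedAddCommGroup : NormedAddCommGroup E]
  [normedSpace : NormedSpace ℂ E]
  [completeSpace : CompleteSpace E]
  /-- its Hilbert bimodule structure -/
  bimod : HilbertBimodule (fixedPointAlgebra α μ S) (reducedCrossedProduct α μ π) E
  /-- the canonical map of `S` into its completion -/
  ι : S →ₗ[ℂ] E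
  dense_ι : DenseRange ι
  rinner_ι : ∀ ξ η : S,
    IsRegularOp α μ π (braket α (ξ : A) (η : A))
      (bimod.rinner (ι ξ) (ι η) : Lp H 2 μ →L[ℂ] Lp H 2 μ)
  linner_ι : ∀ ξ η : S,
    HasStrictIntegral μ (fun t => α t ((ξ : A) * star (η : A)))
      (bimod.linner (ι ξ) (ι η) : 𝓜(ℂ, A))
  rsmul_ι : ∀ (ξ : S) (φ : G → A) (T : reducedCrossedProduct α μ π), MemL1Δ μ φ →
    IsRegularOp α μ π φ (T : Lp H 2 μ →L[ℂ] Lp H 2 μ) →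
    ∀ h : conv α μ (ξ : A) φ ∈ S, bimod.rsmul (ι ξ) T = ι ⟨conv α μ (ξ : A) φ, h⟩
  lsmul_ι : ∀ (m : fixedPointAlgebra α μ S) (ξ : S),
    ∀ h : (m : 𝓜(ℂ, A)).fst (ξ : A) ∈ S, bimod.lsmul m (ι ξ) = ι ⟨(m : 𝓜(ℂ, A)).fst (ξ : A), h⟩

attribute [instance] FModule.normedAddCommGroup FModule.normedSpace FModule.completeSpace

/-- `U` is the canonical isomorphism of Hilbert bimodules `𝓕(S) ≅ 𝓕(S')` for `S ⊆ S'`: the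
coefficient algebras coincide, `U` extends the inclusion of `S` into `S'`, and
it preserves both actions and both inner products. -/
structure IsCanonicalIso {α : G →* (A ≃⋆ₐ[ℂ] A)} {μ : Measure G} {π : A →⋆ₙₐ[ℂ] (H →L[ℂ] H)}
    {S S' : Submodule ℂ A} (h : S ≤ S') (X : FModule α μ π S) (X' : FModule α μ π S')
    (U : X.E ≃ₗᵢ[ℂ] X'.E) : Prop where
  fixedPointAlgebra_eq : fixedPointAlgebra α μ S = fixedPointAlgebra α μ S'
  map_ι : ∀ ξ : S, U (X.ι ξ) = X'.ι ⟨ξ, h ξ.2⟩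
  map_rinner : ∀ x y, X'.bimod.rinner (U x) (U y) = X.bimod.rinner x y
  map_linner : ∀ x y,
    (X'.bimod.linner (U x) (U y) : 𝓜(ℂ, A)) = (X.bimod.linner x y : 𝓜(ℂ, A))
  map_rsmul : ∀ x c, U (X.bimod.rsmul x c) = X'.bimod.rsmul (U x) c
  map_lsmul : ∀ (m : 𝓜(ℂ, A)) (hm : m ∈ fixedPointAlgebra α μ S)
    (hm' : m ∈ fixedPointAlgebra α μ S') (x : X.E),
    U (X.bimod.lsmul ⟨m, hm⟩ x) = X'.bimod.lsmul ⟨m, hm'⟩ (U x)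

end Module

end RieffelProper

end

set_option linter.unusedSectionVars false
set_option linter.overlappingInstances false

namespace RieffelProper

/-! ### The modular function and its square root -/

section Modular

variable {G : Type uG} [Group G] [TopologicalSpace G] [IsTopologicalGroup G]
  [LocallyCompactSpace G]

/-! The abstract completions are realised by operators. For ξ in `R` the ket |ξ⟩ : L²(G, H) → H
sends f to ∫ Δ(u)^{-1/2} π(α_{u⁻¹}(ξ)) f(u) du. It is bounded because ‖|ξ⟩f‖² = ⟨f, λ_{⟨⟨ξ,ξ⟩⟩} f⟩.
Three identities translate the structure on `R` into operator products: |ξ⟩*|η⟩ = λ_{⟨⟨ξ,η⟩⟩}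
(`IsKet.adjoint_comp`), |ξ⟩ λ_φ = |ξ*φ⟩ (`IsKet.comp`), and |ξ⟩|η⟩* is the image of ∫^su α_t(ξη*) dt
under the extension of π to the multiplier algebra (`Admissible.exists_hasStrictIntegral`).

The third identity includes the existence of the strict integral. For a in `R`, the integrals over
compact K multiplied by a converge to ξ * ⟨⟨η, a⟩⟩, because ⟨⟨η, a⟩⟩ lies in L¹_Δ. Boundedness of
the kets bounds the integrals uniformly in K (`IsKet.norm_setIntegral_le`), so the convergence
passes from the dense subspace `R` to all of A.

Let E be the norm closure of the kets of `R` (`Admissible.ternary`) and C the reduced crossed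
product. Then E*E ⊆ C, EC ⊆ E and EE*E ⊆ E, so the closed span of EE* is a C*-algebra, and E is a
Hilbert bimodule over it and C (`exists_hilbertBimodule`). Pulling EE* back to the multipliers shows
that the closed span of the left inner products of S is already the generated C*-algebra, for each S
⊆ R whose kets are dense in E. This algebra does not depend on S (`Admissible.mem_leftSpan_iff`),
and the completion of S is a copy of E.

It remains to see that the kets of A₀ are dense in E (`Admissible.closure_ketSpace_spanMulStar`). An
approximate unit of C shows that EC is dense in E, so it suffices to approximate |ζ⟩ λ_φ with φ in
C_c(G, A). Replacing φ(t) by φ(t) α_t(η*) with η in R̃ turns this operator into |(ζ*φ)η*⟩, a ket of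
A₀, and η* may be chosen to act almost as a unit on the compact set of the α_{t⁻¹}(φ(t)).

Finally, the norm and both inner products on each completion are determined on the image of S by
data that do not mention S. The inclusions therefore extend to isometries preserving the inner
products, and such isometries preserve the actions automatically. -/

theorem modular_pos (t : G) : 0 < modular t :=
  NNReal.coe_pos.2 (Measure.modularCharacterFun_pos _)

theorem modular_mul (s t : G) : modular (s * t) = modular s * modular t := by
  simp only [modular, mul_inv_rev, Measure.modularCharacterFun_map_mul, NNReal.coe_mul]
  ring

theorem modular_one : modular (1 : G) = 1 := by
  simp [modular, Measure.modularCharacterFun_map_one]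

/-- The function `Δ^{-1/2}`. -/
noncomputable def modularRoot (t : G) : ℝ := modular t ^ (-1 / 2 : ℝ)

theorem modularRoot_pos (t : G) : 0 < modularRoot t := Real.rpow_pos_of_pos (modular_pos t) _

theorem modularRoot_ne_zero (t : G) : modularRoot t ≠ 0 := (modularRoot_pos t).ne'

theorem modularRoot_mul (s t : G) : modularRoot (s * t) = modularRoot s * modularRoot t := by
  rw [modularRoot, modular_mul, Real.mul_rpow (modular_pos s).le (modular_pos t).le]; rfl

theorem modularRoot_one : modularRoot (1 : G) = 1 := by
  simp [modularRoot, modular_one]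

theorem modularRoot_inv (t : G) : modularRoot t⁻¹ = (modularRoot t)⁻¹ := by
  refine eq_inv_of_mul_eq_one_left ?_
  rw [← modularRoot_mul, inv_mul_cancel, modularRoot_one]

theorem modular_rpow_half (t : G) : modular t ^ (1 / 2 : ℝ) = (modularRoot t)⁻¹ := by
  rw [modularRoot, ← Real.rpow_neg (modular_pos t).le]
  norm_num

theorem modularRoot_sq (t : G) : modularRoot t ^ 2 = (modular t)⁻¹ := by
  rw [modularRoot, ← Real.rpow_natCast, ← Real.rpow_mul (modular_pos t).le,
    ← Real.rpow_neg_one]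
  norm_num

variable [MeasurableSpace G] [BorelSpace G] (μ : Measure G) [μ.IsHaarMeasure]

theorem integral_comp_mul_right {f : G → ℝ} (hf : Continuous f) (h'f : HasCompactSupport f)
    (g : G) : ∫ x, f (x * g) ∂μ = (modular g)⁻¹ * ∫ x, f x ∂μ := by
  have h1 : ∫ x, f (x * g) ∂μ = ∫ x, f x ∂(Measure.map (· * g) μ) :=
    (integral_map (AEMeasurable.mul_const aemeasurable_id' _) hf.aestronglyMeasurable).symm
  have h2 : (modular g)⁻¹ = (Measure.modularCharacterFun g : ℝ) := by
    have h : modular g * (Measure.modularCharacterFun g : ℝ) = 1 := by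
      rw [modular, ← NNReal.coe_mul, ← Measure.modularCharacterFun_map_mul, inv_mul_cancel,
        Measure.modularCharacterFun_map_one, NNReal.coe_one]
    exact (eq_inv_of_mul_eq_one_right h).symm
  rw [h1, h2, Measure.modularCharacterFun_eq_haarScalarFactor μ g,
    Measure.integral_isMulLeftInvariant_eq_smul_of_hasCompactSupport _ μ hf h'f,
    integral_smul_nnreal_measure]
  rfl

/-- Δ(g) is the integral of a fixed bump function divided by the integral of its right translate by
g, and the latter depends continuously on g. -/
theorem continuous_modular : Continuous (modular : G → ℝ) := by
  borelize G
  let μ : Measure G := Measure.haar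
  obtain ⟨⟨f, f_cont⟩, f_comp, f_nonneg, f_one⟩ :
    ∃ f : C(G, ℝ), HasCompactSupport f ∧ 0 ≤ f ∧ f 1 ≠ 0 := exists_continuous_nonneg_pos 1
  have hne : ∫ x, f x ∂μ ≠ 0 :=
    ne_of_gt (f_cont.integral_pos_of_hasCompactSupport_nonneg_nonzero f_comp f_nonneg f_one)
  have hc : Continuous fun g : G => ∫ x, f (x * g) ∂μ := by
    refine continuous_iff_continuousAt.2 fun x₀ => ?_
    obtain ⟨t, t_comp, ht⟩ : ∃ t, IsCompact t ∧ t ∈ 𝓝 x₀ := exists_compact_mem_nhds x₀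
    have k'_comp : IsCompact ((fun p : G × G => p.1 * p.2⁻¹) '' (tsupport f ×ˢ t)) :=
      (IsCompact.prod f_comp t_comp).image (by fun_prop)
    refine ContinuousOn.continuousAt (s := t) ?_ ht
    refine continuousOn_integral_of_compact_support k'_comp
      (Continuous.continuousOn (by
        exact f_cont.comp (continuous_snd.mul continuous_fst))) fun p x hp hx => ?_
    contrapose! hx
    exact ⟨(x * p, p), ⟨subset_tsupport _ hx, hp⟩, by simp⟩
  have heq : (modular : G → ℝ) = fun g => (∫ x, f x ∂μ) / ∫ x, f (x * g) ∂μ := by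
    funext g
    rw [integral_comp_mul_right μ f_cont f_comp]
    have := (modular_pos g).ne'
    field_simp
  rw [heq]
  refine continuous_const.div hc fun g => ?_
  rw [integral_comp_mul_right μ f_cont f_comp]
  exact mul_ne_zero (inv_ne_zero (modular_pos g).ne') hne

@[fun_prop]
theorem continuous_modularRoot : Continuous (modularRoot : G → ℝ) :=
  continuous_modular.rpow_const fun t => Or.inl (modular_pos t).ne'

end Modular

theorem hasCompactSupport_comp_inv {G : Type*} [Group G] [TopologicalSpace G]
    [IsTopologicalGroup G] {E : Type*} [Zero E] {g : G → E} (hg : HasCompactSupport g) :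
    HasCompactSupport fun t => g t⁻¹ :=
  hg.comp_homeomorph (Homeomorph.inv G)

/-! ### Inversion in the Haar integral for compactly supported functions -/

section Inversion

variable {G : Type uG} [Group G] [TopologicalSpace G] [IsTopologicalGroup G]
  [LocallyCompactSpace G] [MeasurableSpace G] [BorelSpace G] (μ : Measure G) [μ.IsHaarMeasure]
variable {E : Type*} [NormedAddCommGroup E] [NormedSpace ℝ E] [CompleteSpace E]

/-- The change of variables `t ↦ t⁻¹` for continuous functions with compact support. -/
theorem integral_comp_inv_of_hasCompactSupport [T2Space G] {g : G → E} (hg : Continuous g)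
    (h'g : HasCompactSupport g) :
    ∫ t, g t⁻¹ ∂μ = ∫ t, modularRoot t ^ 2 • g t ∂μ := by
  obtain ⟨⟨f, f_cont⟩, f_comp, f_nonneg, f_one⟩ :
    ∃ f : C(G, ℝ), HasCompactSupport f ∧ 0 ≤ f ∧ f 1 ≠ 0 := exists_continuous_nonneg_pos 1
  change Continuous f at f_cont
  change HasCompactSupport f at f_comp
  have hne : ∫ x, f x ∂μ ≠ 0 :=
    ne_of_gt (f_cont.integral_pos_of_hasCompactSupport_nonneg_nonzero f_comp f_nonneg f_one)
  have hK : IsCompact (tsupport f ×ˢ ((fun p : G × G => p.1 * p.2⁻¹) '' (tsupport f ×ˢ tsupport g))) :=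
    IsCompact.prod f_comp ((IsCompact.prod f_comp h'g).image (by fun_prop))
  -- One double integral is evaluated in both orders. Integrating over y first gives the integral of
  -- g(t⁻¹) by left invariance; integrating over x first and translating produces f(yx), whose
  -- y-integral contributes the factor Δ(x)⁻¹. The nonzero integral of the auxiliary f then cancels.
  have key : ∫ x, ∫ y, f x • g (y⁻¹ * x) ∂μ ∂μ = ∫ y, ∫ x, f x • g (y⁻¹ * x) ∂μ ∂μ := by
    refine integral_integral_swap_of_hasCompactSupport (by fun_prop)
      (HasCompactSupport.intro hK fun p hp => ?_)
    contrapose! hp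
    have hp' : f p.1 • g (p.2⁻¹ * p.1) ≠ 0 := hp
    have h1 : f p.1 ≠ 0 := fun h => hp' (by rw [h, zero_smul])
    have h2 : g (p.2⁻¹ * p.1) ≠ 0 := fun h => hp' (by rw [h, smul_zero])
    exact ⟨subset_tsupport _ h1, (p.1, p.2⁻¹ * p.1),
      ⟨subset_tsupport _ h1, subset_tsupport _ h2⟩, by simp⟩
  have hL : ∫ x, ∫ y, f x • g (y⁻¹ * x) ∂μ ∂μ = (∫ x, f x ∂μ) • ∫ t, g t⁻¹ ∂μ := by
    have : ∀ x, ∫ y, f x • g (y⁻¹ * x) ∂μ = f x • ∫ t, g t⁻¹ ∂μ := fun x => by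
      rw [integral_smul, ← integral_mul_left_eq_self (fun y => g (y⁻¹ * x)) x]
      simp
    simp_rw [this]
    exact integral_smul_const _ _
  have hK' : IsCompact (((fun p : G × G => p.1 * p.2⁻¹) '' (tsupport f ×ˢ tsupport g)) ×ˢ tsupport g) :=
    ((IsCompact.prod f_comp h'g).image (by fun_prop)).prod h'g
  have hR : ∫ y, ∫ x, f x • g (y⁻¹ * x) ∂μ ∂μ =
      (∫ x, f x ∂μ) • ∫ t, modularRoot t ^ 2 • g t ∂μ := by
    have h1 : ∀ y, ∫ x, f x • g (y⁻¹ * x) ∂μ = ∫ x, f (y * x) • g x ∂μ := fun y => by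
      rw [← integral_mul_left_eq_self _ y]
      simp
    simp_rw [h1]
    rw [integral_integral_swap_of_hasCompactSupport (by fun_prop)
      (HasCompactSupport.intro hK' fun p hp => ?_)]
    · rw [← integral_smul]
      congr 1 with x
      rw [integral_smul_const, integral_comp_mul_right μ f_cont f_comp, modularRoot_sq, mul_comm,
        mul_smul]
    · contrapose! hp
      have hp' : f (p.1 * p.2) • g p.2 ≠ 0 := hp
      have h1 : f (p.1 * p.2) ≠ 0 := fun h => hp' (by rw [h, zero_smul])
      have h2 : g p.2 ≠ 0 := fun h => hp' (by rw [h, smul_zero])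
      exact ⟨⟨(p.1 * p.2, p.2), ⟨subset_tsupport _ h1, subset_tsupport _ h2⟩, by simp⟩,
        subset_tsupport _ h2⟩
  rw [hL, hR] at key
  exact smul_right_injective E hne key

end Inversion

/-! ### Approximation by continuous functions with compact support -/

section Approximation

variable {G : Type uG} [TopologicalSpace G]
  [LocallyCompactSpace G] [T2Space G] [MeasurableSpace G] [BorelSpace G] {μ : Measure G}
  [μ.Regular]
variable {E F : Type*} [NormedAddCommGroup E] [NormedSpace ℝ E]

/-- In a locally compact Hausdorff space the continuous functions with compact support are dense in
`Lᵖ` for `p < ∞` (without normality assumption on the space). -/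
theorem exists_hasCompactSupport_eLpNorm_sub_le {p : ENNReal} (hp : p ≠ ⊤) {f : G → E}
    (hf : MemLp f p μ) {ε : ENNReal} (hε : ε ≠ 0) :
    ∃ g : G → E, eLpNorm (f - g) p μ ≤ ε ∧ Continuous g ∧ MemLp g p μ ∧ HasCompactSupport g := by
  apply hf.induction_dense hp _ _ _ _ hε
  rotate_left
  · rintro f g ⟨f_cont, f_mem, hf⟩ ⟨g_cont, g_mem, hg⟩
    exact ⟨f_cont.add g_cont, f_mem.add g_mem, hf.add hg⟩
  · rintro f ⟨_, f_mem, _⟩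
    exact f_mem.aestronglyMeasurable
  intro c t ht htμ ε hε
  rcases exists_Lp_half E μ p hε with ⟨δ, δpos, hδ⟩
  obtain ⟨η, ηpos, hη⟩ := exists_eLpNorm_indicator_le (μ := μ) hp c δpos.ne'
  have hη_pos' : (0 : ENNReal) < η := ENNReal.coe_pos.2 ηpos
  obtain ⟨s, st, s_compact, s_closed, μs⟩ :=
    ht.exists_isCompact_isClosed_sdiff_lt htμ.ne hη_pos'.ne'
  have hsμ : μ s < ⊤ := (measure_mono st).trans_lt htμ
  -- The indicator of t is first replaced by that of a compact s inside it, then by a bump function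
  -- equal to 1 on s and supported in an open V only slightly larger than s.
  have I1 : eLpNorm ((s.indicator fun _ => c) - t.indicator fun _ => c) p μ ≤ δ := by
    rw [← eLpNorm_neg, neg_sub, ← Set.indicator_sdiff st]
    exact hη _ μs.le
  obtain ⟨V, sV, V_open, -, hV⟩ :=
    s_closed.measurableSet.exists_isOpen_sdiff_lt hsμ.ne hη_pos'.ne'
  obtain ⟨g, hgs, hgc, hgV, hg_range⟩ :=
    exists_continuousMap_one_of_isCompact_subset_isOpen s_compact V_open sV
  have hgz : ∀ x ∉ V, g x = 0 := fun x hx =>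
    image_eq_zero_of_notMem_tsupport fun h => hx (hgV h)
  have hcs : HasCompactSupport fun x => g x • c := HasCompactSupport.smul_right (f := g) hgc
  have hcont : Continuous fun x => g x • c := by fun_prop
  have hmem : MemLp (fun x => g x • c) p μ := hcont.memLp_of_hasCompactSupport hcs
  have I2 : eLpNorm ((fun x => g x • c) - s.indicator fun _ => c) p μ ≤ δ := by
    refine (eLpNorm_mono (g := (V \ s).indicator fun _ => c) fun x => ?_).trans (hη _ hV.le)
    rw [Pi.sub_apply]
    by_cases hs : x ∈ s
    · simp [hgs hs, hs]
    by_cases hv : x ∈ V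
    · rw [Set.indicator_of_notMem hs, Set.indicator_of_mem (show x ∈ V \ s from ⟨hv, hs⟩), sub_zero,
        norm_smul, Real.norm_eq_abs, abs_of_nonneg (hg_range x).1]
      exact mul_le_of_le_one_left (norm_nonneg _) (hg_range x).2
    · simp [hgz x hv, hs]
  refine ⟨fun x => g x • c, ?_, hcont, hmem, hcs⟩
  have I3 := (hδ _ _ (hmem.aestronglyMeasurable.sub
    (aestronglyMeasurable_const.indicator s_closed.measurableSet))
    ((aestronglyMeasurable_const.indicator s_closed.measurableSet).sub
      (aestronglyMeasurable_const.indicator ht)) I2 I1).le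
  rwa [sub_add_sub_cancel] at I3

/-- An integrable function is the limit, in mean and almost everywhere, of a sequence of continuous
functions with compact support. -/
theorem exists_seq_hasCompactSupport {φ : G → E} (hφ : Integrable φ μ) :
    ∃ u : ℕ → G → E, (∀ n, Continuous (u n) ∧ HasCompactSupport (u n)) ∧
      Tendsto (fun n => ∫ t, ‖φ t - u n t‖ ∂μ) atTop (𝓝 0) ∧
      ∀ᵐ t ∂μ, Tendsto (fun n => u n t) atTop (𝓝 (φ t)) := by
  have hpos : ∀ n : ℕ, ENNReal.ofReal (1 / (n + 1)) ≠ 0 := fun n =>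
    (ENNReal.ofReal_pos.2 (by positivity)).ne'
  choose v hv using fun n : ℕ => exists_hasCompactSupport_eLpNorm_sub_le ENNReal.one_ne_top
    (memLp_one_iff_integrable.2 hφ) (hpos n)
  have hvi : ∀ n, Integrable (v n) μ := fun n => memLp_one_iff_integrable.1 (hv n).2.2.1
  have hnorm : ∀ n, eLpNorm (φ - v n) 1 μ = ENNReal.ofReal (∫ t, ‖φ t - v n t‖ ∂μ) := fun n => by
    rw [eLpNorm_one_eq_lintegral_enorm]
    exact (ofReal_integral_norm_eq_lintegral_enorm (hφ.sub (hvi n))).symm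
  have hlim : Tendsto (fun n => ∫ t, ‖φ t - v n t‖ ∂μ) atTop (𝓝 0) := by
    refine squeeze_zero (fun n => integral_nonneg fun t => norm_nonneg _) (fun n => ?_)
      tendsto_one_div_add_atTop_nhds_zero_nat
    have h := (hv n).1
    rw [hnorm] at h
    exact (ENNReal.ofReal_le_ofReal_iff (by positivity)).1 h
  have hm : TendstoInMeasure μ v atTop φ := by
    refine tendstoInMeasure_of_tendsto_eLpNorm one_ne_zero
      (fun n => (hvi n).aestronglyMeasurable) hφ.aestronglyMeasurable ?_
    simp_rw [eLpNorm_sub_comm _ φ, hnorm]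
    simpa using ENNReal.tendsto_ofReal hlim
  obtain ⟨ns, hns, hae⟩ := hm.exists_seq_tendsto_ae
  exact ⟨fun n => v (ns n), fun n => ⟨(hv _).2.1, (hv _).2.2.2⟩, hlim.comp hns.tendsto_atTop, hae⟩

/-- Composition of an integrable function with a jointly continuous function of two variables. -/
theorem aestronglyMeasurable_continuous_comp [TopologicalSpace F] [PseudoMetrizableSpace F] [Zero F]
    {Φ : G → E → F} (hΦ : Continuous fun p : G × E => Φ p.1 p.2) (h0 : ∀ t, Φ t 0 = 0)
    {φ : G → E} (hφ : Integrable φ μ) : AEStronglyMeasurable (fun t => Φ t (φ t)) μ := by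
  -- No countability is assumed on `G` or `E`, so joint continuity of Φ is not used as joint
  -- measurability. The composite is instead an almost everywhere limit of continuous functions;
  -- `h0` keeps their supports compact.
  obtain ⟨u, hu, -, hae⟩ := exists_seq_hasCompactSupport hφ
  refine aestronglyMeasurable_of_tendsto_ae atTop (f := fun n t => Φ t (u n t)) (fun n => ?_) ?_
  · have hc : Continuous fun t => Φ t (u n t) := hΦ.comp (continuous_id.prodMk (hu n).1)
    refine (hc.stronglyMeasurable_of_hasCompactSupport ?_).aestronglyMeasurable
    refine HasCompactSupport.intro (hu n).2 fun t ht => ?_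
    rw [image_eq_zero_of_notMem_tsupport ht, h0]
  · filter_upwards [hae] with t ht
    exact ((hΦ.comp (continuous_const.prodMk continuous_id)).tendsto (φ t)).comp ht

end Approximation

end RieffelProper

namespace RieffelProper

/-! ### Convergence in mean from convergence almost everywhere -/

theorem eLpNorm_one_sub_eq_ofReal {X E : Type*} [MeasurableSpace X] {μ : Measure X}
    [NormedAddCommGroup E] {f g : X → E} (hf : Integrable f μ) (hg : Integrable g μ) :
    eLpNorm (f - g) 1 μ = ENNReal.ofReal (∫ t, ‖f t - g t‖ ∂μ) := by
  rw [eLpNorm_one_eq_lintegral_enorm]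
  exact (ofReal_integral_norm_eq_lintegral_enorm (hf.sub hg)).symm

/-- A sequence which is Cauchy in mean and converges almost everywhere converges in mean. -/
theorem tendsto_integral_of_cauchy_of_ae {X E E' : Type*} [MeasurableSpace X] {μ : Measure X}
    [NormedAddCommGroup E] [NormedSpace ℝ E] [CompleteSpace E] [NormedAddCommGroup E']
    {w : ℕ → X → E} {u : ℕ → X → E'} {f : X → E} {g : X → E'}
    (hw : ∀ n, Integrable (w n) μ) (hu : ∀ n, Integrable (u n) μ) (hg : Integrable g μ)
    (hlim : Tendsto (fun n => ∫ t, ‖g t - u n t‖ ∂μ) atTop (𝓝 0))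
    (hae : ∀ᵐ t ∂μ, Tendsto (fun n => w n t) atTop (𝓝 (f t)))
    (hwu : ∀ m n, ∫ t, ‖w m t - w n t‖ ∂μ = ∫ t, ‖u m t - u n t‖ ∂μ) :
    Integrable f μ ∧ Tendsto (fun n => ∫ t, w n t ∂μ) atTop (𝓝 (∫ t, f t ∂μ)) := by
  have hmeas : AEStronglyMeasurable f μ :=
    aestronglyMeasurable_of_tendsto_ae atTop (fun n => (hw n).aestronglyMeasurable) hae
  have hbound : ∀ ε : ℝ, 0 < ε → ∀ᶠ m in atTop,
      eLpNorm (f - w m) 1 μ ≤ ENNReal.ofReal ε := by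
    intro ε hε
    have hev := hlim.eventually (gt_mem_nhds (half_pos hε))
    filter_upwards [hev] with m hm
    -- Fatou's lemma bounds f − w_m in mean by the differences w_n − w_m, which `hwu` converts into
    -- differences of the convergent sequence u.
    have hF := Lp.eLpNorm_lim_le_liminf_eLpNorm (p := 1) (f := fun n => w n - w m)
      (fun n => ((hw n).sub (hw m)).aestronglyMeasurable) (f - w m)
      (by filter_upwards [hae] with t ht; exact ht.sub_const _)
    refine hF.trans (liminf_le_of_frequently_le' (Eventually.frequently ?_))
    filter_upwards [hev] with n hn
    rw [eLpNorm_one_sub_eq_ofReal (hw n) (hw m), hwu]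
    refine ENNReal.ofReal_le_ofReal ?_
    have h3 : ∫ t, ‖u n t - u m t‖ ∂μ ≤ ∫ t, (‖g t - u n t‖ + ‖g t - u m t‖) ∂μ := by
      refine integral_mono ((hu n).sub (hu m)).norm
        ((hg.sub (hu n)).norm.add (hg.sub (hu m)).norm) fun t => ?_
      simp only [norm_sub_rev (g t) (u n t)]
      exact norm_sub_le_norm_sub_add_norm_sub _ _ _
    have h4 := integral_add (hg.sub (hu n)).norm (hg.sub (hu m)).norm
    simp only [Pi.sub_apply] at h4
    linarith
  have hint : Integrable f μ := by
    obtain ⟨m, hm⟩ := (hbound 1 one_pos).exists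
    have h1 : MemLp (f - w m) 1 μ :=
      ⟨hmeas.sub (hw m).aestronglyMeasurable, hm.trans_lt ENNReal.ofReal_lt_top⟩
    have := (memLp_one_iff_integrable.1 h1).add (hw m)
    rwa [sub_add_cancel] at this
  refine ⟨hint, tendsto_integral_of_L1' _ hint.aestronglyMeasurable (Eventually.of_forall hw) ?_⟩
  refine ENNReal.tendsto_nhds_zero.2 fun ε hε => ?_
  obtain ⟨r, hr, hrε⟩ : ∃ r : ℝ, 0 < r ∧ ENNReal.ofReal r ≤ ε := by
    by_cases h : ε = ⊤
    · exact ⟨1, one_pos, by simp [h]⟩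
    · exact ⟨ε.toReal, ENNReal.toReal_pos hε.ne' h, ENNReal.ofReal_toReal_le⟩
  filter_upwards [hbound r hr] with m hm
  rw [eLpNorm_sub_comm]
  exact hm.trans hrε

theorem tendsto_integral_of_tendsto_integral_norm_sub {X E : Type*} [MeasurableSpace X]
    {μ : Measure X} [NormedAddCommGroup E] [NormedSpace ℝ E] {u : ℕ → X → E} {g : X → E}
    (hu : ∀ n, Integrable (u n) μ) (hg : Integrable g μ)
    (hlim : Tendsto (fun n => ∫ t, ‖g t - u n t‖ ∂μ) atTop (𝓝 0)) :
    Tendsto (fun n => ∫ t, u n t ∂μ) atTop (𝓝 (∫ t, g t ∂μ)) := by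
  refine tendsto_iff_norm_sub_tendsto_zero.2 ?_
  refine squeeze_zero (fun n => norm_nonneg _) (fun n => ?_) hlim
  rw [norm_sub_rev, ← integral_sub hg (hu n)]
  exact norm_integral_le_integral_norm _

/-! ### Inversion for null sets and integrable functions -/

section Reflection

variable {G : Type uG} [Group G] [TopologicalSpace G] [IsTopologicalGroup G]
  [LocallyCompactSpace G] [T2Space G] [MeasurableSpace G] [BorelSpace G] (μ : Measure G)
  [μ.IsHaarMeasure] [μ.Regular]

/-- Inner regularity reduces the open set V⁻¹ to a compact subset. A bump function between the two
is integrable, and the change of variables t ↦ t⁻¹ applies to it. -/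
theorem measure_inv_le_of_isOpen {V : Set G} (hV : IsOpen V) {c : ℝ}
    (hc : ∀ t ∈ V, modularRoot t ^ 2 ≤ c) : μ V⁻¹ ≤ ENNReal.ofReal c * μ V := by
  rw [(hV.inv).measure_eq_iSup_isCompact μ]
  refine iSup_le fun K => iSup_le fun hKV => iSup_le fun hK => ?_
  obtain ⟨f, hf1, hfc, hfV, hf01⟩ :=
    exists_continuousMap_one_of_isCompact_subset_isOpen hK hV.inv hKV
  have hfc' : HasCompactSupport f := hfc
  have hcont : Continuous f := f.continuous
  have h1 : μ K ≤ ENNReal.ofReal (∫ t, f t ∂μ) := by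
    rw [ofReal_integral_eq_lintegral_ofReal (hcont.integrable_of_hasCompactSupport hfc')
      (Eventually.of_forall fun t => (hf01 t).1), ← lintegral_indicator_one hK.measurableSet]
    refine lintegral_mono fun t => ?_
    by_cases ht : t ∈ K
    · simp [ht, hf1 ht]
    · simp [ht]
  have h2 : ∫ t, f t ∂μ = ∫ t, modularRoot t ^ 2 * f t⁻¹ ∂μ := by
    have := integral_comp_inv_of_hasCompactSupport μ (g := fun t => f t⁻¹)
      (hcont.comp continuous_inv) (hasCompactSupport_comp_inv hfc')
    simpa using this
  have hcs : HasCompactSupport fun t => modularRoot t ^ 2 * f t⁻¹ :=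
    (hasCompactSupport_comp_inv hfc').mul_left
  refine h1.trans ?_
  rw [h2, ofReal_integral_eq_lintegral_ofReal
    (Continuous.integrable_of_hasCompactSupport (by fun_prop) hcs)
    (Eventually.of_forall fun t => mul_nonneg (sq_nonneg _) (hf01 _).1),
    ← lintegral_indicator_const hV.measurableSet]
  refine lintegral_mono fun t => ?_
  by_cases ht : t ∈ V
  · rw [Set.indicator_of_mem ht]
    refine ENNReal.ofReal_le_ofReal ?_
    exact (mul_le_of_le_one_right (sq_nonneg _) (hf01 _).2).trans (hc t ht)
  · have h0 : f t⁻¹ = 0 := image_eq_zero_of_notMem_tsupport fun h => ht (by simpa using hfV h)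
    simp [ht, h0]

/-- Needed to carry convergence almost everywhere through t ↦ t⁻¹. The set N is cut into pieces on
which Δ⁻¹ is below n; outer regularity encloses N in an open set of measure below ε, and the
preceding bound gives at most nε for each inverted piece. -/
theorem measure_inv_eq_zero {N : Set G} (hN : μ N = 0) : μ N⁻¹ = 0 := by
  have hU : N⁻¹ = ⋃ n : ℕ, (N ∩ {t | modularRoot t ^ 2 < n})⁻¹ := by
    ext t
    simp only [Set.mem_inv, Set.mem_iUnion, Set.mem_inter_iff, Set.mem_ofPred_eq]
    refine ⟨fun h => ?_, fun ⟨n, h⟩ => h.1⟩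
    obtain ⟨n, hn⟩ := exists_nat_gt (modularRoot t⁻¹ ^ 2)
    exact ⟨n, h, hn⟩
  rw [hU, measure_iUnion_null_iff]
  intro n
  have hle : ∀ ε : NNReal, 0 < ε → μ (N ∩ {t | modularRoot t ^ 2 < n})⁻¹ ≤ n * ε := by
    intro ε hε
    obtain ⟨V, hNV, hV, hμV⟩ := Set.exists_isOpen_lt_of_lt N ε (by rw [hN]; exact_mod_cast hε)
    have hW : IsOpen (V ∩ {t : G | modularRoot t ^ 2 < n}) :=
      hV.inter (isOpen_lt (by fun_prop) continuous_const)
    calc μ (N ∩ {t | modularRoot t ^ 2 < n})⁻¹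
        ≤ μ (V ∩ {t | modularRoot t ^ 2 < n})⁻¹ :=
          measure_mono (Set.inv_subset_inv.2 (Set.inter_subset_inter_left _ hNV))
      _ ≤ ENNReal.ofReal n * μ (V ∩ {t | modularRoot t ^ 2 < n}) :=
          measure_inv_le_of_isOpen μ hW fun t ht => ht.2.le
      _ ≤ n * ε := by
          rw [ENNReal.ofReal_natCast]
          gcongr
          exact (measure_mono Set.inter_subset_left).trans hμV.le
  by_contra hne
  rcases Nat.eq_zero_or_pos n with rfl | hn
  · have := hle 1 one_pos
    simp at this
    exact hne (by simpa using this)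
  · obtain ⟨ε, hε, hlt⟩ := ENNReal.exists_nnreal_pos_mul_lt (a := n) (by simp) hne
    have := hle ε hε
    rw [mul_comm] at this
    exact absurd hlt (not_lt.2 this)

variable {E : Type*} [NormedAddCommGroup E] [NormedSpace ℝ E] [CompleteSpace E]

/-- The change of variables `t ↦ t⁻¹` for integrable functions. -/
theorem integrable_comp_inv_and_integral_eq {φ : G → E}
    (hφ : Integrable (fun t => modularRoot t ^ 2 • φ t) μ) :
    Integrable (fun t => φ t⁻¹) μ ∧ ∫ t, φ t⁻¹ ∂μ = ∫ t, modularRoot t ^ 2 • φ t ∂μ := by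
  -- The approximants are for Δ⁻¹φ. Dividing by Δ⁻¹ and inverting is isometric in mean on C_c, so
  -- the transformed sequence is Cauchy and its almost everywhere limit φ(t⁻¹) is also its limit in
  -- mean.
  obtain ⟨u, hu, hlim, hae⟩ := exists_seq_hasCompactSupport hφ
  have hd : ∀ t : G, modularRoot t ^ 2 ≠ 0 := fun t => pow_ne_zero 2 (modularRoot_ne_zero t)
  have hcv : ∀ n, Continuous fun t : G => (modularRoot t ^ 2)⁻¹ • u n t := fun n =>
    Continuous.smul (Continuous.inv₀ (by fun_prop) hd) (hu n).1
  have hsv : ∀ n, HasCompactSupport fun t : G => (modularRoot t ^ 2)⁻¹ • u n t := fun n =>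
    HasCompactSupport.smul_left (hu n).2
  have hui : ∀ n, Integrable (u n) μ := fun n => (hu n).1.integrable_of_hasCompactSupport (hu n).2
  have hwi : ∀ n, Integrable (fun t : G => (modularRoot t⁻¹ ^ 2)⁻¹ • u n t⁻¹) μ := fun n =>
    Continuous.integrable_of_hasCompactSupport (f := fun t : G => (modularRoot t⁻¹ ^ 2)⁻¹ • u n t⁻¹)
      (Continuous.comp (g := fun t : G => (modularRoot t ^ 2)⁻¹ • u n t) (hcv n) continuous_inv)
      (hasCompactSupport_comp_inv (g := fun t : G => (modularRoot t ^ 2)⁻¹ • u n t) (hsv n))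
  have hwae : ∀ᵐ t ∂μ, Tendsto (fun n => (modularRoot t⁻¹ ^ 2)⁻¹ • u n t⁻¹) atTop (𝓝 (φ t⁻¹)) := by
    have h1 : ∀ᵐ t ∂μ, Tendsto (fun n => u n t⁻¹) atTop (𝓝 (modularRoot t⁻¹ ^ 2 • φ t⁻¹)) := by
      rw [ae_iff] at hae ⊢
      exact measure_inv_eq_zero μ hae
    filter_upwards [h1] with t ht
    have := ht.const_smul (modularRoot t⁻¹ ^ 2)⁻¹
    rwa [smul_smul, inv_mul_cancel₀ (hd _), one_smul] at this
  have hww : ∀ m n, ∫ t, ‖(modularRoot t⁻¹ ^ 2)⁻¹ • u m t⁻¹ -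
      (modularRoot t⁻¹ ^ 2)⁻¹ • u n t⁻¹‖ ∂μ = ∫ t, ‖u m t - u n t‖ ∂μ := fun m n => by
    have h := integral_comp_inv_of_hasCompactSupport μ
      (g := fun t => ‖(modularRoot t ^ 2)⁻¹ • u m t - (modularRoot t ^ 2)⁻¹ • u n t‖)
      ((hcv m).sub (hcv n)).norm ((hsv m).sub (hsv n)).norm
    refine h.trans (integral_congr_ae (Eventually.of_forall fun t => ?_))
    simp only [smul_eq_mul]
    rw [← smul_sub, norm_smul, norm_inv, Real.norm_of_nonneg (sq_nonneg _),
      mul_inv_cancel_left₀ (hd t)]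
  have hI : ∀ n, ∫ t, (modularRoot t⁻¹ ^ 2)⁻¹ • u n t⁻¹ ∂μ = ∫ t, u n t ∂μ := fun n => by
    have h := integral_comp_inv_of_hasCompactSupport μ (hcv n) (hsv n)
    refine h.trans (integral_congr_ae (Eventually.of_forall fun t => ?_))
    simp only
    rw [smul_smul, mul_inv_cancel₀ (hd t), one_smul]
  obtain ⟨hint, hlim'⟩ := tendsto_integral_of_cauchy_of_ae hwi hui hφ hlim hwae hww
  refine ⟨hint, tendsto_nhds_unique hlim' ?_⟩
  simp only [hI]
  exact tendsto_integral_of_tendsto_integral_norm_sub hui hφ hlim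

end Reflection

/-! ### Bump functions concentrated at the identity -/

section Bump

variable {G : Type uG} [Group G] [TopologicalSpace G] [IsTopologicalGroup G]
  [LocallyCompactSpace G] [T2Space G] [MeasurableSpace G] [BorelSpace G] (μ : Measure G)
  [μ.IsHaarMeasure]

omit [T2Space G] in
theorem exists_bump {U : Set G} (hU : U ∈ 𝓝 (1 : G)) :
    ∃ ψ : G → ℝ, Continuous ψ ∧ HasCompactSupport ψ ∧ (∀ t, 0 ≤ ψ t) ∧ (∀ t ∉ U, ψ t = 0) ∧
      ∫ t, ψ t ∂μ = 1 := by
  obtain ⟨f, hf1, hfc, hfV, hf01⟩ := exists_continuousMap_one_of_isCompact_subset_isOpen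
    (isCompact_singleton (x := (1 : G))) isOpen_interior
    (Set.singleton_subset_iff.2 (mem_interior_iff_mem_nhds.2 hU))
  have hfc' : HasCompactSupport f := hfc
  have hpos : 0 < ∫ t, f t ∂μ :=
    f.continuous.integral_pos_of_hasCompactSupport_nonneg_nonzero hfc' (fun t => (hf01 t).1)
      (x := 1) (by rw [hf1 rfl]; simp)
  refine ⟨fun t => (∫ t, f t ∂μ)⁻¹ * f t, by fun_prop, hfc'.mul_left,
    fun t => mul_nonneg (inv_nonneg.2 hpos.le) (hf01 t).1, fun t ht => ?_, ?_⟩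
  · change _ * f t = 0
    rw [image_eq_zero_of_notMem_tsupport fun h => ht (interior_subset (hfV h)), mul_zero]
  · rw [integral_const_mul, inv_mul_cancel₀ hpos.ne']

variable {μ}

omit [IsTopologicalGroup G] [LocallyCompactSpace G] [T2Space G] in
theorem norm_integral_smul_sub_le {E : Type*} [NormedAddCommGroup E] [NormedSpace ℝ E]
    [CompleteSpace E] {F : G → E} (hF : Continuous F) {ε : ℝ} {U : Set G}
    (hU : ∀ t ∈ U, ‖F t - F 1‖ ≤ ε) {ψ : G → ℝ} (hψ : Continuous ψ) (hψc : HasCompactSupport ψ)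
    (h0 : ∀ t, 0 ≤ ψ t) (hψU : ∀ t ∉ U, ψ t = 0) (h1 : ∫ t, ψ t ∂μ = 1) :
    ‖∫ t, ψ t • F t ∂μ - F 1‖ ≤ ε := by
  have hi : Integrable ψ μ := hψ.integrable_of_hasCompactSupport hψc
  have hI : F 1 = ∫ t, ψ t • F 1 ∂μ := by rw [integral_smul_const, h1, one_smul]
  have hsm : Integrable (fun t => ψ t • F t) μ :=
    (hψ.smul hF).integrable_of_hasCompactSupport hψc.smul_right
  nth_rw 1 [hI]
  rw [← integral_sub hsm (hi.smul_const _)]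
  calc ‖∫ t, (ψ t • F t - ψ t • F 1) ∂μ‖ ≤ ∫ t, ψ t * ε ∂μ := by
        refine norm_integral_le_of_norm_le (hi.mul_const _) (Eventually.of_forall fun t => ?_)
        rw [← smul_sub, norm_smul, Real.norm_of_nonneg (h0 t)]
        by_cases ht : t ∈ U
        · exact mul_le_mul_of_nonneg_left (hU t ht) (h0 t)
        · simp [hψU t ht]
    _ = ε := by rw [integral_mul_const, h1, one_mul]

end Bump

end RieffelProper

namespace RieffelProper

/-! ### The action and the representation -/

section Action

variable {G : Type uG} [Group G] [TopologicalSpace G]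
variable {A : Type uA} [NonUnitalCStarAlgebra A]
variable {H : Type uH} [NormedAddCommGroup H] [InnerProductSpace ℂ H] [CompleteSpace H]
variable {α : G →* (A ≃⋆ₐ[ℂ] A)}

theorem norm_action (α : G →* (A ≃⋆ₐ[ℂ] A)) (t : G) (a : A) : ‖α t a‖ = ‖a‖ :=
  NonUnitalStarAlgHom.norm_map (α t) (α t).injective a

theorem action_mul (α : G →* (A ≃⋆ₐ[ℂ] A)) (s t : G) (a : A) : α (s * t) a = α s (α t a) := by
  rw [map_mul]; rfl

theorem action_one (α : G →* (A ≃⋆ₐ[ℂ] A)) (a : A) : α 1 a = a := by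
  rw [map_one]; rfl

theorem action_real_smul (α : G →* (A ≃⋆ₐ[ℂ] A)) (t : G) (r : ℝ) (a : A) :
    α t (r • a) = r • α t a := by
  rw [RCLike.real_smul_eq_coe_smul (K := ℂ), map_smul, ← RCLike.real_smul_eq_coe_smul]

theorem rep_real_smul (π : A →⋆ₙₐ[ℂ] (H →L[ℂ] H)) (r : ℝ) (a : A) : π (r • a) = r • π a := by
  rw [RCLike.real_smul_eq_coe_smul (K := ℂ), map_smul, ← RCLike.real_smul_eq_coe_smul]

/-- Each α_t is isometric, so strong continuity upgrades to joint continuity. -/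
theorem continuous_action (hα : ∀ a : A, Continuous fun t => α t a) {X : Type*}
    [TopologicalSpace X] {f : X → G} {g : X → A} (hf : Continuous f) (hg : Continuous g) :
    Continuous fun x => α (f x) (g x) := by
  refine continuous_iff_continuousAt.2 fun x₀ => ?_
  rw [ContinuousAt, tendsto_iff_norm_sub_tendsto_zero]
  have h1 : Tendsto (fun x => ‖g x - g x₀‖) (𝓝 x₀) (𝓝 0) :=
    tendsto_iff_norm_sub_tendsto_zero.1 (hg.tendsto x₀)
  have h2 : Tendsto (fun x => ‖α (f x) (g x₀) - α (f x₀) (g x₀)‖) (𝓝 x₀) (𝓝 0) :=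
    tendsto_iff_norm_sub_tendsto_zero.1 (((hα (g x₀)).comp hf).tendsto x₀)
  refine squeeze_zero (fun x => norm_nonneg _) (fun x => ?_) (by simpa using h1.add h2)
  calc ‖α (f x) (g x) - α (f x₀) (g x₀)‖
      ≤ ‖α (f x) (g x) - α (f x) (g x₀)‖ + ‖α (f x) (g x₀) - α (f x₀) (g x₀)‖ :=
        norm_sub_le_norm_sub_add_norm_sub _ _ _
    _ = _ := by rw [← map_sub, norm_action]

theorem norm_rep_apply_le (π : A →⋆ₙₐ[ℂ] (H →L[ℂ] H)) (a : A) (h : H) : ‖π a h‖ ≤ ‖a‖ * ‖h‖ :=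
  (ContinuousLinearMap.le_opNorm _ _).trans
    (mul_le_mul_of_nonneg_right (NonUnitalStarAlgHom.norm_apply_le π a) (norm_nonneg _))

theorem continuous_rep (π : A →⋆ₙₐ[ℂ] (H →L[ℂ] H)) : Continuous π :=
  AddMonoidHomClass.continuous_of_bound π 1 fun a => by
    simpa using NonUnitalStarAlgHom.norm_apply_le π a

theorem continuous_rep_apply (π : A →⋆ₙₐ[ℂ] (H →L[ℂ] H)) {X : Type*}
    [TopologicalSpace X] {f : X → A} {g : X → H} (hf : Continuous f) (hg : Continuous g) :
    Continuous fun x => π (f x) (g x) :=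
  ((continuous_rep π).comp hf).clm_apply hg

theorem inner_rep_left (π : A →⋆ₙₐ[ℂ] (H →L[ℂ] H)) (a : A) (x y : H) :
    inner ℂ (π a x) y = inner ℂ x (π (star a) y) := by
  rw [map_star, ContinuousLinearMap.star_eq_adjoint, ContinuousLinearMap.adjoint_inner_right]

theorem inner_rep_right (π : A →⋆ₙₐ[ℂ] (H →L[ℂ] H)) (a : A) (x y : H) :
    inner ℂ x (π a y) = inner ℂ (π (star a) x) y := by
  rw [inner_rep_left, star_star]

theorem rep_mul_apply (π : A →⋆ₙₐ[ℂ] (H →L[ℂ] H)) (a b : A) (x : H) :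
    π (a * b) x = π a (π b x) := by
  rw [map_mul]; rfl

end Action

/-! ### Continuous functions with compact support inside L² -/

section Cc

variable (G : Type uG) [TopologicalSpace G]
variable (H : Type uH) [NormedAddCommGroup H] [InnerProductSpace ℂ H]

/-- The continuous functions with compact support. -/
def ccSubmodule : Submodule ℂ (G → H) where
  carrier := {f | Continuous f ∧ HasCompactSupport f}
  add_mem' hf hg := ⟨hf.1.add hg.1, hf.2.add hg.2⟩
  zero_mem' := ⟨continuous_zero, HasCompactSupport.zero⟩
  smul_mem' c _ hf := ⟨hf.1.const_smul c, HasCompactSupport.smul_left (f := fun _ => c) hf.2⟩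

variable {G H}
variable [MeasurableSpace G] [BorelSpace G] (μ : Measure G) [IsFiniteMeasureOnCompacts μ]

theorem memLp_cc (f : ccSubmodule G H) : MemLp (f : G → H) 2 μ :=
  f.2.1.memLp_of_hasCompactSupport f.2.2

/-- The class in `L²` of a continuous function with compact support. -/
noncomputable def ccToLp : ccSubmodule G H →ₗ[ℂ] Lp H 2 μ where
  toFun f := (memLp_cc μ f).toLp
  map_add' _ _ := rfl
  map_smul' _ _ := rfl

theorem coeFn_ccToLp (f : ccSubmodule G H) : (ccToLp μ f : G → H) =ᵐ[μ] f :=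
  MemLp.coeFn_toLp (memLp_cc μ f)

theorem eq_ccToLp {f : ccSubmodule G H} {F : Lp H 2 μ} (h : (F : G → H) =ᵐ[μ] f) :
    F = ccToLp μ f :=
  Lp.ext (h.trans (coeFn_ccToLp μ f).symm)

theorem inner_ccToLp (f g : ccSubmodule G H) :
    inner ℂ (ccToLp μ f) (ccToLp μ g) = ∫ t, inner ℂ ((f : G → H) t) ((g : G → H) t) ∂μ := by
  rw [L2.inner_def]
  refine integral_congr_ae ?_
  filter_upwards [coeFn_ccToLp μ f, coeFn_ccToLp μ g] with t h1 h2
  rw [h1, h2]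

theorem norm_ccToLp_sq (f : ccSubmodule G H) :
    ‖ccToLp μ f‖ ^ 2 = ∫ t, ‖(f : G → H) t‖ ^ 2 ∂μ := by
  have h := inner_ccToLp μ f f
  simp only [inner_self_eq_norm_sq_to_K] at h
  have h2 : ((‖ccToLp μ f‖ ^ 2 : ℝ) : ℂ) = ((∫ t, ‖(f : G → H) t‖ ^ 2 ∂μ : ℝ) : ℂ) := by
    rw [← integral_complex_ofReal]
    push_cast
    exact h
  exact_mod_cast h2

variable {μ}

variable (μ) in
theorem denseRange_ccToLp [LocallyCompactSpace G] [T2Space G] [μ.Regular] :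
    DenseRange (ccToLp (H := H) μ) := by
  intro F
  refine Metric.mem_closure_iff.2 fun ε hε => ?_
  obtain ⟨g, hg, hgc, hgm, hgs⟩ := exists_hasCompactSupport_eLpNorm_sub_le (μ := μ)
    ENNReal.ofNat_ne_top (Lp.memLp F) (ENNReal.ofReal_pos.2 (half_pos hε)).ne'
  refine ⟨_, ⟨⟨g, hgc, hgs⟩, rfl⟩, ?_⟩
  rw [Lp.dist_def]
  have h : eLpNorm ((F : G → H) - ((ccToLp μ ⟨g, hgc, hgs⟩ : Lp H 2 μ) : G → H)) 2 μ =
      eLpNorm ((F : G → H) - g) 2 μ :=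
    eLpNorm_congr_ae ((EventuallyEq.refl _ _).sub (coeFn_ccToLp μ _))
  rw [h]
  refine (ENNReal.toReal_le_of_le_ofReal (half_pos hε).le hg).trans_lt (half_lt_self hε)

theorem clm_ext_cc [LocallyCompactSpace G] [T2Space G] [μ.Regular] {F : Type*}
    [NormedAddCommGroup F] [NormedSpace ℂ F] {S T : Lp H 2 μ →L[ℂ] F}
    (h : ∀ f : ccSubmodule G H, S (ccToLp μ f) = T (ccToLp μ f)) : S = T :=
  ContinuousLinearMap.coeFn_injective
    ((denseRange_ccToLp μ).equalizer S.continuous T.continuous (funext h))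

theorem exists_clm_of_denseRange {V N F : Type*} [AddCommGroup V] [Module ℂ V]
    [NormedAddCommGroup N] [NormedSpace ℂ N] [NormedAddCommGroup F] [NormedSpace ℂ F]
    [CompleteSpace F] {e : V →ₗ[ℂ] N} (he : DenseRange e) (L : V →ₗ[ℂ] F) {M : ℝ} (hM : 0 ≤ M)
    (h : ∀ f, ‖L f‖ ≤ M * ‖e f‖) : ∃ T : N →L[ℂ] F, (∀ f, T (e f) = L f) ∧ ‖T‖ ≤ M :=
  ⟨L.extendOfNorm e, fun f => LinearMap.extendOfNorm_eq he ⟨M, h⟩ f,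
    LinearMap.opNorm_extendOfNorm_le he hM h⟩

end Cc

/-! ### The regular representation of L¹(G, A) -/

section RegularRep

variable {G : Type uG} [Group G] [TopologicalSpace G] [IsTopologicalGroup G]
  [LocallyCompactSpace G] [T2Space G] [MeasurableSpace G] [BorelSpace G] {μ : Measure G}
  [μ.IsHaarMeasure] [μ.Regular]
variable {A : Type uA} [NonUnitalCStarAlgebra A]
variable {H : Type uH} [NormedAddCommGroup H] [InnerProductSpace ℂ H] [CompleteSpace H]
variable {α : G →* (A ≃⋆ₐ[ℂ] A)} {π : A →⋆ₙₐ[ℂ] (H →L[ℂ] H)}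

/-- The function `λ_φ f`. -/
noncomputable def regularFun (α : G →* (A ≃⋆ₐ[ℂ] A)) (μ : Measure G) (π : A →⋆ₙₐ[ℂ] (H →L[ℂ] H))
    (φ : G → A) (f : G → H) (t : G) : H :=
  ∫ s, π (α t⁻¹ (φ s)) (f (s⁻¹ * t)) ∂μ

omit [IsTopologicalGroup G] [LocallyCompactSpace G] [T2Space G] [μ.Regular] in
theorem isRegularOp_iff {φ : G → A} {T : Lp H 2 μ →L[ℂ] Lp H 2 μ} :
    IsRegularOp α μ π φ T ↔
      ∀ f : ccSubmodule G H, (T (ccToLp μ f) : G → H) =ᵐ[μ] regularFun α μ π φ f := by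
  refine ⟨fun h f => h f _ f.2.1 f.2.2 (coeFn_ccToLp μ f), fun h f F hf hfc hF => ?_⟩
  rw [eq_ccToLp μ (f := ⟨f, hf, hfc⟩) hF]
  exact h ⟨f, hf, hfc⟩

theorem IsRegularOp.unique {φ : G → A} {S T : Lp H 2 μ →L[ℂ] Lp H 2 μ}
    (hS : IsRegularOp α μ π φ S) (hT : IsRegularOp α μ π φ T) : S = T :=
  clm_ext_cc fun f =>
    Lp.ext ((isRegularOp_iff.1 hS f).trans (isRegularOp_iff.1 hT f).symm)

theorem exists_norm_le_of_cc (f : ccSubmodule G H) : ∃ M, 0 ≤ M ∧ ∀ t, ‖(f : G → H) t‖ ≤ M := by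
  obtain ⟨M, hM⟩ := f.2.1.bounded_above_of_compact_support f.2.2
  exact ⟨max M 0, le_max_right _ _, fun t => (hM t).trans (le_max_left _ _)⟩

theorem integrable_regularFun_integrand (hα : ∀ a : A, Continuous fun t => α t a) {φ : G → A}
    (hφ : Integrable φ μ) (f : ccSubmodule G H) (t : G) :
    Integrable (fun s => π (α t⁻¹ (φ s)) ((f : G → H) (s⁻¹ * t))) μ := by
  obtain ⟨M, -, hM⟩ := exists_norm_le_of_cc f
  have hf := f.2.1
  refine (hφ.norm.mul_const M).mono' ?_ (Eventually.of_forall fun s => ?_)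
  · refine aestronglyMeasurable_continuous_comp
      (Φ := fun s a => π (α t⁻¹ a) ((f : G → H) (s⁻¹ * t))) ?_ (fun s => by simp) hφ
    exact continuous_rep_apply π (continuous_action hα continuous_const continuous_snd)
      (by fun_prop)
  · refine (norm_rep_apply_le _ _ _).trans ?_
    rw [norm_action]
    gcongr
    exact hM _

theorem norm_regularFun_le {φ : G → A}
    (hφ : Integrable φ μ) {f : ccSubmodule G H} {M : ℝ} (hM : ∀ t, ‖(f : G → H) t‖ ≤ M) (t : G) :
    ‖regularFun α μ π φ f t‖ ≤ (∫ s, ‖φ s‖ ∂μ) * M := by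
  rw [← integral_mul_const]
  refine norm_integral_le_of_norm_le (hφ.norm.mul_const M) (Eventually.of_forall fun s => ?_)
  refine (norm_rep_apply_le _ _ _).trans ?_
  rw [norm_action]
  gcongr
  exact hM _

theorem regularFun_sub (hα : ∀ a : A, Continuous fun t => α t a) {φ ψ : G → A}
    (hφ : Integrable φ μ) (hψ : Integrable ψ μ) (f : ccSubmodule G H) (t : G) :
    regularFun α μ π (fun s => φ s - ψ s) f t =
      regularFun α μ π φ f t - regularFun α μ π ψ f t := by
  simp only [regularFun]
  rw [← integral_sub (integrable_regularFun_integrand hα hφ f t)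
    (integrable_regularFun_integrand hα hψ f t)]
  simp only [map_sub, sub_apply]

theorem IsRegularOp.sub (hα : ∀ a : A, Continuous fun t => α t a) {φ ψ : G → A}
    (hφ : Integrable φ μ) (hψ : Integrable ψ μ) {S T : Lp H 2 μ →L[ℂ] Lp H 2 μ}
    (hS : IsRegularOp α μ π φ S) (hT : IsRegularOp α μ π ψ T) :
    IsRegularOp α μ π (fun s => φ s - ψ s) (S - T) := by
  refine isRegularOp_iff.2 fun f => ?_
  rw [sub_apply]
  filter_upwards [Lp.coeFn_sub (S (ccToLp μ f)) (T (ccToLp μ f)), isRegularOp_iff.1 hS f,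
    isRegularOp_iff.1 hT f] with t h1 h2 h3
  rw [h1, Pi.sub_apply, h2, h3, regularFun_sub hα hφ hψ]

theorem continuous_regular_integrand (hα : ∀ a : A, Continuous fun t => α t a) {φ : G → A}
    (hφ : Continuous φ) {f : G → H} (hf : Continuous f) :
    Continuous fun p : G × G => π (α p.1⁻¹ (φ p.2)) (f (p.2⁻¹ * p.1)) :=
  continuous_rep_apply π (continuous_action hα (by fun_prop) (by fun_prop)) (by fun_prop)

theorem regularFun_mem_cc (hα : ∀ a : A, Continuous fun t => α t a) {φ : G → A}
    (hφ : Continuous φ) (hφc : HasCompactSupport φ) (f : ccSubmodule G H) :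
    regularFun α μ π φ f ∈ ccSubmodule G H := by
  refine ⟨?_, ?_⟩
  · rw [← continuousOn_univ]
    refine continuousOn_integral_of_compact_support (k := tsupport φ) hφc
      (continuous_regular_integrand hα hφ f.2.1).continuousOn fun p s _ hs => ?_
    rw [image_eq_zero_of_notMem_tsupport hs]
    simp
  · refine HasCompactSupport.intro
      (K := (fun p : G × G => p.1 * p.2) '' (tsupport φ ×ˢ tsupport (f : G → H)))
      ((IsCompact.prod hφc f.2.2).image (by fun_prop)) fun t ht => ?_
    refine integral_eq_zero_of_ae (Eventually.of_forall fun s => ?_)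
    by_contra hne
    apply ht
    have h1 : φ s ≠ 0 := fun h => hne (by simp [h])
    have h2 : (f : G → H) (s⁻¹ * t) ≠ 0 := fun h => hne (by simp [h])
    exact ⟨(s, s⁻¹ * t), ⟨subset_tsupport _ h1, subset_tsupport _ h2⟩, by simp⟩

/-- `λ_φ` as an operator on the continuous functions with compact support. -/
noncomputable def regularCc (hα : ∀ a : A, Continuous fun t => α t a) (π : A →⋆ₙₐ[ℂ] (H →L[ℂ] H))
    {φ : G → A} (hφ : Continuous φ) (hφc : HasCompactSupport φ) :
    ccSubmodule G H →ₗ[ℂ] ccSubmodule G H where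
  toFun f := ⟨regularFun α μ π φ f, regularFun_mem_cc hα hφ hφc f⟩
  map_add' f g := by
    ext t
    have hi := hφ.integrable_of_hasCompactSupport (μ := μ) hφc
    change ∫ s, π (α t⁻¹ (φ s)) ((f : G → H) (s⁻¹ * t) + (g : G → H) (s⁻¹ * t)) ∂μ = _
    simp only [map_add]
    exact integral_add (integrable_regularFun_integrand hα hi f t)
      (integrable_regularFun_integrand hα hi g t)
  map_smul' c f := by
    ext t
    change ∫ s, π (α t⁻¹ (φ s)) (c • (f : G → H) (s⁻¹ * t)) ∂μ = _
    simp only [map_smul]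
    exact integral_smul c _

/-- Fubini's theorem for the matrix coefficients of `λ_φ`. -/
theorem inner_regularFun (hα : ∀ a : A, Continuous fun t => α t a) {φ : G → A}
    (hφ : Continuous φ) (hφc : HasCompactSupport φ) (k f : ccSubmodule G H) :
    ∫ t, inner ℂ ((k : G → H) t) (regularFun α μ π φ f t) ∂μ =
      ∫ s, ∫ t, inner ℂ ((k : G → H) t) (π (α t⁻¹ (φ s)) ((f : G → H) (s⁻¹ * t))) ∂μ ∂μ := by
  have hi := hφ.integrable_of_hasCompactSupport (μ := μ) hφc
  rw [← integral_integral_swap_of_hasCompactSupport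
    (f := fun t s => (inner ℂ ((k : G → H) t) (π (α t⁻¹ (φ s)) ((f : G → H) (s⁻¹ * t))) : ℂ))]
  · refine integral_congr_ae (Eventually.of_forall fun t => ?_)
    exact (integral_inner (integrable_regularFun_integrand hα hi f t) _).symm
  · exact (k.2.1.comp continuous_fst).inner (continuous_regular_integrand hα hφ f.2.1)
  · refine HasCompactSupport.intro (IsCompact.prod k.2.2 hφc) fun p hp => ?_
    by_contra hne
    apply hp
    have h1 : (k : G → H) p.1 ≠ 0 := fun h => hne (by simp [Function.uncurry_def, h])
    have h2 : φ p.2 ≠ 0 := fun h => hne (by simp [Function.uncurry_def, h])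
    exact ⟨subset_tsupport _ h1, subset_tsupport _ h2⟩

/-- A Minkowski inequality proved by duality: Fubini writes ⟨k, λ_φ f⟩ as an integral over s of ⟨k,
F_s⟩, where the twisted translate F_s of f has norm at most ‖φ(s)‖ ‖f‖. -/
theorem norm_regularCc_le (hα : ∀ a : A, Continuous fun t => α t a) {φ : G → A}
    (hφ : Continuous φ) (hφc : HasCompactSupport φ) (f : ccSubmodule G H) :
    ‖ccToLp μ (regularCc (μ := μ) hα π hφ hφc f)‖ ≤ (∫ s, ‖φ s‖ ∂μ) * ‖ccToLp μ f‖ := by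
  have hi := hφ.integrable_of_hasCompactSupport (μ := μ) hφc
  have hcont : ∀ s, Continuous fun t => π (α t⁻¹ (φ s)) ((f : G → H) (s⁻¹ * t)) := fun s =>
    (continuous_regular_integrand hα (φ := φ) hφ f.2.1).comp (Continuous.prodMk_left s)
  have hF : ∀ s, (fun t => π (α t⁻¹ (φ s)) ((f : G → H) (s⁻¹ * t))) ∈ ccSubmodule G H := fun s => by
    refine ⟨hcont s, HasCompactSupport.intro (K := (fun t => s * t) '' tsupport (f : G → H))
      (IsCompact.image f.2.2 (by fun_prop)) fun t ht => ?_⟩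
    rw [image_eq_zero_of_notMem_tsupport (f := (f : G → H)) (x := s⁻¹ * t)
      fun h => ht ⟨_, h, by simp⟩, map_zero]
  have hFn : ∀ s, ‖ccToLp μ ⟨_, hF s⟩‖ ≤ ‖φ s‖ * ‖ccToLp μ f‖ := fun s => by
    refine le_of_sq_le_sq ?_ (by positivity)
    rw [norm_ccToLp_sq, mul_pow, norm_ccToLp_sq,
      ← integral_mul_left_eq_self (fun t => ‖(f : G → H) t‖ ^ 2) s⁻¹, ← integral_const_mul]
    refine integral_mono_of_nonneg (Eventually.of_forall fun t => sq_nonneg _) ?_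
      (Eventually.of_forall fun t => ?_)
    · refine Integrable.const_mul ?_ _
      have h := (memLp_cc μ f).integrable_norm_pow (p := 2) two_ne_zero
      exact h.comp_mul_left s⁻¹
    · simp only
      rw [← mul_pow]
      gcongr
      refine (norm_rep_apply_le _ _ _).trans ?_
      rw [norm_action]
  have key : ∀ k : ccSubmodule G H,
      ‖(inner ℂ (ccToLp μ k) (ccToLp μ (regularCc (μ := μ) hα π hφ hφc f)) : ℂ)‖ ≤
        ‖ccToLp μ k‖ * ((∫ s, ‖φ s‖ ∂μ) * ‖ccToLp μ f‖) := fun k => by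
    rw [inner_ccToLp]
    refine (congrArg norm (inner_regularFun hα hφ hφc k f)).trans_le ?_
    rw [← integral_mul_const, ← integral_const_mul]
    refine norm_integral_le_of_norm_le ((hi.norm.mul_const _).const_mul _)
      (Eventually.of_forall fun s => ?_)
    have := inner_ccToLp μ k ⟨_, hF s⟩
    rw [← this]
    refine (norm_inner_le_norm _ _).trans ?_
    gcongr
    exact hFn s
  -- Taking k = λ_φ f gives the square of the wanted norm on the left; one factor is then cancelled.
  have h := key (regularCc (μ := μ) hα π hφ hφc f)
  rw [inner_self_eq_norm_sq_to_K, norm_pow, RCLike.norm_ofReal, abs_norm, sq] at h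
  rcases (norm_nonneg (ccToLp μ (regularCc (μ := μ) hα π hφ hφc f))).eq_or_lt with h0 | h0
  · rw [← h0]
    exact mul_nonneg (integral_nonneg fun s => norm_nonneg _) (norm_nonneg _)
  · exact le_of_mul_le_mul_left h h0

theorem exists_isRegularOp_of_cc (hα : ∀ a : A, Continuous fun t => α t a) {φ : G → A}
    (hφ : Continuous φ) (hφc : HasCompactSupport φ) :
    ∃ T : Lp H 2 μ →L[ℂ] Lp H 2 μ, IsRegularOp α μ π φ T ∧
      (∀ f, T (ccToLp μ f) = ccToLp μ (regularCc (μ := μ) hα π hφ hφc f)) ∧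
      ‖T‖ ≤ ∫ s, ‖φ s‖ ∂μ := by
  obtain ⟨T, hT, hTn⟩ := exists_clm_of_denseRange (denseRange_ccToLp (H := H) μ)
    (ccToLp μ ∘ₗ regularCc (μ := μ) hα π hφ hφc) (integral_nonneg fun s => norm_nonneg (φ s))
    (norm_regularCc_le hα hφ hφc)
  refine ⟨T, isRegularOp_iff.2 fun f => ?_, hT, hTn⟩
  rw [hT]
  exact coeFn_ccToLp μ (regularCc (μ := μ) hα π hφ hφc f)

theorem reducedCrossedProduct_mem_of_cc {φ : G → A} (hφ : Continuous φ)
    (hφc : HasCompactSupport φ) {T : Lp H 2 μ →L[ℂ] Lp H 2 μ} (hT : IsRegularOp α μ π φ T) :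
    T ∈ reducedCrossedProduct α μ π :=
  NonUnitalStarSubalgebra.le_topologicalClosure _
    (NonUnitalStarAlgebra.subset_adjoin ℂ _ ⟨φ, hφ, hφc, hT⟩)

theorem norm_le_of_isRegularOp_cc (hα : ∀ a : A, Continuous fun t => α t a) {φ : G → A}
    (hφ : Continuous φ) (hφc : HasCompactSupport φ) {T : Lp H 2 μ →L[ℂ] Lp H 2 μ}
    (hT : IsRegularOp α μ π φ T) : ‖T‖ ≤ ∫ s, ‖φ s‖ ∂μ := by
  obtain ⟨T', hT', -, hn⟩ := exists_isRegularOp_of_cc (μ := μ) (π := π) hα hφ hφc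
  rwa [hT.unique hT']

/-- The regular representation extends to `L¹(G, A)`. -/
theorem exists_isRegularOp (hα : ∀ a : A, Continuous fun t => α t a) {φ : G → A}
    (hφ : Integrable φ μ) :
    ∃ T ∈ reducedCrossedProduct α μ π, IsRegularOp α μ π φ T ∧ ‖T‖ ≤ ∫ s, ‖φ s‖ ∂μ := by
  obtain ⟨u, hu, hlim, -⟩ := exists_seq_hasCompactSupport hφ
  have hui : ∀ n, Integrable (u n) μ := fun n => (hu n).1.integrable_of_hasCompactSupport (hu n).2
  choose T hT _ hTn using fun n =>
    exists_isRegularOp_of_cc (μ := μ) (π := π) hα (hu n).1 (hu n).2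
  have hsub : ∀ m n, ‖T m - T n‖ ≤ (∫ t, ‖φ t - u m t‖ ∂μ) + ∫ t, ‖φ t - u n t‖ ∂μ := fun m n => by
    refine (norm_le_of_isRegularOp_cc hα ((hu m).1.sub (hu n).1) ((hu m).2.sub (hu n).2)
      ((hT m).sub hα (hui m) (hui n) (hT n))).trans ?_
    have h4 := integral_add (hφ.sub (hui m)).norm (hφ.sub (hui n)).norm
    simp only [Pi.sub_apply] at h4
    rw [← h4]
    refine integral_mono ((hui m).sub (hui n)).norm
      ((hφ.sub (hui m)).norm.add (hφ.sub (hui n)).norm) fun t => ?_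
    simp only [norm_sub_rev (φ t) (u m t)]
    exact norm_sub_le_norm_sub_add_norm_sub _ _ _
  have hcau : CauchySeq T := by
    refine Metric.cauchySeq_iff'.2 fun ε hε => ?_
    obtain ⟨N, hN⟩ := eventually_atTop.1 (hlim.eventually (gt_mem_nhds (half_pos hε)))
    refine ⟨N, fun n hn => ?_⟩
    rw [dist_eq_norm]
    have := hN n hn
    have := hN N le_rfl
    linarith [hsub n N]
  obtain ⟨S, hS⟩ := cauchySeq_tendsto_of_complete hcau
  refine ⟨S, ?_, isRegularOp_iff.2 fun f => ?_, ?_⟩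
  · exact (NonUnitalStarSubalgebra.isClosed_topologicalClosure _).mem_of_tendsto hS
      (Eventually.of_forall fun n => reducedCrossedProduct_mem_of_cc (hu n).1 (hu n).2 (hT n))
  · have hS' : Tendsto (fun n => T n (ccToLp μ f)) atTop (𝓝 (S (ccToLp μ f))) :=
      ((ContinuousLinearMap.apply ℂ (Lp H 2 μ) (ccToLp μ f)).continuous.tendsto S).comp hS
    -- The limit operator is identified pointwise: a subsequence converges almost everywhere because
    -- of L² convergence, while λ_{u_n} f converges to λ_φ f at every point because f is bounded.
    obtain ⟨ns, hns, hae⟩ := (tendstoInMeasure_of_tendsto_Lp hS').exists_seq_tendsto_ae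
    have hall : ∀ᵐ t ∂μ, ∀ n, (T n (ccToLp μ f) : G → H) t = regularFun α μ π (u n) f t :=
      ae_all_iff.2 fun n => isRegularOp_iff.1 (hT n) f
    obtain ⟨M, -, hM⟩ := exists_norm_le_of_cc f
    filter_upwards [hae, hall] with t h1 h2
    simp only [h2] at h1
    refine tendsto_nhds_unique h1 (Tendsto.comp (g := fun n => regularFun α μ π (u n) f t) ?_
      hns.tendsto_atTop)
    refine tendsto_iff_norm_sub_tendsto_zero.2 ?_
    refine squeeze_zero (fun n => norm_nonneg _) (fun n => ?_) (by simpa using hlim.mul_const M)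
    rw [norm_sub_rev, ← regularFun_sub hα hφ (hui n)]
    exact norm_regularFun_le (hφ.sub (hui n)) hM t
  · refine le_of_tendsto_of_tendsto hS.norm (tendsto_integral_of_tendsto_integral_norm_sub
      (fun n => (hui n).norm) hφ.norm ?_) (Eventually.of_forall hTn)
    refine squeeze_zero (fun n => integral_nonneg fun t => norm_nonneg _) (fun n => ?_) hlim
    refine integral_mono (hφ.norm.sub (hui n).norm).norm (hφ.sub (hui n)).norm fun t => ?_
    exact abs_norm_sub_norm_le _ _

theorem IsRegularOp.mem (hα : ∀ a : A, Continuous fun t => α t a) {φ : G → A}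
    (hφ : Integrable φ μ) {T : Lp H 2 μ →L[ℂ] Lp H 2 μ} (hT : IsRegularOp α μ π φ T) :
    T ∈ reducedCrossedProduct α μ π := by
  obtain ⟨T', h, hT', -⟩ := exists_isRegularOp (μ := μ) (π := π) hα hφ
  rwa [hT.unique hT']

theorem IsRegularOp.norm_le (hα : ∀ a : A, Continuous fun t => α t a) {φ : G → A}
    (hφ : Integrable φ μ) {T : Lp H 2 μ →L[ℂ] Lp H 2 μ} (hT : IsRegularOp α μ π φ T) :
    ‖T‖ ≤ ∫ s, ‖φ s‖ ∂μ := by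
  obtain ⟨T', -, hT', h⟩ := exists_isRegularOp (μ := μ) (π := π) hα hφ
  rwa [hT.unique hT']

/-- The adjoint of `λ_φ` is `λ_ψ` for `ψ(s) = Δ(s)⁻¹ α_s(φ(s⁻¹))*`. -/
theorem isRegularOp_adjoint (hα : ∀ a : A, Continuous fun t => α t a) {φ : G → A}
    (hφ : Continuous φ) (hφc : HasCompactSupport φ) {T : Lp H 2 μ →L[ℂ] Lp H 2 μ}
    (hT : IsRegularOp α μ π φ T) :
    ∃ ψ : G → A, Continuous ψ ∧ HasCompactSupport ψ ∧ IsRegularOp α μ π ψ (star T) := by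
  have hψ : Continuous fun s => modularRoot s ^ 2 • α s (star (φ s⁻¹)) :=
    (continuous_modularRoot.pow 2).smul (continuous_action hα continuous_id (by fun_prop))
  have hψc : HasCompactSupport fun s => modularRoot s ^ 2 • α s (star (φ s⁻¹)) := by
    refine HasCompactSupport.intro (hasCompactSupport_comp_inv hφc) fun s hs => ?_
    rw [image_eq_zero_of_notMem_tsupport (f := fun s => φ s⁻¹) hs, star_zero, map_zero, smul_zero]
  refine ⟨_, hψ, hψc, ?_⟩
  obtain ⟨S, hS, hSf, -⟩ := exists_isRegularOp_of_cc (μ := μ) (π := π) hα hψ hψc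
  obtain ⟨T', hT', hTf, -⟩ := exists_isRegularOp_of_cc (μ := μ) (π := π) hα hφ hφc
  rw [hT.unique hT']
  suffices h : star T' = S by rwa [h]
  refine clm_ext_cc fun g => ?_
  refine (denseRange_ccToLp (H := H) μ).eq_of_inner_left ℂ fun f => ?_
  rw [ContinuousLinearMap.star_eq_adjoint, ContinuousLinearMap.adjoint_inner_left, hTf, hSf,
    ← inner_conj_symm (ccToLp μ (regularCc (μ := μ) hα π hψ hψc g)), inner_ccToLp, inner_ccToLp]
  refine (inner_regularFun hα hφ hφc g f).trans ?_
  refine Eq.trans ?_ (congrArg _ (inner_regularFun hα hψ hψc f g).symm)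
  -- P is the matrix coefficient without the modular weight. The factor Δ(s)⁻¹ in ψ is exactly the
  -- density that turns the integral of P(s⁻¹) into one over s.
  let P : G → ℂ := fun s =>
    ∫ t, inner ℂ ((f : G → H) t) (π (α t⁻¹ (α s (star (φ s⁻¹)))) ((g : G → H) (s⁻¹ * t))) ∂μ
  have hPc : Continuous P := by
    rw [← continuousOn_univ]
    refine continuousOn_integral_of_compact_support (k := tsupport (f : G → H)) f.2.2
      (Continuous.continuousOn ?_) fun p s _ hs => ?_
    · refine (f.2.1.comp continuous_snd).inner (continuous_rep_apply π (continuous_action hα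
        continuous_snd.inv (continuous_action hα continuous_fst ?_)) (g.2.1.comp ?_))
      · exact (hφ.comp continuous_fst.inv).star
      · exact continuous_fst.inv.mul continuous_snd
    · rw [image_eq_zero_of_notMem_tsupport hs, inner_zero_left]
  have hPs : HasCompactSupport P := by
    refine HasCompactSupport.intro (hasCompactSupport_comp_inv hφc) fun s hs => ?_
    simp only [P, image_eq_zero_of_notMem_tsupport (f := fun s => φ s⁻¹) hs]
    simp
  have h1 : ∫ s, ∫ t, inner ℂ ((f : G → H) t)
      (π (α t⁻¹ (modularRoot s ^ 2 • α s (star (φ s⁻¹)))) ((g : G → H) (s⁻¹ * t))) ∂μ ∂μ =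
      ∫ s, P s⁻¹ ∂μ := by
    rw [integral_comp_inv_of_hasCompactSupport μ hPc hPs]
    refine integral_congr_ae (Eventually.of_forall fun s => ?_)
    simp only [P]
    rw [← integral_smul]
    refine integral_congr_ae (Eventually.of_forall fun t => ?_)
    simp only [action_real_smul, rep_real_smul]
    rw [smul_apply, inner_smul_right_eq_smul]
  rw [h1, ← integral_conj]
  refine integral_congr_ae (Eventually.of_forall fun s => ?_)
  simp only [P]
  rw [← integral_conj, ← integral_mul_left_eq_self _ s]
  refine integral_congr_ae (Eventually.of_forall fun t => ?_)
  simp only [inner_conj_symm, mul_inv_rev, inv_inv, inv_mul_cancel_left, action_mul]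
  rw [inner_rep_right]
  simp only [map_star]

end RegularRep

end RieffelProper

namespace RieffelProper

/-! ### The module product ξ * φ -/

section Conv

variable {G : Type uG} [Group G] [TopologicalSpace G] [IsTopologicalGroup G]
  [LocallyCompactSpace G] [T2Space G] [MeasurableSpace G] [BorelSpace G] {μ : Measure G}
  [μ.IsHaarMeasure] [μ.Regular]
variable {A : Type uA} [NonUnitalCStarAlgebra A]
variable {α : G →* (A ≃⋆ₐ[ℂ] A)}

theorem memL1Δ_iff {φ : G → A} : MemL1Δ μ φ ↔ Integrable φ μ ∧
    Integrable (fun t => modularRoot t • φ t) μ ∧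
      Integrable (fun t => (modularRoot t)⁻¹ • φ t) μ := by
  simp only [← modular_rpow_half]
  rfl

theorem memL1Δ_of_cc {φ : G → A} (hφ : Continuous φ) (hφc : HasCompactSupport φ) :
    MemL1Δ μ φ := by
  refine memL1Δ_iff.2 ⟨hφ.integrable_of_hasCompactSupport hφc, ?_, ?_⟩
  · exact (continuous_modularRoot.smul hφ).integrable_of_hasCompactSupport hφc.smul_left
  · exact ((continuous_modularRoot.inv₀ modularRoot_ne_zero).smul
      hφ).integrable_of_hasCompactSupport hφc.smul_left

theorem continuous_convIntegrand (hα : ∀ a : A, Continuous fun t => α t a) (ξ : A) :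
    Continuous fun p : G × A => modularRoot p.1 • α p.1⁻¹ (ξ * p.2) :=
  (continuous_modularRoot.comp continuous_fst).smul
    (continuous_action hα continuous_fst.inv (continuous_const.mul continuous_snd))

theorem integrable_convIntegrand (hα : ∀ a : A, Continuous fun t => α t a) {φ : G → A}
    (hφ : MemL1Δ μ φ) (ξ : A) :
    Integrable (fun s => modularRoot s • α s⁻¹ (ξ * φ s)) μ := by
  rw [memL1Δ_iff] at hφ
  refine (hφ.2.1.norm.const_mul ‖ξ‖).mono' (aestronglyMeasurable_continuous_comp
    (Φ := fun s a => modularRoot s • α s⁻¹ (ξ * a)) (continuous_convIntegrand hα ξ)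
    (fun s => by simp) hφ.1) (Eventually.of_forall fun s => ?_)
  rw [norm_smul, norm_smul, norm_action, mul_left_comm]
  gcongr
  exact norm_mul_le _ _

/-- The substitution t = s⁻¹ has density Δ(s)⁻¹ and turns the weight Δ(t)^{-1/2} into Δ(s)^{-1/2}.
Integrability thus rests on the condition Δ^{-1/2}φ ∈ L¹, and φ appears without an inverse, which
suits approximation of φ. -/
theorem integrable_conv_and_eq (hα : ∀ a : A, Continuous fun t => α t a) {φ : G → A}
    (hφ : MemL1Δ μ φ) (ξ : A) :
    Integrable (fun t => modularRoot t • α t (ξ * φ t⁻¹)) μ ∧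
      conv α μ ξ φ = ∫ s, modularRoot s • α s⁻¹ (ξ * φ s) ∂μ := by
  have hsq : ∀ s : G, modularRoot s ^ 2 • ((modularRoot s)⁻¹ • α s⁻¹ (ξ * φ s)) =
      modularRoot s • α s⁻¹ (ξ * φ s) := fun s => by
    rw [smul_smul, sq, mul_assoc, mul_inv_cancel₀ (modularRoot_ne_zero s), mul_one]
  have h := integrable_comp_inv_and_integral_eq μ
    (φ := fun s => (modularRoot s)⁻¹ • α s⁻¹ (ξ * φ s))
    (by simpa only [hsq] using integrable_convIntegrand hα hφ ξ)
  simp only [hsq, modularRoot_inv, inv_inv] at h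
  exact h

theorem conv_eq (hα : ∀ a : A, Continuous fun t => α t a) {φ : G → A}
    (hφ : MemL1Δ μ φ) (ξ : A) :
    conv α μ ξ φ = ∫ s, modularRoot s • α s⁻¹ (ξ * φ s) ∂μ :=
  (integrable_conv_and_eq hα hφ ξ).2

theorem MemL1Δ.sub {φ ψ : G → A} (hφ : MemL1Δ μ φ) (hψ : MemL1Δ μ ψ) :
    MemL1Δ μ (fun s => φ s - ψ s) := by
  rw [memL1Δ_iff] at *
  simp only [smul_sub]
  exact ⟨hφ.1.sub hψ.1, hφ.2.1.sub hψ.2.1, hφ.2.2.sub hψ.2.2⟩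

theorem conv_sub (hα : ∀ a : A, Continuous fun t => α t a) {φ ψ : G → A}
    (hφ : MemL1Δ μ φ) (hψ : MemL1Δ μ ψ) (ξ : A) :
    conv α μ ξ (fun s => φ s - ψ s) = conv α μ ξ φ - conv α μ ξ ψ := by
  rw [conv_eq hα hφ, conv_eq hα hψ, conv_eq hα (hφ.sub hψ),
    ← integral_sub (integrable_convIntegrand hα hφ ξ) (integrable_convIntegrand hα hψ ξ)]
  simp only [mul_sub, map_sub, smul_sub]

theorem norm_conv_le (hα : ∀ a : A, Continuous fun t => α t a) {φ : G → A}
    (hφ : MemL1Δ μ φ) (ξ : A) :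
    ‖conv α μ ξ φ‖ ≤ ‖ξ‖ * ∫ s, modularRoot s * ‖φ s‖ ∂μ := by
  rw [conv_eq hα hφ, ← integral_const_mul]
  refine norm_integral_le_of_norm_le ?_ (Eventually.of_forall fun s => ?_)
  · refine Integrable.const_mul ?_ _
    have := (memL1Δ_iff.1 hφ).2.1.norm
    simpa only [norm_smul, Real.norm_of_nonneg (modularRoot_pos _).le] using this
  · rw [norm_smul, Real.norm_of_nonneg (modularRoot_pos s).le, norm_action, mul_left_comm]
    gcongr
    · exact (modularRoot_pos s).le
    · exact norm_mul_le _ _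

theorem MemL1Δ.mul_action (hα : ∀ a : A, Continuous fun t => α t a) {φ : G → A}
    (hφ : MemL1Δ μ φ) (a : A) : MemL1Δ μ (fun t => φ t * α t a) := by
  rw [memL1Δ_iff] at *
  have key : ∀ {ψ : G → A}, Integrable ψ μ → Integrable (fun t => ψ t * α t a) μ := fun {ψ} hψ => by
    refine (hψ.norm.mul_const ‖a‖).mono' (aestronglyMeasurable_continuous_comp
      (Φ := fun t b => b * α t a) ?_ (fun s => by simp) hψ) (Eventually.of_forall fun s => ?_)
    · exact continuous_snd.mul ((hα a).comp continuous_fst)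
    · exact (norm_mul_le _ _).trans_eq (by rw [norm_action])
  refine ⟨key hφ.1, ?_, ?_⟩
  · simpa only [smul_mul_assoc] using key hφ.2.1
  · simpa only [smul_mul_assoc] using key hφ.2.2

/-- Since α_{s⁻¹}(α_s(a)) = a, a right factor can be absorbed into φ. This makes R̃ a right ideal
and recognises (ζ*φ)η* as a module product. -/
theorem conv_mul (hα : ∀ a : A, Continuous fun t => α t a) {φ : G → A}
    (hφ : MemL1Δ μ φ) (ξ a : A) :
    conv α μ ξ φ * a = conv α μ ξ (fun t => φ t * α t a) := by
  rw [conv_eq hα hφ, conv_eq hα (hφ.mul_action hα a),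
    ← integral_mul_const_of_integrable (integrable_convIntegrand hα hφ ξ)]
  refine integral_congr_ae (Eventually.of_forall fun s => ?_)
  simp only [← mul_assoc]
  rw [map_mul (α s⁻¹) _ (α s a), ← action_mul, inv_mul_cancel, action_one, smul_mul_assoc]

/-- The function (1 + Δ^{-1/2})φ is approximated in mean and the weight divided out; this single
weight dominates both 1 and Δ^{-1/2}. The first limit controls λ_φ in operator norm, the second
controls ξ * φ in A. -/
theorem exists_seq_memL1Δ {φ : G → A} (hφ : MemL1Δ μ φ) :
    ∃ u : ℕ → G → A, (∀ n, Continuous (u n) ∧ HasCompactSupport (u n)) ∧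
      Tendsto (fun n => ∫ t, ‖φ t - u n t‖ ∂μ) atTop (𝓝 0) ∧
      Tendsto (fun n => ∫ t, modularRoot t * ‖φ t - u n t‖ ∂μ) atTop (𝓝 0) := by
  have hφ' := memL1Δ_iff.1 hφ
  have hg : Integrable (fun t => (1 + modularRoot t) • φ t) μ := by
    simp only [add_smul, one_smul]
    exact hφ'.1.add hφ'.2.1
  obtain ⟨v, hv, hlim, -⟩ := exists_seq_hasCompactSupport hg
  have hpos : ∀ t : G, 0 < 1 + modularRoot t := fun t => add_pos one_pos (modularRoot_pos t)
  have hu : ∀ n, Continuous (fun t => (1 + modularRoot t)⁻¹ • v n t) ∧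
      HasCompactSupport (fun t => (1 + modularRoot t)⁻¹ • v n t) := fun n =>
    ⟨(Continuous.inv₀ (by fun_prop) fun t => (hpos t).ne').smul (hv n).1, (hv n).2.smul_left⟩
  have hvi : ∀ n, Integrable (v n) μ := fun n => (hv n).1.integrable_of_hasCompactSupport (hv n).2
  have hn : ∀ n t, ‖(1 + modularRoot t) • φ t - v n t‖ =
      (1 + modularRoot t) * ‖φ t - (1 + modularRoot t)⁻¹ • v n t‖ := fun n t => by
    rw [← Real.norm_of_nonneg (hpos t).le, ← norm_smul, smul_sub,
      Real.norm_of_nonneg (hpos t).le, smul_smul, mul_inv_cancel₀ (hpos t).ne', one_smul]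
  refine ⟨_, hu, ?_, ?_⟩
  · refine squeeze_zero (fun n => integral_nonneg fun t => norm_nonneg _) (fun n => ?_) hlim
    refine integral_mono_of_nonneg (Eventually.of_forall fun t => norm_nonneg _)
      (hg.sub (hvi n)).norm (Eventually.of_forall fun t => ?_)
    refine le_trans ?_ (hn n t).ge
    exact le_mul_of_one_le_left (norm_nonneg _) (le_add_of_nonneg_right (modularRoot_pos t).le)
  · refine squeeze_zero (fun n => integral_nonneg fun t =>
      mul_nonneg (modularRoot_pos t).le (norm_nonneg _)) (fun n => ?_) hlim
    refine integral_mono_of_nonneg (Eventually.of_forall fun t =>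
      mul_nonneg (modularRoot_pos t).le (norm_nonneg _))
      (hg.sub (hvi n)).norm (Eventually.of_forall fun t => ?_)
    refine le_trans ?_ (hn n t).ge
    exact mul_le_mul_of_nonneg_right (le_add_of_nonneg_left zero_le_one) (norm_nonneg _)

end Conv

/-! ### The kets and their products with λ_φ -/

section Ket

variable {G : Type uG} [Group G] [TopologicalSpace G] [IsTopologicalGroup G]
  [LocallyCompactSpace G] [T2Space G] [MeasurableSpace G] [BorelSpace G] {μ : Measure G}
  [μ.IsHaarMeasure] [μ.Regular]
variable {A : Type uA} [NonUnitalCStarAlgebra A]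
variable {H : Type uH} [NormedAddCommGroup H] [InnerProductSpace ℂ H] [CompleteSpace H]
variable {α : G →* (A ≃⋆ₐ[ℂ] A)} {π : A →⋆ₙₐ[ℂ] (H →L[ℂ] H)}

/-- The vector `∫ Δ(u)^{-1/2} π(α_{u⁻¹}(ξ)) f(u) du`. -/
noncomputable def ketInt (α : G →* (A ≃⋆ₐ[ℂ] A)) (μ : Measure G) (π : A →⋆ₙₐ[ℂ] (H →L[ℂ] H))
    (ξ : A) (f : G → H) : H :=
  ∫ u, modularRoot u • π (α u⁻¹ ξ) (f u) ∂μ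

/-- `IsKet α μ π ξ S` : the operator `S` on `L²(G, H)` is given by
`S f = ∫ Δ(u)^{-1/2} π(α_{u⁻¹}(ξ)) f(u) du`. -/
def IsKet (α : G →* (A ≃⋆ₐ[ℂ] A)) (μ : Measure G) [IsFiniteMeasureOnCompacts μ]
    (π : A →⋆ₙₐ[ℂ] (H →L[ℂ] H)) (ξ : A) (S : Lp H 2 μ →L[ℂ] H) : Prop :=
  ∀ f : ccSubmodule G H, S (ccToLp μ f) = ketInt α μ π ξ f

theorem continuous_ketIntegrand (hα : ∀ a : A, Continuous fun t => α t a) (ξ : A)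
    {f : G → H} (hf : Continuous f) : Continuous fun u => modularRoot u • π (α u⁻¹ ξ) (f u) :=
  continuous_modularRoot.smul
    (continuous_rep_apply π (continuous_action hα continuous_inv continuous_const) hf)

theorem hasCompactSupport_ketIntegrand (ξ : A) {f : G → H} (hf : HasCompactSupport f) :
    HasCompactSupport fun u => modularRoot u • π (α u⁻¹ ξ) (f u) := by
  refine HasCompactSupport.intro hf fun u hu => ?_
  rw [image_eq_zero_of_notMem_tsupport hu, map_zero, smul_zero]

theorem integrable_ketIntegrand (hα : ∀ a : A, Continuous fun t => α t a) (ξ : A)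
    (f : ccSubmodule G H) :
    Integrable (fun u => modularRoot u • π (α u⁻¹ ξ) ((f : G → H) u)) μ :=
  (continuous_ketIntegrand hα ξ f.2.1).integrable_of_hasCompactSupport
    (hasCompactSupport_ketIntegrand ξ f.2.2)

theorem ketInt_add_left (hα : ∀ a : A, Continuous fun t => α t a) (ξ η : A)
    (f : ccSubmodule G H) : ketInt α μ π (ξ + η) f = ketInt α μ π ξ f + ketInt α μ π η f := by
  simp only [ketInt]
  rw [← integral_add (integrable_ketIntegrand hα ξ f) (integrable_ketIntegrand hα η f)]
  simp only [map_add, add_apply, smul_add]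

theorem ketInt_smul_left (c : ℂ) (ξ : A) (f : ccSubmodule G H) :
    ketInt α μ π (c • ξ) f = c • ketInt α μ π ξ f := by
  simp only [ketInt, map_smul, smul_apply]
  rw [← integral_smul]
  simp only [smul_comm c]

theorem ketInt_sub_left (hα : ∀ a : A, Continuous fun t => α t a) (ξ η : A)
    (f : ccSubmodule G H) : ketInt α μ π (ξ - η) f = ketInt α μ π ξ f - ketInt α μ π η f := by
  rw [sub_eq_add_neg, ketInt_add_left hα, ← neg_one_smul ℂ η, ketInt_smul_left, neg_one_smul,
    sub_eq_add_neg]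

theorem norm_ketInt_le (ξ : A) (f : ccSubmodule G H) :
    ‖ketInt α μ π ξ f‖ ≤ ‖ξ‖ * ∫ u, modularRoot u * ‖(f : G → H) u‖ ∂μ := by
  rw [← integral_const_mul]
  refine norm_integral_le_of_norm_le ?_ (Eventually.of_forall fun u => ?_)
  · refine Integrable.const_mul (Continuous.integrable_of_hasCompactSupport
      (continuous_modularRoot.mul f.2.1.norm) ?_) _
    exact HasCompactSupport.mul_left f.2.2.norm
  · rw [norm_smul, Real.norm_of_nonneg (modularRoot_pos u).le, mul_left_comm]
    gcongr
    · exact (modularRoot_pos u).le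
    · exact (norm_rep_apply_le _ _ _).trans_eq (by rw [norm_action])

/-- The vectors `ketInt α μ π ξ f` as a linear function of `f`. -/
noncomputable def ketCc (hα : ∀ a : A, Continuous fun t => α t a) (μ : Measure G)
    [μ.IsHaarMeasure] [μ.Regular] (π : A →⋆ₙₐ[ℂ] (H →L[ℂ] H)) (ξ : A) :
    ccSubmodule G H →ₗ[ℂ] H where
  toFun f := ketInt α μ π ξ f
  map_add' f g := by
    simp only [ketInt, Submodule.coe_add, Pi.add_apply, map_add, smul_add]
    exact integral_add (integrable_ketIntegrand hα ξ f) (integrable_ketIntegrand hα ξ g)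
  map_smul' c f := by
    simp only [ketInt, Submodule.coe_smul, Pi.smul_apply, map_smul, RingHom.id_apply]
    rw [← integral_smul]
    simp only [smul_comm c]

theorem braket_apply (ξ η : A) (t : G) :
    braket α ξ η t = modularRoot t • (star ξ * α t η) := rfl

/-- A left translation followed by inversion separates the variables: the factor depending on s
leaves the integral and the rest is the ket of η. Formally this is |ξ⟩* applied to |η⟩g. -/
theorem regularFun_braket (hα : ∀ a : A, Continuous fun t => α t a) (ξ η : A)
    (g : ccSubmodule G H) (s : G) :
    regularFun α μ π (braket α ξ η) g s =
      modularRoot s • π (α s⁻¹ (star ξ)) (ketInt α μ π η g) := by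
  have h1 : regularFun α μ π (braket α ξ η) g s = ∫ r, (fun u => modularRoot s •
      π (α s⁻¹ (star ξ)) ((modularRoot u)⁻¹ • π (α u⁻¹ η) ((g : G → H) u))) r⁻¹ ∂μ := by
    rw [regularFun, ← integral_mul_left_eq_self _ s]
    refine integral_congr_ae (Eventually.of_forall fun r => ?_)
    simp only [braket_apply, action_real_smul, rep_real_smul, map_mul (α s⁻¹), ← action_mul,
      inv_mul_cancel_left, mul_inv_rev, inv_mul_cancel_right, modularRoot_inv, inv_inv,
      modularRoot_mul, smul_apply, rep_mul_apply]
    rw [ContinuousLinearMap.map_smul_of_tower, smul_smul]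
  rw [h1, integral_comp_inv_of_hasCompactSupport μ
    (g := fun u => modularRoot s •
      π (α s⁻¹ (star ξ)) ((modularRoot u)⁻¹ • π (α u⁻¹ η) ((g : G → H) u)))]
  · rw [ketInt, ← ContinuousLinearMap.integral_comp_comm _ (integrable_ketIntegrand hα η g),
      ← integral_smul]
    refine integral_congr_ae (Eventually.of_forall fun u => ?_)
    simp only [ContinuousLinearMap.map_smul_of_tower]
    rw [smul_comm (modularRoot u ^ 2), smul_smul (modularRoot u ^ 2), sq, mul_assoc,
      mul_inv_cancel₀ (modularRoot_ne_zero u), mul_one]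
  · exact continuous_const.smul ((ContinuousLinearMap.continuous _).comp
      ((continuous_modularRoot.inv₀ modularRoot_ne_zero).smul
        (continuous_rep_apply π (continuous_action hα continuous_inv continuous_const) g.2.1)))
  · refine HasCompactSupport.intro g.2.2 fun u hu => ?_
    rw [image_eq_zero_of_notMem_tsupport hu]
    simp

theorem inner_ketInt (hα : ∀ a : A, Continuous fun t => α t a) (ξ η : A)
    (f g : ccSubmodule G H) {T : Lp H 2 μ →L[ℂ] Lp H 2 μ}
    (hT : IsRegularOp α μ π (braket α ξ η) T) :
    inner ℂ (ketInt α μ π ξ f) (ketInt α μ π η g) = inner ℂ (ccToLp μ f) (T (ccToLp μ g)) := by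
  rw [L2.inner_def]
  have h1 : ∫ s, inner ℂ ((ccToLp μ f : G → H) s) ((T (ccToLp μ g) : G → H) s) ∂μ =
      ∫ s, inner ℂ (modularRoot s • π (α s⁻¹ ξ) ((f : G → H) s)) (ketInt α μ π η g) ∂μ := by
    refine integral_congr_ae ?_
    filter_upwards [coeFn_ccToLp μ f, isRegularOp_iff.1 hT g] with s h1 h2
    rw [h1, h2, regularFun_braket hα, inner_smul_right_eq_smul, inner_smul_left_eq_smul,
      inner_rep_left, map_star]
  rw [h1]
  generalize ketInt α μ π η g = k
  rw [← inner_conj_symm, ketInt, ← integral_inner (integrable_ketIntegrand hα ξ f),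
    ← integral_conj]
  simp only [inner_conj_symm]

/-- With T = λ_{⟨⟨ξ,ξ⟩⟩}, ‖|ξ⟩f‖² = ⟨f, T f⟩ ≤ ‖T‖ ‖f‖², whence the constant √‖T‖. -/
theorem exists_isKet (hα : ∀ a : A, Continuous fun t => α t a) {ξ : A}
    (hξ : Integrable (braket α ξ ξ) μ) : ∃ S, IsKet α μ π ξ S := by
  obtain ⟨T, -, hT, -⟩ := exists_isRegularOp (μ := μ) (π := π) hα hξ
  obtain ⟨S, hS, -⟩ := exists_clm_of_denseRange (denseRange_ccToLp (H := H) μ) (ketCc hα μ π ξ)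
    (Real.sqrt_nonneg ‖T‖) fun f => by
      refine le_of_sq_le_sq ?_ (by positivity)
      rw [mul_pow, Real.sq_sqrt (norm_nonneg _)]
      have h := inner_ketInt hα ξ ξ f f hT
      rw [inner_self_eq_norm_sq_to_K] at h
      have h2 := congrArg norm h
      rw [norm_pow, RCLike.norm_ofReal, abs_norm] at h2
      change ‖ketInt α μ π ξ f‖ ^ 2 ≤ _
      rw [h2]
      refine (norm_inner_le_norm _ _).trans ?_
      nlinarith [T.le_opNorm (ccToLp μ f), norm_nonneg (ccToLp μ f)]
  exact ⟨S, hS⟩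

theorem IsKet.unique {ξ : A} {S T : Lp H 2 μ →L[ℂ] H} (hS : IsKet α μ π ξ S)
    (hT : IsKet α μ π ξ T) : S = T :=
  clm_ext_cc fun f => (hS f).trans (hT f).symm

theorem IsKet.adjoint_comp (hα : ∀ a : A, Continuous fun t => α t a) {ξ η : A}
    (hξη : Integrable (braket α ξ η) μ) {S T : Lp H 2 μ →L[ℂ] H} (hS : IsKet α μ π ξ S)
    (hT : IsKet α μ π η T) : IsRegularOp α μ π (braket α ξ η) (S.adjoint ∘L T) := by
  obtain ⟨Λ, -, hΛ, -⟩ := exists_isRegularOp (μ := μ) (π := π) hα hξη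
  suffices h : S.adjoint ∘L T = Λ by rwa [h]
  refine clm_ext_cc fun g => ?_
  refine (denseRange_ccToLp (H := H) μ).eq_of_inner_right ℂ fun f => ?_
  rw [ContinuousLinearMap.comp_apply, ContinuousLinearMap.adjoint_inner_right, hS f, hT g,
    inner_ketInt hα ξ η f g hΛ]

/-- Both sides are double integrals over (u, s). After exchanging the order in each, the inner
integrals over u differ by the left translation u ↦ su. -/
theorem IsKet.comp_of_cc (hα : ∀ a : A, Continuous fun t => α t a) {ξ : A} {φ : G → A}
    (hφ : Continuous φ) (hφc : HasCompactSupport φ) {S : Lp H 2 μ →L[ℂ] H}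
    (hS : IsKet α μ π ξ S) {T : Lp H 2 μ →L[ℂ] Lp H 2 μ} (hT : IsRegularOp α μ π φ T) :
    IsKet α μ π (conv α μ ξ φ) (S ∘L T) := by
  intro f
  obtain ⟨T', hT', hTf, -⟩ := exists_isRegularOp_of_cc (μ := μ) (π := π) hα hφ hφc
  have hi := hφ.integrable_of_hasCompactSupport (μ := μ) hφc
  have hm : MemL1Δ μ φ := memL1Δ_of_cc hφ hφc
  rw [ContinuousLinearMap.comp_apply, hT.unique hT', hTf, hS]
  have h1 : ketInt α μ π ξ (regularFun α μ π φ f) =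
      ∫ u, ∫ s, modularRoot u • π (α u⁻¹ (ξ * φ s)) ((f : G → H) (s⁻¹ * u)) ∂μ ∂μ := by
    refine integral_congr_ae (Eventually.of_forall fun u => ?_)
    simp only [regularFun]
    rw [← ContinuousLinearMap.integral_comp_comm _ (integrable_regularFun_integrand hα hi f u),
      ← integral_smul]
    simp only [map_mul (α _), rep_mul_apply]
  have h2 : ketInt α μ π (conv α μ ξ φ) f =
      ∫ u, ∫ s, modularRoot (s * u) • π (α (s * u)⁻¹ (ξ * φ s)) ((f : G → H) u) ∂μ ∂μ := by
    refine integral_congr_ae (Eventually.of_forall fun u => ?_)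
    simp only [conv_eq hα hm]
    let L : A →L[ℂ] H := ((ContinuousLinearMap.apply ℂ H ((f : G → H) u)).comp
      ⟨(π : A →ₗ[ℂ] (H →L[ℂ] H)), continuous_rep π⟩).comp
      ⟨(α u⁻¹ : A →ₗ[ℂ] A), continuous_action hα continuous_const continuous_id⟩
    have hL := L.integral_comp_comm (integrable_convIntegrand (μ := μ) hα hm ξ)
    change ∫ s, π (α u⁻¹ (modularRoot s • α s⁻¹ (ξ * φ s))) ((f : G → H) u) ∂μ =
      π (α u⁻¹ (∫ s, modularRoot s • α s⁻¹ (ξ * φ s) ∂μ)) ((f : G → H) u) at hL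
    rw [← hL, ← integral_smul]
    refine integral_congr_ae (Eventually.of_forall fun s => ?_)
    simp only [action_real_smul, rep_real_smul, smul_apply, mul_inv_rev, action_mul,
      modularRoot_mul, smul_smul]
    rw [mul_comm]
  have hfst := continuous_fst (X := G) (Y := G)
  have hsnd := continuous_snd (X := G) (Y := G)
  have h3 : ∫ u, ∫ s, modularRoot u • π (α u⁻¹ (ξ * φ s)) ((f : G → H) (s⁻¹ * u)) ∂μ ∂μ =
      ∫ s, ∫ u, modularRoot u • π (α u⁻¹ (ξ * φ s)) ((f : G → H) (s⁻¹ * u)) ∂μ ∂μ := by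
    refine integral_integral_swap_of_hasCompactSupport
      (f := fun u s => modularRoot u • π (α u⁻¹ (ξ * φ s)) ((f : G → H) (s⁻¹ * u))) ?_ ?_
    · exact (continuous_modularRoot.comp hfst).smul (continuous_rep_apply π
        (continuous_action hα hfst.inv (continuous_const.mul (hφ.comp hsnd)))
        (f.2.1.comp (hsnd.inv.mul hfst)))
    · refine HasCompactSupport.intro (K := ((fun p : G × G => p.1 * p.2) ''
        (tsupport φ ×ˢ tsupport (f : G → H))) ×ˢ tsupport φ)
        (((IsCompact.prod hφc f.2.2).image (by fun_prop)).prod hφc) fun p hp => ?_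
      by_contra hne
      apply hp
      have h1 : (f : G → H) (p.2⁻¹ * p.1) ≠ 0 := fun h => hne (by simp [Function.uncurry_def, h])
      have h2 : φ p.2 ≠ 0 := fun h => hne (by simp [Function.uncurry_def, h])
      exact ⟨⟨(p.2, p.2⁻¹ * p.1), ⟨subset_tsupport _ h2, subset_tsupport _ h1⟩, by simp⟩,
        subset_tsupport _ h2⟩
  have h4 : ∫ u, ∫ s, modularRoot (s * u) • π (α (s * u)⁻¹ (ξ * φ s)) ((f : G → H) u) ∂μ ∂μ =
      ∫ s, ∫ u, modularRoot (s * u) • π (α (s * u)⁻¹ (ξ * φ s)) ((f : G → H) u) ∂μ ∂μ := by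
    refine integral_integral_swap_of_hasCompactSupport
      (f := fun u s => modularRoot (s * u) • π (α (s * u)⁻¹ (ξ * φ s)) ((f : G → H) u)) ?_ ?_
    · exact (continuous_modularRoot.comp (hsnd.mul hfst)).smul (continuous_rep_apply π
        (continuous_action hα (hsnd.mul hfst).inv (continuous_const.mul (hφ.comp hsnd)))
        (f.2.1.comp hfst))
    · refine HasCompactSupport.intro (IsCompact.prod f.2.2 hφc) fun p hp => ?_
      by_contra hne
      apply hp
      have h1 : (f : G → H) p.1 ≠ 0 := fun h => hne (by simp [Function.uncurry_def, h])
      have h2 : φ p.2 ≠ 0 := fun h => hne (by simp [Function.uncurry_def, h])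
      exact ⟨subset_tsupport _ h1, subset_tsupport _ h2⟩
  refine h1.trans (h3.trans (Eq.trans ?_ (h4.symm.trans h2.symm)))
  refine integral_congr_ae (Eventually.of_forall fun s => ?_)
  simp only
  rw [← integral_mul_left_eq_self _ s]
  simp only [inv_mul_cancel_left]

/-- `|ξ * φ⟩ = |ξ⟩ λ_φ`. -/
theorem IsKet.comp (hα : ∀ a : A, Continuous fun t => α t a) {ξ : A} {φ : G → A}
    (hφ : MemL1Δ μ φ) {S : Lp H 2 μ →L[ℂ] H}
    (hS : IsKet α μ π ξ S) {T : Lp H 2 μ →L[ℂ] Lp H 2 μ} (hT : IsRegularOp α μ π φ T) :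
    IsKet α μ π (conv α μ ξ φ) (S ∘L T) := by
  intro f
  obtain ⟨u, hu, hlim, hlim'⟩ := exists_seq_memL1Δ hφ
  have hui : ∀ n, Integrable (u n) μ := fun n => (hu n).1.integrable_of_hasCompactSupport (hu n).2
  have hum : ∀ n, MemL1Δ μ (u n) := fun n => memL1Δ_of_cc (hu n).1 (hu n).2
  choose Tn _ hTn _ using fun n => exists_isRegularOp (μ := μ) (π := π) hα (hui n)
  -- Both sides of the identity are limits along u_n: the left through convergence of λ_{u_n} in
  -- operator norm, the right through convergence of ξ * u_n in A.
  have h1 : Tendsto (fun n => S (Tn n (ccToLp μ f))) atTop (𝓝 (S (T (ccToLp μ f)))) := by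
    have hTT : Tendsto Tn atTop (𝓝 T) := by
      refine tendsto_iff_norm_sub_tendsto_zero.2 ?_
      refine squeeze_zero (fun n => norm_nonneg _) (fun n => ?_) hlim
      rw [norm_sub_rev]
      exact (hT.sub hα hφ.1 (hui n) (hTn n)).norm_le hα (hφ.1.sub (hui n))
    exact (S.continuous.tendsto _).comp
      (((ContinuousLinearMap.apply ℂ (Lp H 2 μ) (ccToLp μ f)).continuous.tendsto T).comp hTT)
  have h2 : Tendsto (fun n => ketInt α μ π (conv α μ ξ (u n)) f) atTop
      (𝓝 (ketInt α μ π (conv α μ ξ φ) f)) := by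
    have hlim0 := (hlim'.const_mul ‖ξ‖).mul_const (∫ v, modularRoot v * ‖(f : G → H) v‖ ∂μ)
    rw [mul_zero, zero_mul] at hlim0
    refine tendsto_iff_norm_sub_tendsto_zero.2 ?_
    refine squeeze_zero (fun n => norm_nonneg _) (fun n => ?_)
      hlim0
    rw [norm_sub_rev, ← ketInt_sub_left hα, ← conv_sub hα hφ (hum n)]
    refine (norm_ketInt_le _ _).trans ?_
    gcongr
    · exact integral_nonneg fun u => mul_nonneg (modularRoot_pos u).le (norm_nonneg _)
    · exact norm_conv_le hα (hφ.sub (hum n)) ξ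
  refine tendsto_nhds_unique h1 (h2.congr fun n => ?_)
  exact (hS.comp_of_cc hα (hu n).1 (hu n).2 (hTn n) f).symm

end Ket

end RieffelProper

namespace RieffelProper

/-! ### Square roots, approximate units and multipliers -/

section CStar

/-- Positivity is visible only in the larger algebra `N`, but the root has to lie in `B`. The
functional calculus commutes with the isometric σ, so the square root of b formed inside `B` maps to
the square root of σ(b). -/
theorem exists_selfAdjoint_sq_eq {M N : Type*} [NonUnitalCStarAlgebra M] [NonUnitalCStarAlgebra N]
    (σ : M →⋆ₙₐ[ℂ] N) (hσ : Function.Injective σ) {B : NonUnitalStarSubalgebra ℂ M}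
    (hB : IsClosed (B : Set M)) {b : M} (hb : b ∈ B) {y : N} (hy : σ b = star y * y) :
    ∃ c ∈ B, star c = c ∧ b = c * c := by
  let _ := CStarAlgebra.spectralOrder N
  have := CStarAlgebra.spectralOrderedRing N
  have hsa : IsSelfAdjoint b := hσ (by rw [map_star, hy]; simp)
  have hsσ : IsSelfAdjoint (σ b) := hsa.map σ
  have hσ0 : 0 ≤ σ b := hy ▸ star_mul_self_nonneg y
  have hcont : Continuous σ := (NonUnitalStarAlgHom.isometry σ hσ).continuous
  have hc : IsSelfAdjoint (cfcₙ Real.sqrt b) := cfcₙ_predicate _ _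
  refine ⟨cfcₙ Real.sqrt b, cfcₙ_mem (𝕜' := ℂ) _ hb, hc, hσ ?_⟩
  rw [map_mul, σ.map_cfcₙ Real.sqrt b (by fun_prop) (by simp) hcont hsa hsσ,
    ← cfcₙ_mul _ _ _ (by fun_prop) (by simp) (by fun_prop) (by simp)]
  conv_lhs => rw [← cfcₙ_id ℝ (σ b)]
  refine cfcₙ_congr fun x hx => ?_
  exact (Real.mul_self_sqrt (quasispectrum_nonneg_of_nonneg _ hσ0 x hx)).symm

theorem exists_approximateUnit (A : Type*) [NonUnitalCStarAlgebra A] :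
    ∃ l : Filter A, l.NeBot ∧ (∀ a, Tendsto (fun e => e * a) l (𝓝 a)) ∧
      (∀ a, Tendsto (fun e => a * e) l (𝓝 a)) ∧ ∀ᶠ e in l, ‖e‖ ≤ 1 := by
  let _ := CStarAlgebra.spectralOrder A
  have := CStarAlgebra.spectralOrderedRing A
  have h := CStarAlgebra.increasingApproximateUnit A
  exact ⟨_, h.neBot, h.tendsto_mul_right, h.tendsto_mul_left, h.eventually_norm⟩

variable {A : Type uA} [NonUnitalCStarAlgebra A]

theorem eq_of_forall_mul_left {a b : A} (h : ∀ x, x * a = x * b) : a = b := by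
  have h1 : star (a - b) * (a - b) = 0 := by rw [mul_sub, h, sub_self]
  exact sub_eq_zero.1 (CStarRing.star_mul_self_eq_zero_iff _ |>.1 h1)

theorem multiplier_fst_mul (m : 𝓜(ℂ, A)) (a b : A) : m.fst (a * b) = m.fst a * b :=
  eq_of_forall_mul_left fun x => by
    rw [← m.central, ← mul_assoc, m.central, mul_assoc]

theorem multiplier_ext {m m' : 𝓜(ℂ, A)} (h : ∀ a, m.fst a = m'.fst a) : m = m' := by
  rw [← sub_eq_zero, ← norm_eq_zero, ← DoubleCentralizer.norm_fst, norm_eq_zero,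
    DoubleCentralizer.sub_fst, sub_eq_zero]
  exact ContinuousLinearMap.ext h

theorem norm_multiplier_fst_le (m : 𝓜(ℂ, A)) (a : A) : ‖m.fst a‖ ≤ ‖m‖ * ‖a‖ := by
  rw [← DoubleCentralizer.norm_fst]
  exact m.fst.le_opNorm a

end CStar

/-! ### Extension of π to the multiplier algebra -/

section MultiplierRep

variable {A : Type uA} [NonUnitalCStarAlgebra A]
variable {H : Type uH} [NormedAddCommGroup H] [InnerProductSpace ℂ H] [CompleteSpace H]
variable (π : A →⋆ₙₐ[ℂ] (H →L[ℂ] H))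

/-- The essential subspace of a representation. -/
def essSubspace : Submodule ℂ H := Submodule.span ℂ {x | ∃ a h, x = π a h}

/-- π may be degenerate. The orthogonal complement of its essential subspace is annihilated by π(A),
which reduces statements about operators on H to vectors π(a)h and null vectors. -/
theorem exists_ess_add_null (x : H) :
    ∃ w ∈ (essSubspace π).topologicalClosure, ∃ n, (∀ a, π a n = 0) ∧ x = w + n := by
  have : CompleteSpace (essSubspace π).topologicalClosure :=
    (essSubspace π).isClosed_topologicalClosure.completeSpace_coe
  obtain ⟨w, hw, n, hn, rfl⟩ :=
    (essSubspace π).topologicalClosure.exists_add_mem_mem_orthogonal x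
  refine ⟨w, hw, n, fun a => ?_, rfl⟩
  refine ext_inner_right ℂ fun h => ?_
  rw [inner_rep_left, inner_zero_left]
  exact Submodule.inner_left_of_mem_orthogonal ((essSubspace π).le_topologicalClosure
    (Submodule.subset_span ⟨_, _, rfl⟩)) hn

theorem clm_ext_of_rep {F : Type*} [NormedAddCommGroup F] [NormedSpace ℂ F] {S T : H →L[ℂ] F}
    (h1 : ∀ a x, S (π a x) = T (π a x)) (h2 : ∀ x, (∀ a, π a x = 0) → S x = T x) : S = T := by
  ext x
  obtain ⟨w, hw, n, hn, rfl⟩ := exists_ess_add_null π x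
  rw [map_add, map_add, h2 n hn]
  congr 1
  have hle : (essSubspace π).topologicalClosure ≤ (LinearMap.eqLocus S.toLinearMap T.toLinearMap) := by
    refine Submodule.topologicalClosure_minimal _ ?_ (isClosed_eq S.continuous T.continuous)
    refine Submodule.span_le.2 ?_
    rintro _ ⟨a, h, rfl⟩
    exact h1 a h
  exact hle hw

/-- D is the strong limit of π(m e) along an approximate unit. On π(a)x the limit is π(m a)x, on
null vectors it is 0, and the bound ‖m‖ gives convergence on the closed span. -/
theorem exists_multiplierRep (m : 𝓜(ℂ, A)) :
    ∃ D : H →L[ℂ] H, (∀ a x, D (π a x) = π (m.fst a) x) ∧ ∀ x, (∀ a, π a x = 0) → D x = 0 := by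
  obtain ⟨l, hl, hl1, -, hl2⟩ := exists_approximateUnit A
  have hbd : ∀ᶠ e in l, ∀ x, ‖π (m.fst e) x‖ ≤ ‖m‖ * ‖x‖ := by
    filter_upwards [hl2] with e he x
    refine (norm_rep_apply_le _ _ _).trans ?_
    gcongr
    refine (norm_multiplier_fst_le m e).trans ?_
    exact mul_le_of_le_one_right (norm_nonneg _) he
  have hgen : ∀ a x, Tendsto (fun e => π (m.fst e) (π a x)) l (𝓝 (π (m.fst a) x)) := fun a x => by
    have h : ∀ e, π (m.fst e) (π a x) = π (m.fst (e * a)) x := fun e => by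
      rw [multiplier_fst_mul, rep_mul_apply]
    simp only [h]
    exact ((continuous_rep_apply π m.fst.continuous (continuous_const (y := x))).tendsto a).comp
      (hl1 a)
  have hlim : ∀ x, ∃ y, Tendsto (fun e => π (m.fst e) x) l (𝓝 y) := fun x => by
    obtain ⟨w, hw, n, hn, rfl⟩ := exists_ess_add_null π x
    simp only [map_add, hn, add_zero]
    -- The vectors on which the limit exists form a subspace, closed because the operators π(m e)
    -- are eventually uniformly bounded.
    let V : Submodule ℂ H :=
      { carrier := {x | ∃ y, Tendsto (fun e => π (m.fst e) x) l (𝓝 y)}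
        add_mem' := fun ⟨y, hy⟩ ⟨z, hz⟩ => ⟨y + z, by simpa using hy.add hz⟩
        zero_mem' := ⟨0, by simp⟩
        smul_mem' := fun c _ ⟨y, hy⟩ => ⟨c • y, by simpa using hy.const_smul c⟩ }
    have hVc : IsClosed (V : Set H) := by
      refine isClosed_of_closure_subset fun x hx => ?_
      refine cauchy_map_iff_exists_tendsto.1 ?_
      refine Metric.cauchy_iff.2 ⟨hl.map _, fun ε hε => ?_⟩
      have hδ : 0 < ε / (3 * (‖m‖ + 1)) := by positivity
      obtain ⟨z, ⟨y, hy⟩, hz⟩ := Metric.mem_closure_iff.1 hx _ hδ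
      have hsmall : ∀ᶠ e in l, ‖π (m.fst e) x - y‖ < ε / 2 := by
        filter_upwards [hbd, (tendsto_iff_norm_sub_tendsto_zero.1 hy).eventually
          (gt_mem_nhds (show 0 < ε / 6 by positivity))] with e h1 h2
        have h3 : ‖π (m.fst e) x - π (m.fst e) z‖ < ε / 3 := by
          rw [← map_sub]
          refine (h1 _).trans_lt ?_
          rw [dist_eq_norm] at hz
          calc ‖m‖ * ‖x - z‖ ≤ (‖m‖ + 1) * ‖x - z‖ := by gcongr; linarith
            _ < (‖m‖ + 1) * (ε / (3 * (‖m‖ + 1))) := by gcongr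
            _ = ε / 3 := by field_simp
        linarith [norm_sub_le_norm_sub_add_norm_sub (π (m.fst e) x) (π (m.fst e) z) y]
      refine ⟨_, image_mem_map hsmall, ?_⟩
      rintro _ ⟨e, he, rfl⟩ _ ⟨e', he', rfl⟩
      rw [dist_eq_norm]
      have he : ‖π (m.fst e) x - y‖ < ε / 2 := he
      have he' : ‖π (m.fst e') x - y‖ < ε / 2 := he'
      rw [norm_sub_rev] at he'
      linarith [norm_sub_le_norm_sub_add_norm_sub (π (m.fst e) x) y (π (m.fst e') x)]
    have hle : (essSubspace π).topologicalClosure ≤ V := by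
      refine Submodule.topologicalClosure_minimal _ (Submodule.span_le.2 ?_) hVc
      rintro _ ⟨a, h, rfl⟩
      exact ⟨_, hgen a h⟩
    exact hle hw
  choose f hf using hlim
  have hadd : ∀ x y, f (x + y) = f x + f y := fun x y =>
    tendsto_nhds_unique (hf (x + y)) (by simpa using (hf x).add (hf y))
  have hsmul : ∀ (c : ℂ) x, f (c • x) = c • f x := fun c x =>
    tendsto_nhds_unique (hf (c • x)) (by simpa using (hf x).const_smul c)
  let L : H →ₗ[ℂ] H := ⟨⟨f, hadd⟩, hsmul⟩
  refine ⟨L.mkContinuous ‖m‖ fun x => ?_, fun a x => ?_, fun x hx => ?_⟩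
  · exact le_of_tendsto (hf x).norm (hbd.mono fun e he => he x)
  · exact tendsto_nhds_unique (hf _) (hgen a x)
  · exact tendsto_nhds_unique (hf x) (by simp [hx])

variable {π} in
-- On the essential part the two operators agree because D also satisfies π(b)D = π(b m). The null
-- part needs an argument of its own, since D* is not known beforehand to vanish there.
theorem multiplierRep_star_aux {m : 𝓜(ℂ, A)} {D D' : H →L[ℂ] H}
    (hD : ∀ a x, D (π a x) = π (m.fst a) x) (hD0 : ∀ x, (∀ a, π a x = 0) → D x = 0)
    (hD' : ∀ a x, D' (π a x) = π ((star m).fst a) x) (hD'0 : ∀ x, (∀ a, π a x = 0) → D' x = 0) :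
    D' = star D := by
  have hl : ∀ b x, π b (D x) = π (m.snd b) x := fun b x => by
    have : (π b).comp D = π (m.snd b) := by
      refine clm_ext_of_rep π (fun a x => ?_) fun x hx => ?_
      · rw [ContinuousLinearMap.comp_apply, hD, ← rep_mul_apply, ← rep_mul_apply, m.central]
      · rw [ContinuousLinearMap.comp_apply, hD0 x hx, map_zero, hx]
    exact congrArg (fun T => T x) this
  have hs : ∀ a x, star D (π a x) = π ((star m).fst a) x := fun a x => by
    refine ext_inner_right ℂ fun y => ?_
    rw [ContinuousLinearMap.star_eq_adjoint, ContinuousLinearMap.adjoint_inner_left,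
      inner_rep_left, hl, inner_rep_left, DoubleCentralizer.star_fst, star_star]
  refine clm_ext_of_rep π (fun a x => by rw [hD', hs]) fun x hx => ?_
  rw [hD'0 x hx]
  have h0 : ∀ a, π a (star D x) = 0 := fun a => by
    refine ext_inner_right ℂ fun y => ?_
    rw [inner_rep_left, ContinuousLinearMap.star_eq_adjoint,
      ContinuousLinearMap.adjoint_inner_left, hD, inner_rep_right, hx]
  -- The vector D*x is itself null, so D kills it and ⟨D*x, D*x⟩ = ⟨x, D D*x⟩ = 0.
  have h1 : inner ℂ (star D x) (star D x) = (0 : ℂ) := by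
    nth_rw 1 [ContinuousLinearMap.star_eq_adjoint]
    rw [ContinuousLinearMap.adjoint_inner_left, hD0 _ h0, inner_zero_right]
  exact (inner_self_eq_zero.1 h1).symm

/-- The extension of a representation of `A` to the multiplier algebra, trivial on the complement of
the essential subspace. -/
noncomputable def multiplierRep : 𝓜(ℂ, A) →⋆ₙₐ[ℂ] (H →L[ℂ] H) where
  toFun m := (exists_multiplierRep π m).choose
  map_smul' c m := by
    refine clm_ext_of_rep π (fun a x => ?_) fun x hx => ?_
    · rw [(exists_multiplierRep π _).choose_spec.1, smul_apply,
        (exists_multiplierRep π _).choose_spec.1]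
      simp
    · rw [(exists_multiplierRep π _).choose_spec.2 x hx, smul_apply,
        (exists_multiplierRep π _).choose_spec.2 x hx]
      simp
  map_zero' := by
    refine clm_ext_of_rep π (fun a x => ?_) fun x hx => ?_
    · rw [(exists_multiplierRep π _).choose_spec.1]
      simp
    · rw [(exists_multiplierRep π _).choose_spec.2 x hx]
      simp
  map_add' m m' := by
    refine clm_ext_of_rep π (fun a x => ?_) fun x hx => ?_
    · rw [(exists_multiplierRep π _).choose_spec.1, add_apply,
        (exists_multiplierRep π _).choose_spec.1, (exists_multiplierRep π _).choose_spec.1]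
      simp
    · rw [(exists_multiplierRep π _).choose_spec.2 x hx, add_apply,
        (exists_multiplierRep π _).choose_spec.2 x hx,
        (exists_multiplierRep π _).choose_spec.2 x hx]
      simp
  map_mul' m m' := by
    refine clm_ext_of_rep π (fun a x => ?_) fun x hx => ?_
    · rw [(exists_multiplierRep π _).choose_spec.1, ContinuousLinearMap.mul_def, ContinuousLinearMap.comp_apply,
        (exists_multiplierRep π _).choose_spec.1, (exists_multiplierRep π _).choose_spec.1]
      simp
    · rw [(exists_multiplierRep π _).choose_spec.2 x hx, ContinuousLinearMap.mul_def, ContinuousLinearMap.comp_apply,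
        (exists_multiplierRep π _).choose_spec.2 x hx, map_zero]
  map_star' m :=
    multiplierRep_star_aux (exists_multiplierRep π m).choose_spec.1
      (exists_multiplierRep π m).choose_spec.2 (exists_multiplierRep π (star m)).choose_spec.1
      (exists_multiplierRep π (star m)).choose_spec.2

theorem multiplierRep_apply (m : 𝓜(ℂ, A)) (a : A) (x : H) :
    multiplierRep π m (π a x) = π (m.fst a) x :=
  (exists_multiplierRep π m).choose_spec.1 a x

theorem multiplierRep_null (m : 𝓜(ℂ, A)) {x : H} (hx : ∀ a, π a x = 0) :
    multiplierRep π m x = 0 :=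
  (exists_multiplierRep π m).choose_spec.2 x hx

variable {π} (hπ : Function.Injective π)

include hπ in
theorem multiplierRep_injective : Function.Injective (multiplierRep π) := fun m m' h =>
  multiplier_ext fun a => hπ <| ContinuousLinearMap.ext fun x => by
    rw [← multiplierRep_apply, h, multiplierRep_apply]

include hπ in
/-- An operator which multiplies `π(A)` into itself on both sides defines a multiplier. -/
theorem exists_multiplier_of_operator (D : H →L[ℂ] H) (h1 : ∀ a, ∃ b, π b = D * π a)
    (h2 : ∀ a, ∃ b, π b = π a * D) :
    ∃ m : 𝓜(ℂ, A), (∀ a, π (m.fst a) = D * π a) ∧ ∀ a, π (m.snd a) = π a * D := by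
  have hn : ∀ a, ‖π a‖ = ‖a‖ := NonUnitalStarAlgHom.norm_map π hπ
  choose f hf using h1
  choose g hg using h2
  let F : A →ₗ[ℂ] A :=
    { toFun := f
      map_add' := fun a b => hπ (by rw [hf, map_add, map_add, hf, hf, mul_add])
      map_smul' := fun c a => hπ (by
        rw [hf, map_smul, RingHom.id_apply, map_smul, hf, mul_smul_comm]) }
  let K : A →ₗ[ℂ] A :=
    { toFun := g
      map_add' := fun a b => hπ (by rw [hg, map_add, map_add, hg, hg, add_mul])
      map_smul' := fun c a => hπ (by
        rw [hg, map_smul, RingHom.id_apply, map_smul, hg, smul_mul_assoc]) }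
  refine ⟨⟨(F.mkContinuous ‖D‖ fun a => ?_, K.mkContinuous ‖D‖ fun a => ?_), fun a b => ?_⟩,
    hf, hg⟩
  · change ‖f a‖ ≤ _
    rw [← hn, hf, ← hn a]
    exact norm_mul_le _ _
  · change ‖g a‖ ≤ _
    rw [← hn, hg, ← hn a, mul_comm]
    exact norm_mul_le _ _
  · change g a * b = a * f b
    exact hπ (by rw [map_mul, map_mul, hf, hg, mul_assoc])

end MultiplierRep

end RieffelProper

namespace RieffelProper

/-! ### Hilbert bimodules of operators -/

section Ternary

variable {M : Type uM} [NonUnitalCStarAlgebra M]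
variable {K : Type uL} [NormedAddCommGroup K] [InnerProductSpace ℂ K] [CompleteSpace K]
variable {H : Type uH} [NormedAddCommGroup H] [InnerProductSpace ℂ H] [CompleteSpace H]
variable {E : Type uA} [NormedAddCommGroup E] [NormedSpace ℂ E]

theorem norm_comp_adjoint_self (x : K →L[ℂ] H) : ‖x ∘L x.adjoint‖ = ‖x‖ ^ 2 := by
  have h := ContinuousLinearMap.norm_adjoint_comp_self x.adjoint
  rw [ContinuousLinearMap.adjoint_adjoint, LinearIsometryEquiv.norm_map] at h
  rw [h, sq]

theorem exists_eq_star_mul_self {T : H →L[ℂ] H} (hT : T.IsPositive) : ∃ y, T = star y * y :=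
  CStarAlgebra.nonneg_iff_eq_star_mul_self.1 ((ContinuousLinearMap.nonneg_iff_isPositive T).2 hT)

/-- A space `E` of operators `K → H` with `E E* ⊆ ρ(B)`, `E* E ⊆ C`, `E C ⊆ E` and `ρ(B) E ⊆ E` is a
Hilbert `B`-`C`-bimodule. -/
theorem exists_hilbertBimodule (ρ : M →⋆ₙₐ[ℂ] (H →L[ℂ] H)) (hρ : Function.Injective ρ)
    {B : NonUnitalStarSubalgebra ℂ M} (hB : IsClosed (B : Set M))
    {C : NonUnitalStarSubalgebra ℂ (K →L[ℂ] K)} (hC : IsClosed (C : Set (K →L[ℂ] K)))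
    (J : E →ₗᵢ[ℂ] (K →L[ℂ] H))
    (hr : ∀ x y, (J x).adjoint ∘L J y ∈ C)
    (hl : ∀ x y, ∃ b ∈ B, ρ b = J x ∘L (J y).adjoint)
    (hrs : ∀ x, ∀ c ∈ C, ∃ z, J z = J x ∘L c)
    (hls : ∀ b ∈ B, ∀ x, ∃ z, J z = ρ b ∘L J x) :
    ∃ X : HilbertBimodule B C E,
      (∀ x y, (X.rinner x y : K →L[ℂ] K) = (J x).adjoint ∘L J y) ∧
      (∀ x y, ρ (X.linner x y) = J x ∘L (J y).adjoint) ∧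
      (∀ x (c : C), J (X.rsmul x c) = J x ∘L c) ∧
      (∀ (b : B) x, J (X.lsmul b x) = ρ b ∘L J x) := by
  choose l hlB hl using hl
  choose rs hrs using fun x (c : C) => hrs x c c.2
  choose ls hls using fun (b : B) x => hls b b.2 x
  have hJ := J.injective
  have hlu : ∀ {b b' : B}, ρ b = ρ b' → b = b' := fun h => Subtype.ext (hρ h)
  let lsmul : B →ₗ[ℂ] E →ₗ[ℂ] E := LinearMap.mk₂ ℂ ls
    (fun b b' x => hJ (by simp only [hls, map_add, NonUnitalStarSubalgebra.coe_add, ContinuousLinearMap.add_comp]))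
    (fun c b x => hJ (by simp only [hls, map_smul, NonUnitalStarSubalgebra.coe_smul, ContinuousLinearMap.smul_comp]))
    (fun b x y => hJ (by simp only [hls, map_add, ContinuousLinearMap.comp_add]))
    (fun c b x => hJ (by simp only [hls, map_smul, ContinuousLinearMap.comp_smul]))
  let rsmul : E →ₗ[ℂ] C →ₗ[ℂ] E := LinearMap.mk₂ ℂ rs
    (fun x y c => hJ (by simp only [hrs, map_add, ContinuousLinearMap.add_comp]))
    (fun c x y => hJ (by simp only [hrs, map_smul, ContinuousLinearMap.smul_comp]))
    (fun x c c' => hJ (by simp only [hrs, map_add, NonUnitalStarSubalgebra.coe_add, ContinuousLinearMap.comp_add]))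
    (fun c x y => hJ (by simp only [hrs, map_smul, NonUnitalStarSubalgebra.coe_smul, ContinuousLinearMap.comp_smul]))
  let linner : E →ₗ[ℂ] E →ₗ⋆[ℂ] B := LinearMap.mk₂'ₛₗ (RingHom.id ℂ) (starRingEnd ℂ)
    (fun x y => ⟨l x y, hlB x y⟩)
    (fun x x' y => hlu (by
      simp only [hl, map_add, NonUnitalStarSubalgebra.coe_add, ContinuousLinearMap.add_comp]))
    (fun c x y => hlu (by
      simp only [hl, map_smul, NonUnitalStarSubalgebra.coe_smul, ContinuousLinearMap.smul_comp,
        RingHom.id_apply]))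
    (fun x y y' => hlu (by
      simp only [hl, map_add, NonUnitalStarSubalgebra.coe_add, ContinuousLinearMap.comp_add]))
    (fun c x y => hlu (by
      simp only [hl, map_smul, map_smulₛₗ, NonUnitalStarSubalgebra.coe_smul,
        ContinuousLinearMap.comp_smul]))
  let rinner : E →ₗ⋆[ℂ] E →ₗ[ℂ] C := LinearMap.mk₂'ₛₗ (starRingEnd ℂ) (RingHom.id ℂ)
    (fun x y => ⟨(J x).adjoint ∘L J y, hr x y⟩)
    (fun x x' y => Subtype.ext (by
      simp only [map_add, NonUnitalStarSubalgebra.coe_add, ContinuousLinearMap.add_comp]))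
    (fun c x y => Subtype.ext (by
      simp only [map_smul, map_smulₛₗ, NonUnitalStarSubalgebra.coe_smul,
        ContinuousLinearMap.smul_comp]))
    (fun x y y' => Subtype.ext (by
      simp only [map_add, NonUnitalStarSubalgebra.coe_add, ContinuousLinearMap.comp_add]))
    (fun c x y => Subtype.ext (by
      simp only [map_smul, NonUnitalStarSubalgebra.coe_smul,
        ContinuousLinearMap.comp_smul, RingHom.id_apply]))
  have hlsm : ∀ b x, J (lsmul b x) = ρ b ∘L J x := hls
  have hrsm : ∀ x (c : C), J (rsmul x c) = J x ∘L c := hrs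
  have hlin : ∀ x y, ρ (linner x y) = J x ∘L (J y).adjoint := hl
  have hrin : ∀ x y, (rinner x y : K →L[ℂ] K) = (J x).adjoint ∘L J y := fun _ _ => rfl
  refine ⟨{
    lsmul := lsmul
    rsmul := rsmul
    linner := linner
    rinner := rinner
    mul_lsmul := fun b b' x => hJ ?_
    rsmul_mul := fun x c c' => hJ ?_
    lsmul_rsmul := fun b x c => hJ ?_
    linner_lsmul := fun b x y => hlu ?_
    rinner_rsmul := fun x y c => Subtype.ext ?_
    star_linner := fun x y => hlu ?_
    star_rinner := fun x y => Subtype.ext ?_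
    linner_self_nonneg := fun x => ?_
    rinner_self_nonneg := fun x => ?_
    norm_linner_self := fun x => ?_
    norm_rinner_self := fun x => ?_
    lsmul_linner := fun x y z => hJ ?_ }, hrin, hlin, hrsm, hlsm⟩
  · rw [hlsm, hlsm, hlsm, NonUnitalStarSubalgebra.coe_mul, map_mul]; rfl
  · rw [hrsm, hrsm, hrsm]; rfl
  · rw [hlsm, hrsm, hrsm, hlsm]; rfl
  · rw [hlin, hlsm, NonUnitalStarSubalgebra.coe_mul, map_mul, hlin]; rfl
  · rw [hrin, hrsm, NonUnitalStarSubalgebra.coe_mul, hrin]; rfl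
  · change ρ (star (linner x y : M)) = _
    rw [map_star, hlin, hlin,
      ContinuousLinearMap.star_eq_adjoint, ContinuousLinearMap.adjoint_comp,
      ContinuousLinearMap.adjoint_adjoint]
  · change star (rinner x y : K →L[ℂ] K) = _
    rw [hrin, hrin,
      ContinuousLinearMap.star_eq_adjoint, ContinuousLinearMap.adjoint_comp,
      ContinuousLinearMap.adjoint_adjoint]
  -- Positivity of (J x)(J x)* provides a factorisation only in B(H); `exists_selfAdjoint_sq_eq`
  -- moves it into `B`.
  · obtain ⟨y, hy⟩ := exists_eq_star_mul_self (J x).isPositive_self_comp_adjoint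
    obtain ⟨c, hc, hcs, h⟩ := exists_selfAdjoint_sq_eq ρ hρ hB (linner x x).2
      ((hlin x x).trans hy)
    exact ⟨⟨c, hc⟩, Subtype.ext (by
      change _ = c * star c
      rw [hcs, h])⟩
  · obtain ⟨y, hy⟩ := exists_eq_star_mul_self (J x).isPositive_adjoint_comp_self
    obtain ⟨c, hc, hcs, h⟩ := exists_selfAdjoint_sq_eq (NonUnitalStarAlgHom.id ℂ (K →L[ℂ] K))
      Function.injective_id hC (rinner x x).2 ((hrin x x).trans hy)
    exact ⟨⟨c, hc⟩, Subtype.ext (by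
      change _ = star c * c
      rw [hcs, h])⟩
  · have h1 : ‖ρ (linner x x)‖ = ‖(linner x x : M)‖ := NonUnitalStarAlgHom.norm_map ρ hρ _
    rw [hlin, norm_comp_adjoint_self, J.norm_map] at h1
    exact h1.symm
  · change ‖(J x).adjoint ∘L J x‖ = _
    rw [ContinuousLinearMap.norm_adjoint_comp_self, J.norm_map, sq]
  · rw [hlsm, hlin, hrsm, hrin]; rfl

end Ternary

end RieffelProper

namespace RieffelProper

/-! ### Continuity of the inner products -/

section Sesquilinear

variable {E : Type*} [NormedAddCommGroup E] [NormedSpace ℂ E]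
variable {N : Type*} [NormedAddCommGroup N] [NormedSpace ℂ N]

theorem sesquilinear_polarization (b : E →ₗ⋆[ℂ] E →ₗ[ℂ] N) (x y : E) :
    (4 : ℂ) • b x y = b (x + y) (x + y) - b (x - y) (x - y) -
      Complex.I • (b (x + Complex.I • y) (x + Complex.I • y) -
        b (x - Complex.I • y) (x - Complex.I • y)) := by
  simp only [map_add, map_sub, LinearMap.add_apply, LinearMap.sub_apply, map_smul,
    LinearMap.map_smulₛₗ₂, Complex.conj_I, smul_sub, smul_add, smul_smul, Complex.I_mul_I,
    neg_smul, neg_neg, one_smul]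
  match_scalars <;> first
    | ring1
    | linear_combination (-2 : ℂ) * Complex.I_sq

/-- Only the diagonal norms are given, with no Cauchy–Schwarz inequality. Polarization bounds b(x,
y) for y in the unit ball, and a linear map bounded on a ball is continuous. -/
theorem continuous_sesquilinear (b : E →ₗ⋆[ℂ] E →ₗ[ℂ] N) (hb : ∀ z, ‖b z z‖ = ‖z‖ ^ 2) (x : E) :
    Continuous (b x) := by
  obtain ⟨C, hC⟩ := LinearMap.bound_of_ball_bound one_pos ((‖x‖ + 1) ^ 2) (b x) fun y hy => by
    rw [mem_ball_zero_iff] at hy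
    have h := congrArg norm (sesquilinear_polarization b x y)
    rw [norm_smul] at h
    have h4 : ‖(4 : ℂ)‖ = 4 := by simp
    have hz : ∀ z : E, ‖z‖ < 1 → ‖b (x + z) (x + z)‖ ≤ (‖x‖ + 1) ^ 2 ∧
        ‖b (x - z) (x - z)‖ ≤ (‖x‖ + 1) ^ 2 := fun z hz => by
      rw [hb, hb]
      constructor <;> gcongr
      · exact (norm_add_le _ _).trans (by linarith)
      · exact (norm_sub_le _ _).trans (by linarith)
    obtain ⟨h1, h2⟩ := hz y hy
    obtain ⟨h3, h5⟩ := hz (Complex.I • y) (by rwa [norm_smul, Complex.norm_I, one_mul])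
    have h6 : ∀ p q r s : N, ‖p - q - Complex.I • (r - s)‖ ≤ ‖p‖ + ‖q‖ + (‖r‖ + ‖s‖) :=
      fun p q r s => by
        refine (norm_sub_le _ _).trans (add_le_add (norm_sub_le _ _) ?_)
        rw [norm_smul, Complex.norm_I, one_mul]
        exact norm_sub_le _ _
    have h7 := h.le.trans (h6 _ _ _ _)
    rw [h4] at h7
    linarith
  exact AddMonoidHomClass.continuous_of_bound (b x) C hC

end Sesquilinear

/-! ### Uniqueness of the completions and extension of inclusions -/

section Iso

variable {M : Type uM} {L : Type uL} [NonUnitalCStarAlgebra M]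
    [NonUnitalCStarAlgebra L] {B : NonUnitalStarSubalgebra ℂ M} {C : NonUnitalStarSubalgebra ℂ L}
    {E : Type uA} [NormedAddCommGroup E] [NormedSpace ℂ E]

theorem HilbertBimodule.continuous_rinner_right (X : HilbertBimodule B C E) (x : E) :
    Continuous fun y => X.rinner x y :=
  continuous_sesquilinear X.rinner X.norm_rinner_self x

theorem HilbertBimodule.continuous_rinner_left (X : HilbertBimodule B C E) (y : E) :
    Continuous fun x => X.rinner x y := by
  simp only [← X.star_rinner y]
  exact continuous_induced_rng.2 (continuous_star.comp (continuous_subtype_val.comp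
    (X.continuous_rinner_right y)))

theorem HilbertBimodule.continuous_linner_left (X : HilbertBimodule B C E) (y : E) :
    Continuous fun x => X.linner x y :=
  continuous_sesquilinear X.linner.flip X.norm_linner_self y

theorem HilbertBimodule.continuous_linner_right (X : HilbertBimodule B C E) (x : E) :
    Continuous fun y => X.linner x y := by
  simp only [← X.star_linner _ x]
  exact continuous_induced_rng.2 (continuous_star.comp (continuous_subtype_val.comp
    (X.continuous_linner_left x)))

theorem HilbertBimodule.eq_of_rinner (X : HilbertBimodule B C E) {x y : E}
    (h : ∀ z, X.rinner z x = X.rinner z y) : x = y := by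
  rw [← sub_eq_zero, ← norm_eq_zero, ← sq_eq_zero_iff, ← X.norm_rinner_self, map_sub, h, sub_self,
    norm_zero]

theorem HilbertBimodule.eq_of_linner (X : HilbertBimodule B C E) {x y : E}
    (h : ∀ z, X.linner x z = X.linner y z) : x = y := by
  rw [← sub_eq_zero, ← norm_eq_zero, ← sq_eq_zero_iff, ← X.norm_linner_self, map_sub X.linner,
    LinearMap.sub_apply, h, sub_self, norm_zero]

variable {G : Type uG} [Group G] [TopologicalSpace G] [IsTopologicalGroup G]
  [LocallyCompactSpace G] [T2Space G] [MeasurableSpace G] [BorelSpace G] {μ : Measure G}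
  [μ.IsHaarMeasure] [μ.Regular]
variable {A : Type uA} [NonUnitalCStarAlgebra A]
variable {H : Type uH} [NormedAddCommGroup H] [InnerProductSpace ℂ H] [CompleteSpace H]
variable {α : G →* (A ≃⋆ₐ[ℂ] A)} {π : A →⋆ₙₐ[ℂ] (H →L[ℂ] H)}

theorem HasStrictIntegral.unique {f : G → A} {m m' : 𝓜(ℂ, A)} (h : HasStrictIntegral μ f m)
    (h' : HasStrictIntegral μ f m') : m = m' :=
  multiplier_ext fun a => tendsto_nhds_unique (h a).1 (h' a).1

/-- The right-hand side does not involve S, so ξ has the same norm in every completion 𝓕(S) with ξ ∈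
S. -/
theorem FModule.norm_ι_sq {S : Submodule ℂ A} (X : FModule α μ π S) (ξ : S)
    {T : Lp H 2 μ →L[ℂ] Lp H 2 μ} (hT : IsRegularOp α μ π (braket α (ξ : A) ξ) T) :
    ‖X.ι ξ‖ ^ 2 = ‖T‖ := by
  rw [← X.bimod.norm_rinner_self, hT.unique (X.rinner_ι ξ ξ)]
  rfl

section Extension

variable {S S' : Submodule ℂ A} (h : S ≤ S') (X : FModule α μ π S) (X' : FModule α μ π S')

theorem FModule.exists_extension (hd : DenseRange fun ξ : S => X'.ι ⟨ξ, h ξ.2⟩) :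
    ∃ U : X.E ≃ₗᵢ[ℂ] X'.E, ∀ ξ : S, U (X.ι ξ) = X'.ι ⟨ξ, h ξ.2⟩ := by
  have hn : ∀ ξ : S, ‖X'.ι ⟨ξ, h ξ.2⟩‖ = ‖X.ι ξ‖ := fun ξ => by
    rw [← sq_eq_sq₀ (norm_nonneg _) (norm_nonneg _), X.norm_ι_sq ξ (X.rinner_ι ξ ξ),
      X'.norm_ι_sq ⟨ξ, h ξ.2⟩ (X.rinner_ι ξ ξ)]
  let e₂ : S →ₗ[ℂ] X'.E := X'.ι ∘ₗ Submodule.inclusion h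
  exact ⟨(LinearEquiv.refl ℂ S).extendOfIsometry X.ι e₂ X.dense_ι hd hn,
      (LinearEquiv.refl ℂ S).extendOfIsometry_eq X.ι e₂ X.dense_ι hd hn⟩

variable {h X X'} {U : X.E ≃ₗᵢ[ℂ] X'.E} (hU : ∀ ξ : S, U (X.ι ξ) = X'.ι ⟨ξ, h ξ.2⟩)

include hU

theorem FModule.map_rinner (x y : X.E) :
    X'.bimod.rinner (U x) (U y) = X.bimod.rinner x y := by
  have h1 : ∀ (ξ : S) y, X'.bimod.rinner (U (X.ι ξ)) (U y) = X.bimod.rinner (X.ι ξ) y :=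
    fun ξ => congrFun (X.dense_ι.equalizer
      ((X'.bimod.continuous_rinner_right _).comp U.continuous)
      (X.bimod.continuous_rinner_right _) (funext fun η => Subtype.ext (by
        simp only [Function.comp_apply, hU]
        exact (X'.rinner_ι ⟨ξ, h ξ.2⟩ ⟨η, h η.2⟩).unique (X.rinner_ι ξ η))))
  exact congrFun (X.dense_ι.equalizer
    ((X'.bimod.continuous_rinner_left _).comp U.continuous)
    (X.bimod.continuous_rinner_left y) (funext fun ξ => h1 ξ y)) x

theorem FModule.map_linner (x y : X.E) :
    (X'.bimod.linner (U x) (U y) : 𝓜(ℂ, A)) = (X.bimod.linner x y : 𝓜(ℂ, A)) := by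
  have h1 : ∀ (ξ : S) y, (X'.bimod.linner (U (X.ι ξ)) (U y) : 𝓜(ℂ, A)) =
      (X.bimod.linner (X.ι ξ) y : 𝓜(ℂ, A)) :=
    fun ξ => congrFun (X.dense_ι.equalizer
      (continuous_subtype_val.comp ((X'.bimod.continuous_linner_right _).comp U.continuous))
      (continuous_subtype_val.comp (X.bimod.continuous_linner_right _)) (funext fun η => by
        simp only [Function.comp_apply, hU]
        exact (X'.linner_ι ⟨ξ, h ξ.2⟩ ⟨η, h η.2⟩).unique (X.linner_ι ξ η)))
  exact congrFun (X.dense_ι.equalizer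
    (continuous_subtype_val.comp ((X'.bimod.continuous_linner_left _).comp U.continuous))
    (continuous_subtype_val.comp (X.bimod.continuous_linner_left y))
    (funext fun ξ => h1 ξ y)) x

/-- The action is recovered from the inner product: both sides equal ⟨z, x⟩c. Hence U intertwines
the right actions without any computation on the image of ι. -/
theorem FModule.rinner_map_rsmul (x z : X.E) (c : reducedCrossedProduct α μ π) :
    X'.bimod.rinner (U z) (U (X.bimod.rsmul x c)) =
      X'.bimod.rinner (U z) (X'.bimod.rsmul (U x) c) :=
  (map_rinner hU _ _).trans ((X.bimod.rinner_rsmul _ _ _).trans (Eq.trans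
    (congrArg (· * c) (map_rinner hU z x).symm) (X'.bimod.rinner_rsmul _ _ _).symm))

theorem FModule.map_rsmul (x : X.E) (c : reducedCrossedProduct α μ π) :
    U (X.bimod.rsmul x c) = X'.bimod.rsmul (U x) c :=
  X'.bimod.eq_of_rinner fun z => Eq.subst (motive := fun w => X'.bimod.rinner w
    (U (X.bimod.rsmul x c)) = X'.bimod.rinner w (X'.bimod.rsmul (U x) c))
    (U.apply_symm_apply z) (rinner_map_rsmul hU x (U.symm z) c)

theorem FModule.map_lsmul (m : 𝓜(ℂ, A)) (hm : m ∈ fixedPointAlgebra α μ S)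
    (hm' : m ∈ fixedPointAlgebra α μ S') (x : X.E) :
    U (X.bimod.lsmul ⟨m, hm⟩ x) = X'.bimod.lsmul ⟨m, hm'⟩ (U x) := by
  refine X'.bimod.eq_of_linner fun z => Subtype.ext ?_
  obtain ⟨z, rfl⟩ := U.surjective z
  rw [map_linner hU, X.bimod.linner_lsmul, X'.bimod.linner_lsmul, NonUnitalStarSubalgebra.coe_mul,
    NonUnitalStarSubalgebra.coe_mul, map_linner hU]

end Extension

theorem existsUnique_isCanonicalIso {S S' : Submodule ℂ A} (h : S ≤ S')
    (hfix : fixedPointAlgebra α μ S = fixedPointAlgebra α μ S')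
    (X : FModule α μ π S) (X' : FModule α μ π S')
    (hd : DenseRange fun ξ : S => X'.ι ⟨ξ, h ξ.2⟩) :
    ∃! U : X.E ≃ₗᵢ[ℂ] X'.E, IsCanonicalIso h X X' U := by
  obtain ⟨U, hU⟩ := X.exists_extension h X' hd
  refine ⟨U, ⟨hfix, hU, FModule.map_rinner hU, FModule.map_linner hU, FModule.map_rsmul hU,
    FModule.map_lsmul hU⟩, fun V hV => LinearIsometryEquiv.ext fun x => ?_⟩
  exact congrFun (X.dense_ι.equalizer V.continuous U.continuous
    (funext fun ξ => (hV.map_ι ξ).trans (hU ξ).symm)) x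

end Iso

end RieffelProper

namespace RieffelProper

/-! ### Recovering π from kets, and uniform bounds on the compact integrals -/

section KetProduct

variable {G : Type uG} [Group G] [TopologicalSpace G] [IsTopologicalGroup G]
  [LocallyCompactSpace G] [T2Space G] [MeasurableSpace G] [BorelSpace G] {μ : Measure G}
  [μ.IsHaarMeasure] [μ.Regular]
variable {A : Type uA} [NonUnitalCStarAlgebra A]
variable {H : Type uH} [NormedAddCommGroup H] [InnerProductSpace ℂ H] [CompleteSpace H]
variable {α : G →* (A ≃⋆ₐ[ℂ] A)} {π : A →⋆ₙₐ[ℂ] (H →L[ℂ] H)}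

theorem hasCompactSupport_real_smul {ψ : G → ℝ} (hψ : HasCompactSupport ψ) {v : G → H} :
    HasCompactSupport fun t => ψ t • v t :=
  HasCompactSupport.intro hψ fun t ht => by rw [image_eq_zero_of_notMem_tsupport ht, zero_smul]

theorem hasCompactSupport_real_mul {ψ : G → ℝ} (hψ : HasCompactSupport ψ) (v : G → ℝ) :
    HasCompactSupport fun t => ψ t * v t :=
  HasCompactSupport.intro hψ fun t ht => by rw [image_eq_zero_of_notMem_tsupport ht, zero_mul]

/-- On f = ψh, with ψ a bump of integral 1 near the identity, the ket of a takes a value near π(a)h.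
One ψ serves a and b simultaneously. -/
theorem IsKet.exists_approx (hα : ∀ a : A, Continuous fun t => α t a) {a b : A}
    {S T : Lp H 2 μ →L[ℂ] H} (hS : IsKet α μ π a S) (hT : IsKet α μ π b T) (h : H) {ε : ℝ}
    (hε : 0 < ε) : ∃ F, ‖S F - π a h‖ ≤ ε ∧ ‖T F - π b h‖ ≤ ε := by
  have hF : ∀ c : A, Continuous fun u => modularRoot u • π (α u⁻¹ c) h := fun c =>
    continuous_ketIntegrand hα c continuous_const
  have hF1 : ∀ c : A, modularRoot (1 : G) • π (α (1 : G)⁻¹ c) h = π c h := fun c => by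
    rw [modularRoot_one, one_smul, inv_one, action_one]
  have hnear : ∀ c : A, ∀ᶠ u in 𝓝 (1 : G),
      ‖modularRoot u • π (α u⁻¹ c) h - modularRoot (1 : G) • π (α (1 : G)⁻¹ c) h‖ ≤ ε := fun c => by
    filter_upwards [Metric.tendsto_nhds.1 ((hF c).tendsto 1) ε hε] with u hu
    rw [dist_eq_norm] at hu
    exact hu.le
  obtain ⟨ψ, hψ, hψc, h0, hψU, h1⟩ := exists_bump μ ((hnear a).and (hnear b))
  let f : ccSubmodule G H :=
    ⟨fun u => ψ u • h, hψ.smul continuous_const, hasCompactSupport_real_smul hψc⟩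
  have hk : ∀ c : A, ketInt α μ π c f = ∫ u, ψ u • (modularRoot u • π (α u⁻¹ c) h) ∂μ := fun c => by
    refine integral_congr_ae (Eventually.of_forall fun u => ?_)
    change modularRoot u • π (α u⁻¹ c) (ψ u • h) = _
    rw [ContinuousLinearMap.map_smul_of_tower, smul_comm]
  refine ⟨ccToLp μ f, ?_, ?_⟩
  · rw [hS, hk, ← hF1]
    exact norm_integral_smul_sub_le (hF a) (fun t ht => ht.1) hψ hψc h0 hψU h1
  · rw [hT, hk, ← hF1]
    exact norm_integral_smul_sub_le (hF b) (fun t ht => ht.2) hψ hψc h0 hψU h1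

/-- The kets of a and b approximate π(a)h and π(b)h on common vectors, so a relation D|a⟩ = |b⟩
descends to Dπ(a) = π(b). -/
theorem IsKet.rep_eq_of_comp_eq (hα : ∀ a : A, Continuous fun t => α t a) {a b : A}
    {S T : Lp H 2 μ →L[ℂ] H} (hS : IsKet α μ π a S) (hT : IsKet α μ π b T) {D : H →L[ℂ] H}
    (hD : D ∘L S = T) : π b = D * π a := by
  ext h
  rw [← sub_eq_zero, ← norm_eq_zero]
  refine le_antisymm (le_of_forall_pos_le_add fun ε hε => ?_) (norm_nonneg _)
  have hδ : 0 < ε / (‖D‖ + 1) := by positivity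
  obtain ⟨F, h1, h2⟩ := hS.exists_approx hα hT h hδ
  have h3 : π b h - D (π a h) = D (S F - π a h) - (T F - π b h) := by
    rw [map_sub, ← hD, ContinuousLinearMap.comp_apply]
    abel
  change ‖π b h - D (π a h)‖ ≤ _
  rw [h3, zero_add]
  calc ‖D (S F - π a h) - (T F - π b h)‖ ≤ ‖D‖ * (ε / (‖D‖ + 1)) + ε / (‖D‖ + 1) :=
        (norm_sub_le _ _).trans (add_le_add ((D.le_opNorm _).trans (by gcongr)) h2)
    _ = ε := by field_simp

/-- |ξ⟩|η⟩*|a⟩ = |ξ⟩ λ_{⟨⟨η,a⟩⟩} = |ξ * ⟨⟨η, a⟩⟩⟩; passing from kets to π gives the claim. -/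
theorem IsKet.rep_conv_braket (hα : ∀ a : A, Continuous fun t => α t a) {ξ η a : A}
    (hηa : MemL1Δ μ (braket α η a)) {S T Q : Lp H 2 μ →L[ℂ] H} (hS : IsKet α μ π ξ S)
    (hT : IsKet α μ π η T) (hQ : IsKet α μ π a Q) :
    π (conv α μ ξ (braket α η a)) = (S ∘L T.adjoint) * π a :=
  hQ.rep_eq_of_comp_eq hα (hS.comp hα hηa (hT.adjoint_comp hα hηa.1 hQ)) rfl

/-- The vector f is |η⟩*h, that is t ↦ Δ(t)^{-1/2} π(α_{t⁻¹}(η*))h, cut off by χ to have compact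
support. -/
theorem inner_ketInt_testVector (hα : ∀ a : A, Continuous fun t => α t a) {η : A} (h : H)
    {χ : G → ℝ} {f : ccSubmodule G H}
    (hf : ∀ t, (f : G → H) t = (χ t * modularRoot t) • π (α t⁻¹ (star η)) h) :
    inner ℂ h (ketInt α μ π η f) =
      ((∫ t, modularRoot t ^ 2 • (χ t * ‖π (α t⁻¹ (star η)) h‖ ^ 2) ∂μ : ℝ) : ℂ) := by
  rw [ketInt, ← integral_inner (integrable_ketIntegrand hα η f), ← integral_complex_ofReal]
  refine integral_congr_ae (Eventually.of_forall fun t => ?_)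
  simp only
  have hn : ∀ v : H, inner ℂ v v = ((‖v‖ ^ 2 : ℝ) : ℂ) := fun v => by
    rw [inner_self_eq_norm_sq_to_K, Complex.ofReal_pow]
    rfl
  rw [hf, inner_smul_right_eq_smul, inner_rep_right, ← map_star, inner_smul_right_eq_smul, hn]
  simp only [Complex.real_smul, smul_eq_mul]
  push_cast
  ring

theorem integral_norm_sq_testVector_le (hα : ∀ a : A, Continuous fun t => α t a) {η : A} (h : H)
    {χ : G → ℝ} (hχ : Continuous χ) (hχc : HasCompactSupport χ) (h0 : ∀ t, 0 ≤ χ t)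
    (h1 : ∀ t, χ t ≤ 1) :
    ∫ t, ‖(χ t * modularRoot t) • π (α t⁻¹ (star η)) h‖ ^ 2 ∂μ ≤
      ∫ t, modularRoot t ^ 2 • (χ t * ‖π (α t⁻¹ (star η)) h‖ ^ 2) ∂μ := by
  have hv : Continuous fun t : G => π (α t⁻¹ (star η)) h :=
    continuous_rep_apply π (continuous_action hα continuous_inv continuous_const) continuous_const
  refine integral_mono_of_nonneg (Eventually.of_forall fun t => by positivity)
    (Continuous.integrable_of_hasCompactSupport
      ((continuous_modularRoot.pow 2).smul (hχ.mul (hv.norm.pow 2)))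
      (HasCompactSupport.intro hχc fun t ht => by
        rw [image_eq_zero_of_notMem_tsupport ht, zero_mul, smul_zero]))
    (Eventually.of_forall fun t => ?_)
  simp only [norm_smul, Real.norm_eq_abs, mul_pow, sq_abs, smul_eq_mul]
  have : χ t ^ 2 ≤ χ t := by
    rw [sq]
    exact mul_le_of_le_one_left (h0 _) (h1 _)
  calc χ t ^ 2 * modularRoot t ^ 2 * ‖π (α t⁻¹ (star η)) h‖ ^ 2
      ≤ χ t * modularRoot t ^ 2 * ‖π (α t⁻¹ (star η)) h‖ ^ 2 := by gcongr
    _ = _ := by ring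

/-- Let Q be the integral. For the cut-off vector f one has Q = ⟨h, S f⟩ ≤ ‖h‖ ‖S‖ ‖f‖, and ‖f‖² ≤ Q
because the cut-off takes values in [0, 1]. Hence Q² ≤ ‖S‖² ‖h‖² Q. -/
theorem IsKet.integral_mul_norm_sq_le (hα : ∀ a : A, Continuous fun t => α t a) {η : A}
    {S : Lp H 2 μ →L[ℂ] H} (hS : IsKet α μ π η S) (h : H) {ψ : G → ℝ} (hψ : Continuous ψ)
    (hψc : HasCompactSupport ψ) (h0 : ∀ t, 0 ≤ ψ t) (h1 : ∀ t, ψ t ≤ 1) :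
    ∫ t, ψ t * ‖π (α t (star η)) h‖ ^ 2 ∂μ ≤ ‖S‖ ^ 2 * ‖h‖ ^ 2 := by
  have hv : Continuous fun t : G => π (α t⁻¹ (star η)) h :=
    continuous_rep_apply π (continuous_action hα continuous_inv continuous_const) continuous_const
  have hχ : Continuous fun t : G => ψ t⁻¹ := hψ.comp continuous_inv
  have hχc : HasCompactSupport fun t : G => ψ t⁻¹ := hasCompactSupport_comp_inv (g := ψ) hψc
  obtain ⟨f, hf⟩ : ∃ f : ccSubmodule G H, ∀ t, (f : G → H) t =
      (ψ t⁻¹ * modularRoot t) • π (α t⁻¹ (star η)) h :=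
    ⟨⟨fun t => (ψ t⁻¹ * modularRoot t) • π (α t⁻¹ (star η)) h,
      (hχ.mul continuous_modularRoot).smul hv,
      hasCompactSupport_real_smul (hasCompactSupport_real_mul hχc _)⟩, fun _ => rfl⟩
  have hQeq := integral_comp_inv_of_hasCompactSupport μ
    (g := fun t => ψ t⁻¹ * ‖π (α t⁻¹ (star η)) h‖ ^ 2) (hχ.mul (hv.norm.pow 2))
    (hasCompactSupport_real_mul hχc _)
  simp only [inv_inv] at hQeq
  have hin := inner_ketInt_testVector (μ := μ) hα h hf
  have hfn : ‖ccToLp μ f‖ ^ 2 ≤ ∫ t, ψ t * ‖π (α t (star η)) h‖ ^ 2 ∂μ := by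
    rw [norm_ccToLp_sq, hQeq]
    simp only [hf]
    exact integral_norm_sq_testVector_le hα h hχ hχc (fun t => h0 _) fun t => h1 _
  have hQ0 : 0 ≤ ∫ t, ψ t * ‖π (α t (star η)) h‖ ^ 2 ∂μ :=
    integral_nonneg fun t => mul_nonneg (h0 t) (by positivity)
  rw [← hQeq] at hin
  clear hQeq
  generalize ∫ t, ψ t * ‖π (α t (star η)) h‖ ^ 2 ∂μ = Q at *
  have hle : Q ≤ ‖h‖ * (‖S‖ * ‖ccToLp μ f‖) := by
    have h3 := (norm_inner_le_norm (𝕜 := ℂ) h (S (ccToLp μ f))).trans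
      (mul_le_mul_of_nonneg_left (S.le_opNorm _) (norm_nonneg h))
    rwa [hS f, hin, Complex.norm_real, Real.norm_of_nonneg hQ0] at h3
  have h5 : Q ^ 2 ≤ (‖S‖ ^ 2 * ‖h‖ ^ 2) * Q := by
    calc Q ^ 2 ≤ (‖h‖ * (‖S‖ * ‖ccToLp μ f‖)) ^ 2 := by gcongr
      _ = (‖S‖ ^ 2 * ‖h‖ ^ 2) * ‖ccToLp μ f‖ ^ 2 := by ring
      _ ≤ _ := by gcongr
  rcases hQ0.eq_or_lt with h6 | h6
  · rw [← h6]; positivity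
  · rw [sq Q] at h5
    exact le_of_mul_le_mul_right h5 h6

theorem IsKet.setIntegral_norm_sq_le (hα : ∀ a : A, Continuous fun t => α t a) {η : A}
    {S : Lp H 2 μ →L[ℂ] H} (hS : IsKet α μ π η S) (h : H) {K : Set G} (hK : IsCompact K) :
    ∫ t in K, ‖π (α t (star η)) h‖ ^ 2 ∂μ ≤ ‖S‖ ^ 2 * ‖h‖ ^ 2 := by
  obtain ⟨ψ, hψ1, hψc, -, hψ01⟩ := exists_continuousMap_one_of_isCompact_subset_isOpen
    hK isOpen_univ (Set.subset_univ K)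
  have hψc' : HasCompactSupport ψ := hψc
  refine le_trans ?_ (hS.integral_mul_norm_sq_le hα h ψ.continuous hψc
    (fun t => (hψ01 t).1) fun t => (hψ01 t).2)
  have hv : Continuous fun t : G => ‖π (α t (star η)) h‖ ^ 2 :=
    (continuous_rep_apply π (hα _) continuous_const).norm.pow 2
  rw [← integral_indicator hK.measurableSet]
  refine integral_mono_of_nonneg (Eventually.of_forall fun t => Set.indicator_nonneg
    (fun t _ => by positivity) t)
    ((ψ.continuous.mul hv).integrable_of_hasCompactSupport (hasCompactSupport_real_mul hψc' _))
    (Eventually.of_forall fun t => ?_)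
  by_cases ht : t ∈ K
  · simp only [Set.indicator_of_mem ht]
    rw [hψ1 ht]
    simp
  · simp only [Set.indicator_of_notMem ht]
    exact mul_nonneg (hψ01 t).1 (by positivity)

/-- The integrals `∫_K α_t(ξ η*) dt`, `K` compact, are bounded uniformly in `K`. -/
theorem IsKet.norm_setIntegral_le (hα : ∀ a : A, Continuous fun t => α t a)
    (hπ : Function.Injective π) {ξ η : A}
    {S T : Lp H 2 μ →L[ℂ] H} (hS : IsKet α μ π ξ S) (hT : IsKet α μ π η T) {K : Set G}
    (hK : IsCompact K) :
    ‖∫ t in K, α t (ξ * star η) ∂μ‖ ≤ (‖S‖ ^ 2 + ‖T‖ ^ 2) / 2 := by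
  have hint : IntegrableOn (fun t => α t (ξ * star η)) K μ := (hα _).continuousOn.integrableOn_compact hK
  have hin : ∀ h k : H, ‖k‖ = ‖h‖ → ‖(inner ℂ k (π (∫ t in K, α t (ξ * star η) ∂μ) h) : ℂ)‖ ≤
      (‖S‖ ^ 2 + ‖T‖ ^ 2) / 2 * ‖h‖ ^ 2 := fun h k hk => by
    let L : A →L[ℂ] H := (ContinuousLinearMap.apply ℂ H h).comp
      ⟨(π : A →ₗ[ℂ] (H →L[ℂ] H)), continuous_rep π⟩
    have hL : π (∫ t in K, α t (ξ * star η) ∂μ) h = ∫ t in K, π (α t (ξ * star η)) h ∂μ :=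
      (L.integral_comp_comm hint).symm
    have hL' : IntegrableOn (fun t => π (α t (ξ * star η)) h) K μ := L.integrable_comp hint
    have h1 : IntegrableOn (fun t => ‖π (α t (star ξ)) k‖ ^ 2) K μ :=
      ((continuous_rep_apply π (hα _) continuous_const).norm.pow 2).continuousOn.integrableOn_compact hK
    have h2 : IntegrableOn (fun t => ‖π (α t (star η)) h‖ ^ 2) K μ :=
      ((continuous_rep_apply π (hα _) continuous_const).norm.pow 2).continuousOn.integrableOn_compact hK
    rw [hL, ← integral_inner hL']
    -- The product ξη* is split across the inner product; Cauchy–Schwarz and 2pq ≤ p² + q² leave one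
    -- square integral for each of ξ and η, both bounded independently of K.
    calc ‖∫ t in K, inner ℂ k (π (α t (ξ * star η)) h) ∂μ‖
        ≤ ∫ t in K, (1 / 2) * (‖π (α t (star ξ)) k‖ ^ 2 + ‖π (α t (star η)) h‖ ^ 2) ∂μ := by
          refine norm_integral_le_of_norm_le ((h1.add h2).const_mul _)
            (Eventually.of_forall fun t => ?_)
          rw [map_mul, rep_mul_apply, inner_rep_right, ← map_star]
          refine (norm_inner_le_norm _ _).trans ?_
          nlinarith [sq_nonneg (‖π (α t (star ξ)) k‖ - ‖π (α t (star η)) h‖)]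
      _ = (1 / 2) * (∫ t in K, ‖π (α t (star ξ)) k‖ ^ 2 ∂μ +
          ∫ t in K, ‖π (α t (star η)) h‖ ^ 2 ∂μ) := by
          rw [integral_const_mul, integral_add h1 h2]
      _ ≤ (1 / 2) * (‖S‖ ^ 2 * ‖k‖ ^ 2 + ‖T‖ ^ 2 * ‖h‖ ^ 2) := by
          gcongr
          · exact hS.setIntegral_norm_sq_le hα k hK
          · exact hT.setIntegral_norm_sq_le hα h hK
      _ = _ := by rw [hk]; ring
  rw [← NonUnitalStarAlgHom.norm_map π hπ]
  refine ContinuousLinearMap.opNorm_le_bound _ (by positivity) fun h => ?_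
  set v := π (∫ t in K, α t (ξ * star η) ∂μ) h with hvdef
  rcases eq_or_ne h 0 with rfl | hh
  · rw [hvdef]; simp
  rcases eq_or_ne v 0 with hv | hv
  · rw [hv, norm_zero]; positivity
  have hv' : 0 < ‖v‖ := norm_pos_iff.2 hv
  have hh' : 0 < ‖h‖ := norm_pos_iff.2 hh
  -- The test vector k is v rescaled to the norm of h, as the bound `hin` requires.
  have h3 := hin h ((‖h‖ / ‖v‖) • v) (by
    rw [norm_smul, norm_div, norm_norm, norm_norm, div_mul_cancel₀ _ hv'.ne'])
  rw [← hvdef, inner_smul_left_eq_smul, inner_self_eq_norm_sq_to_K, norm_smul, norm_pow,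
    RCLike.norm_ofReal, abs_norm, norm_div, norm_norm, norm_norm] at h3
  have h4 : ‖h‖ / ‖v‖ * ‖v‖ ^ 2 = ‖v‖ * ‖h‖ := by field_simp
  rw [h4, sq ‖h‖, ← mul_assoc] at h3
  exact le_of_mul_le_mul_right h3 hh'

end KetProduct

end RieffelProper

namespace RieffelProper

/-! ### Integrals over the net of compact subsets -/

section CompactExhaustion

variable {X : Type*} [TopologicalSpace X] [T2Space X] [LocallyCompactSpace X] [MeasurableSpace X]
  [BorelSpace X] {E : Type*} [NormedAddCommGroup E] [NormedSpace ℝ E]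

/-- A compact set containing the support of u, a C_c approximation of f, misses at most ‖f − u‖₁ of
the integral, since f = f − u off that support. -/
theorem tendsto_setIntegral_compacts {μ : Measure X} [IsFiniteMeasureOnCompacts μ] [μ.Regular]
    {f : X → E} (hf : Integrable f μ) :
    Tendsto (fun K : Compacts X => ∫ t in (K : Set X), f t ∂μ) atTop (𝓝 (∫ t, f t ∂μ)) := by
  obtain ⟨u, hu, hlim, -⟩ := exists_seq_hasCompactSupport hf
  refine Metric.tendsto_nhds.2 fun ε hε => ?_
  obtain ⟨n, hn⟩ := (hlim.eventually (gt_mem_nhds hε)).exists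
  filter_upwards [eventually_ge_atTop (⟨tsupport (u n), (hu n).2⟩ : Compacts X)] with K hK
  have hui : Integrable (u n) μ := (hu n).1.integrable_of_hasCompactSupport (hu n).2
  have h1 := integral_add_compl K.isCompact.measurableSet hf
  have h2 : ∫ t in (K : Set X)ᶜ, f t ∂μ = ∫ t in (K : Set X)ᶜ, (f t - u n t) ∂μ := by
    refine setIntegral_congr_fun K.isCompact.measurableSet.compl fun t ht => ?_
    have h3 : t ∉ tsupport (u n) := fun h => ht (hK h)
    simp only [image_eq_zero_of_notMem_tsupport h3, sub_zero]
  rw [dist_comm, dist_eq_norm, ← h1, add_sub_cancel_left, h2]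
  refine ((norm_integral_le_integral_norm _).trans ?_).trans_lt hn
  exact setIntegral_le_integral (hf.sub hui).norm (Eventually.of_forall fun t => norm_nonneg _)

end CompactExhaustion

/-! ### Existence of the strict integrals -/

section Admissible

variable {G : Type uG} [Group G] [TopologicalSpace G] [IsTopologicalGroup G]
  [LocallyCompactSpace G] [T2Space G] [MeasurableSpace G] [BorelSpace G] {μ : Measure G}
  [μ.IsHaarMeasure] [μ.Regular]
variable {A : Type uA} [NonUnitalCStarAlgebra A]
variable {H : Type uH} [NormedAddCommGroup H] [InnerProductSpace ℂ H] [CompleteSpace H]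
variable {α : G →* (A ≃⋆ₐ[ℂ] A)} {π : A →⋆ₙₐ[ℂ] (H →L[ℂ] H)}

/-- The hypotheses on the dense subspace `R`. -/
structure Admissible (α : G →* (A ≃⋆ₐ[ℂ] A)) (μ : Measure G) (R : Submodule ℂ A) : Prop where
  continuous : ∀ a : A, Continuous fun t => α t a
  dense : Dense (R : Set A)
  memL1Δ_braket : ∀ ξ ∈ R, ∀ η ∈ R, MemL1Δ μ (braket α ξ η)
  conv_mem : ∀ ξ ∈ R, ∀ φ : G → A, MemL1Δ μ φ → conv α μ ξ φ ∈ R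

variable {R : Submodule ℂ A} (hR : Admissible α μ R)

include hR in
theorem Admissible.exists_isKet (π : A →⋆ₙₐ[ℂ] (H →L[ℂ] H)) (ξ : R) :
    ∃ S, IsKet α μ π (ξ : A) S :=
  RieffelProper.exists_isKet hR.continuous (hR.memL1Δ_braket ξ ξ.2 ξ ξ.2).1

/-- The operators `|ξ⟩ : L²(G, H) → H`, `ξ ∈ R`. -/
noncomputable def Admissible.ket (π : A →⋆ₙₐ[ℂ] (H →L[ℂ] H)) :
    R →ₗ[ℂ] (Lp H 2 μ →L[ℂ] H) where
  toFun ξ := (hR.exists_isKet π ξ).choose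
  map_add' ξ η := by
    refine (hR.exists_isKet π _).choose_spec.unique fun f => ?_
    rw [Submodule.coe_add, ketInt_add_left hR.continuous, add_apply,
      (hR.exists_isKet π ξ).choose_spec f, (hR.exists_isKet π η).choose_spec f]
  map_smul' c ξ := by
    refine (hR.exists_isKet π _).choose_spec.unique fun f => ?_
    rw [Submodule.coe_smul, ketInt_smul_left, RingHom.id_apply, smul_apply,
      (hR.exists_isKet π ξ).choose_spec f]

theorem Admissible.isKet (π : A →⋆ₙₐ[ℂ] (H →L[ℂ] H)) (ξ : R) :
    IsKet α μ π (ξ : A) (hR.ket π ξ) :=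
  (hR.exists_isKet π ξ).choose_spec

theorem IsKet.adjoint_null {η : A} {S : Lp H 2 μ →L[ℂ] H}
    (hα : ∀ a : A, Continuous fun t => α t a) (hS : IsKet α μ π η S) {x : H}
    (hx : ∀ a, π a x = 0) : S.adjoint x = 0 := by
  refine (denseRange_ccToLp (H := H) μ).eq_of_inner_right ℂ fun f => ?_
  rw [ContinuousLinearMap.adjoint_inner_right, hS f, inner_zero_right, ketInt,
    ← inner_conj_symm, ← integral_inner (integrable_ketIntegrand hα η f)]
  simp only [inner_smul_right_eq_smul, inner_rep_right, hx, inner_zero_left, smul_zero,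
    integral_zero, map_zero]

include hR

/-- For a in `R` one has α_t(ξη*)a = Δ(t)^{-1/2} α_t(ξ ⟨⟨η, a⟩⟩(t⁻¹)): the integrand defining ξ *
⟨⟨η, a⟩⟩, integrable over all of `G`. -/
theorem Admissible.tendsto_setIntegral_mul {η a : A} (hη : η ∈ R) (ha : a ∈ R) (ξ : A) :
    Tendsto (fun K : Compacts G => (∫ t in (K : Set G), α t (ξ * star η) ∂μ) * a) atTop
      (𝓝 (conv α μ ξ (braket α η a))) := by
  have h := tendsto_setIntegral_compacts
    (integrable_conv_and_eq hR.continuous (hR.memL1Δ_braket η hη a ha) ξ).1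
  refine h.congr fun K => ?_
  have hint : IntegrableOn (fun t => α t (ξ * star η)) K μ :=
    (hR.continuous _).continuousOn.integrableOn_compact K.isCompact
  rw [← integral_mul_const_of_integrable hint]
  refine integral_congr_ae (Eventually.of_forall fun t => ?_)
  simp only [braket_apply, mul_smul_comm, action_real_smul, smul_smul, modularRoot_inv]
  rw [mul_inv_cancel₀ (modularRoot_ne_zero t), one_smul, ← mul_assoc, map_mul (α t) _ (α t⁻¹ a),
    ← action_mul, mul_inv_cancel, action_one]

/-- For a in `R` the element b is ξ * ⟨⟨η, a⟩⟩. The general case follows since `R` is dense and the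
range of the isometry π is closed. -/
theorem Admissible.exists_rep_eq (hπ : Function.Injective π) (ξ η : R) (a : A) :
    ∃ b, π b = (hR.ket π ξ ∘L (hR.ket π η).adjoint) * π a := by
  have hcl : IsClosed {a | (hR.ket π ξ ∘L (hR.ket π η).adjoint) * π a ∈ Set.range π} :=
    (NonUnitalStarAlgHom.isometry π hπ).isClosedEmbedding.isClosed_range.preimage
      (continuous_const.mul (continuous_rep π))
  have hsub : (R : Set A) ⊆ {a | (hR.ket π ξ ∘L (hR.ket π η).adjoint) * π a ∈ Set.range π} :=
    fun a ha => ⟨_, (hR.isKet π ξ).rep_conv_braket hR.continuous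
      (hR.memL1Δ_braket η η.2 a ha) (hR.isKet π η) (hR.isKet π ⟨a, ha⟩)⟩
  exact hcl.closure_subset_iff.2 hsub (hR.dense a)

/-- Convergence is known on the dense subspace `R`; the uniform bound on the compact integrals
extends it to every a. -/
theorem Admissible.tendsto_setIntegral_mul_of_rep_eq (hπ : Function.Injective π) (ξ η : R) {a b : A}
    (hb : π b = (hR.ket π ξ ∘L (hR.ket π η).adjoint) * π a) :
    Tendsto (fun K : Compacts G => (∫ t in (K : Set G), α t ((ξ : A) * star (η : A)) ∂μ) * a) atTop
      (𝓝 b) := by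
  obtain ⟨C, hC0, hC⟩ : ∃ C : ℝ, 0 < C ∧
      ∀ K : Compacts G, ‖∫ t in (K : Set G), α t ((ξ : A) * star (η : A)) ∂μ‖ ≤ C :=
    ⟨(‖hR.ket π ξ‖ ^ 2 + ‖hR.ket π η‖ ^ 2) / 2 + 1, by positivity, fun K =>
      ((hR.isKet π ξ).norm_setIntegral_le hR.continuous hπ (hR.isKet π η) K.isCompact).trans
        (le_add_of_nonneg_right zero_le_one)⟩
  set D := hR.ket π ξ ∘L (hR.ket π η).adjoint with hD
  refine Metric.tendsto_nhds.2 fun ε hε => ?_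
  obtain ⟨a', ha', haa⟩ := Metric.mem_closure_iff.1 (hR.dense a) (ε / (2 * (C + ‖D‖)))
    (by positivity)
  have hb' := (hR.isKet π ξ).rep_conv_braket hR.continuous
      (hR.memL1Δ_braket η η.2 a' ha') (hR.isKet π η) (hR.isKet π ⟨a', ha'⟩)
  rw [← hD] at hb'
  set b' := conv α μ (ξ : A) (braket α (η : A) a')
  have hbb : ‖b' - b‖ ≤ ‖D‖ * ‖a - a'‖ := by
    rw [← NonUnitalStarAlgHom.norm_map π hπ, ← NonUnitalStarAlgHom.norm_map π hπ (a - a'),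
      map_sub, map_sub, hb, hb', ← mul_sub, norm_sub_rev (π a)]
    exact norm_mul_le _ _
  filter_upwards [Metric.tendsto_nhds.1 (hR.tendsto_setIntegral_mul η.2 ha' ξ) (ε / 2)
    (half_pos hε)] with K hK
  rw [dist_eq_norm] at hK haa ⊢
  set I := ∫ t in (K : Set G), α t ((ξ : A) * star (η : A)) ∂μ
  have h1 : I * a - b = I * (a - a') + (I * a' - b') + (b' - b) := by
    rw [mul_sub]
    abel
  have h2 : ‖I * (a - a')‖ ≤ C * ‖a - a'‖ :=
    (norm_mul_le _ _).trans (mul_le_mul_of_nonneg_right (hC K) (norm_nonneg _))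
  have h3 : (C + ‖D‖) * ‖a - a'‖ < ε / 2 := by
    calc (C + ‖D‖) * ‖a - a'‖ < (C + ‖D‖) * (ε / (2 * (C + ‖D‖))) := by gcongr
      _ = ε / 2 := by field_simp
  rw [h1]
  have h4 := norm_add₃_le (a := I * (a - a')) (b := I * a' - b') (c := b' - b)
  linarith

/-- The strict integral `∫ α_t(ξ η*) dt` exists, and acts as `|ξ⟩⟨η|`. -/
theorem Admissible.exists_hasStrictIntegral (hπ : Function.Injective π) (ξ η : R) :
    ∃ m, HasStrictIntegral μ (fun t => α t ((ξ : A) * star (η : A))) m ∧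
      multiplierRep π m = hR.ket π ξ ∘L (hR.ket π η).adjoint := by
  have hstar : star (hR.ket π ξ ∘L (hR.ket π η).adjoint) =
      hR.ket π η ∘L (hR.ket π ξ).adjoint := by
    rw [ContinuousLinearMap.star_eq_adjoint, ContinuousLinearMap.adjoint_comp,
      ContinuousLinearMap.adjoint_adjoint]
  obtain ⟨m, hm1, hm2⟩ := exists_multiplier_of_operator hπ
    (hR.ket π ξ ∘L (hR.ket π η).adjoint) (hR.exists_rep_eq hπ ξ η) fun a => by
      -- Multiplication from the other side follows by taking adjoints, which exchanges ξ and η.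
      obtain ⟨b, hb⟩ := hR.exists_rep_eq hπ η ξ (star a)
      refine ⟨star b, ?_⟩
      rw [map_star, hb, star_mul, ← map_star, star_star, ← hstar, star_star]
  refine ⟨m, fun a => ⟨hR.tendsto_setIntegral_mul_of_rep_eq hπ ξ η (hm1 a), ?_⟩, ?_⟩
  · have h := hR.tendsto_setIntegral_mul_of_rep_eq hπ η ξ (a := star a) (b := star (m.snd a)) (by
      rw [map_star, hm2, star_mul, hstar, ← map_star])
    have h2 := (continuous_star.tendsto _).comp h
    rw [star_star] at h2
    refine h2.congr fun K => ?_
    have hint : ∫ t in (K : Set G), α t ((ξ : A) * star (η : A)) ∂μ =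
        star (∫ t in (K : Set G), α t ((η : A) * star (ξ : A)) ∂μ) := by
      have hs := ((starL' ℝ : A ≃L[ℝ] A) : A →L[ℝ] A).integral_comp_comm
        ((hR.continuous ((η : A) * star (ξ : A))).continuousOn.integrableOn_compact
          (μ := μ) K.isCompact)
      refine Eq.trans ?_ hs
      refine integral_congr_ae (Eventually.of_forall fun t => ?_)
      change _ = star (α t _)
      rw [← map_star, star_mul, star_star]
    simp only [Function.comp_apply]
    rw [star_mul, star_star, hint]
  · refine clm_ext_of_rep π (fun a x => ?_) fun x hx => ?_
    · rw [multiplierRep_apply, hm1]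
      rfl
    · rw [multiplierRep_null π m hx, ContinuousLinearMap.comp_apply,
        (hR.isKet π η).adjoint_null hR.continuous hx, map_zero]

theorem Admissible.multiplierRep_eq (hπ : Function.Injective π) (ξ η : R) {m : 𝓜(ℂ, A)}
    (hm : HasStrictIntegral μ (fun t => α t ((ξ : A) * star (η : A))) m) :
    multiplierRep π m = hR.ket π ξ ∘L (hR.ket π η).adjoint := by
  obtain ⟨m', h1, h2⟩ := hR.exists_hasStrictIntegral hπ ξ η
  rw [hm.unique h1, h2]

theorem Admissible.fst_eq_conv {ξ η : R} {m : 𝓜(ℂ, A)}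
    (hm : HasStrictIntegral μ (fun t => α t ((ξ : A) * star (η : A))) m) {a : A} (ha : a ∈ R) :
    m.fst a = conv α μ (ξ : A) (braket α (η : A) a) :=
  tendsto_nhds_unique (hm a).1 (hR.tendsto_setIntegral_mul η.2 ha ξ)

end Admissible

end RieffelProper

namespace RieffelProper

/-! ### The closed span of EE* -/

section OuterSpan

variable {K : Type uL} [NormedAddCommGroup K] [InnerProductSpace ℂ K] [CompleteSpace K]
variable {H : Type uH} [NormedAddCommGroup H] [InnerProductSpace ℂ H] [CompleteSpace H]

/-- The closed linear span of `E E*`. -/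
noncomputable def outerSpan (E : Submodule ℂ (K →L[ℂ] H)) : Submodule ℂ (H →L[ℂ] H) :=
  (Submodule.span ℂ {T | ∃ x ∈ E, ∃ y ∈ E, T = x ∘L y.adjoint}).topologicalClosure

variable {E : Submodule ℂ (K →L[ℂ] H)}

theorem comp_adjoint_mem_outerSpan {x y : K →L[ℂ] H} (hx : x ∈ E) (hy : y ∈ E) :
    x ∘L y.adjoint ∈ outerSpan E :=
  Submodule.le_topologicalClosure _ (Submodule.subset_span ⟨x, hx, y, hy, rfl⟩)

theorem outerSpan_le {N : Submodule ℂ (H →L[ℂ] H)} (hN : IsClosed (N : Set (H →L[ℂ] H)))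
    (h : ∀ x ∈ E, ∀ y ∈ E, x ∘L y.adjoint ∈ N) : outerSpan E ≤ N := by
  refine Submodule.topologicalClosure_minimal _ (Submodule.span_le.2 ?_) hN
  rintro _ ⟨x, hx, y, hy, rfl⟩
  exact h x hx y hy

theorem continuous_comp_left {L : Type*} [NormedAddCommGroup L] [NormedSpace ℂ L] (T : H →L[ℂ] L) :
    Continuous fun x : K →L[ℂ] H => T ∘L x :=
  (ContinuousLinearMap.compL ℂ K H L T).continuous

theorem continuous_comp_right {L : Type*} [NormedAddCommGroup L] [NormedSpace ℂ L] (x : L →L[ℂ] K) :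
    Continuous fun T : K →L[ℂ] H => T ∘L x :=
  ((ContinuousLinearMap.compL ℂ L K H).flip x).continuous

theorem continuous_comp_adjoint (x : K →L[ℂ] H) :
    Continuous fun y : K →L[ℂ] H => x ∘L y.adjoint :=
  (ContinuousLinearMap.compL ℂ H K H x).continuous.comp
    (ContinuousLinearMap.adjoint (𝕜 := ℂ) (E := K) (F := H)).continuous

theorem continuous_adjoint_comp (y : K →L[ℂ] H) :
    Continuous fun x : K →L[ℂ] H => x.adjoint ∘L y :=
  (continuous_comp_right y).comp
    (ContinuousLinearMap.adjoint (𝕜 := ℂ) (E := K) (F := H)).continuous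

theorem star_mem_outerSpan {T : H →L[ℂ] H} (hT : T ∈ outerSpan E) : star T ∈ outerSpan E := by
  refine (Submodule.isClosed_topologicalClosure _).closure_subset_iff.2 ?_
    (map_mem_closure (t := (outerSpan E : Set (H →L[ℂ] H))) continuous_star hT fun T hT => ?_)
  · exact subset_rfl
  · induction hT using Submodule.span_induction with
    | mem T hT =>
      obtain ⟨x, hx, y, hy, rfl⟩ := hT
      rw [ContinuousLinearMap.star_eq_adjoint, ContinuousLinearMap.adjoint_comp,
        ContinuousLinearMap.adjoint_adjoint]
      exact comp_adjoint_mem_outerSpan hy hx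
    | zero => rw [star_zero]; exact zero_mem _
    | add S T _ _ hS hT => rw [star_add]; exact add_mem hS hT
    | smul c T _ hT => rw [star_smul]; exact Submodule.smul_mem _ _ hT

theorem outerSpan_comp_mem (hE : IsClosed (E : Set (K →L[ℂ] H)))
    (h3 : ∀ x ∈ E, ∀ y ∈ E, ∀ z ∈ E, x ∘L (y.adjoint ∘L z) ∈ E) {T : H →L[ℂ] H}
    (hT : T ∈ outerSpan E) {z : K →L[ℂ] H} (hz : z ∈ E) : T ∘L z ∈ E := by
  let N : Submodule ℂ (H →L[ℂ] H) :=
    E.comap ((ContinuousLinearMap.compL ℂ K H H).flip z : (H →L[ℂ] H) →ₗ[ℂ] (K →L[ℂ] H))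
  have hN : IsClosed (N : Set (H →L[ℂ] H)) :=
    hE.preimage ((ContinuousLinearMap.compL ℂ K H H).flip z).continuous
  exact outerSpan_le hN (fun x hx y hy => h3 x hx y hy z hz) hT

/-- (xy*)(zw*) = (xy*z)w*, and xy*z stays in E by the ternary property. -/
theorem mul_mem_outerSpan (hE : IsClosed (E : Set (K →L[ℂ] H)))
    (h3 : ∀ x ∈ E, ∀ y ∈ E, ∀ z ∈ E, x ∘L (y.adjoint ∘L z) ∈ E) {S T : H →L[ℂ] H}
    (hS : S ∈ outerSpan E) (hT : T ∈ outerSpan E) : S * T ∈ outerSpan E := by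
  let N : Submodule ℂ (H →L[ℂ] H) :=
    (outerSpan E).comap (LinearMap.mulLeft ℂ S)
  have hN : IsClosed (N : Set (H →L[ℂ] H)) :=
    (Submodule.isClosed_topologicalClosure _).preimage (continuous_const_mul S)
  exact outerSpan_le hN (fun x hx y hy =>
    comp_adjoint_mem_outerSpan (outerSpan_comp_mem hE h3 hS hx) hy) hT

theorem outerSpan_le_of_dense {E₀ : Submodule ℂ (K →L[ℂ] H)} {N : Submodule ℂ (H →L[ℂ] H)}
    (hN : IsClosed (N : Set (H →L[ℂ] H))) (h : ∀ x ∈ E₀, ∀ y ∈ E₀, x ∘L y.adjoint ∈ N) :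
    outerSpan E₀.topologicalClosure ≤ N := by
  have h1 : ∀ x ∈ E₀.topologicalClosure, ∀ y ∈ E₀, x ∘L y.adjoint ∈ N := fun x hx y hy =>
    (hN.preimage (continuous_comp_right y.adjoint)).closure_subset_iff.2 (fun x hx => h x hx y hy) hx
  exact outerSpan_le hN fun x hx y hy =>
    (hN.preimage (continuous_comp_adjoint x)).closure_subset_iff.2 (fun y hy => h1 x hx y hy) hy

end OuterSpan

/-! ### The ternary space of kets as a module over the crossed product -/

section FixedPoint

variable {G : Type uG} [Group G] [TopologicalSpace G] [IsTopologicalGroup G]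
  [LocallyCompactSpace G] [T2Space G] [MeasurableSpace G] [BorelSpace G] {μ : Measure G}
  [μ.IsHaarMeasure] [μ.Regular]
variable {A : Type uA} [NonUnitalCStarAlgebra A]
variable {H : Type uH} [NormedAddCommGroup H] [InnerProductSpace ℂ H] [CompleteSpace H]
variable {α : G →* (A ≃⋆ₐ[ℂ] A)}
variable {R : Submodule ℂ A} (hR : Admissible α μ R) (π : A →⋆ₙₐ[ℂ] (H →L[ℂ] H))

/-- The space of the operators `|ξ⟩`, `ξ ∈ S`. -/
noncomputable def Admissible.ketSpace (S : Submodule ℂ A) : Submodule ℂ (Lp H 2 μ →L[ℂ] H) :=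
  (S.comap R.subtype).map (hR.ket π)

/-- The closure of the space of the operators `|ξ⟩`, `ξ ∈ R`. -/
noncomputable def Admissible.ternary : Submodule ℂ (Lp H 2 μ →L[ℂ] H) :=
  (hR.ketSpace π R).topologicalClosure

variable {π}

theorem Admissible.ket_mem_ketSpace {S : Submodule ℂ A} (ξ : R) (hξ : (ξ : A) ∈ S) :
    hR.ket π ξ ∈ hR.ketSpace π S :=
  ⟨ξ, hξ, rfl⟩

theorem Admissible.ket_mem_ternary (ξ : R) : hR.ket π ξ ∈ hR.ternary π :=
  Submodule.le_topologicalClosure _ (hR.ket_mem_ketSpace ξ ξ.2)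

theorem Admissible.isClosed_ternary :
    IsClosed (hR.ternary π : Set (Lp H 2 μ →L[ℂ] H)) :=
  Submodule.isClosed_topologicalClosure _

theorem Admissible.ternary_induction {p : (Lp H 2 μ →L[ℂ] H) → Prop} (hp : IsClosed {x | p x})
    (h : ∀ ξ : R, p (hR.ket π ξ)) {x : Lp H 2 μ →L[ℂ] H} (hx : x ∈ hR.ternary π) : p x := by
  refine hp.closure_subset_iff.2 ?_ hx
  rintro _ ⟨ξ, -, rfl⟩
  exact h ξ

theorem Admissible.ket_comp (ξ : R) {φ : G → A} (hφ : MemL1Δ μ φ)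
    {T : Lp H 2 μ →L[ℂ] Lp H 2 μ} (hT : IsRegularOp α μ π φ T) :
    hR.ket π ξ ∘L T = hR.ket π ⟨conv α μ (ξ : A) φ, hR.conv_mem ξ ξ.2 φ hφ⟩ :=
  ((hR.isKet π ξ).comp hR.continuous hφ hT).unique (hR.isKet π _)

theorem Admissible.isRegularOp_braket (ξ η : R) :
    IsRegularOp α μ π (braket α (ξ : A) (η : A)) ((hR.ket π ξ).adjoint ∘L hR.ket π η) :=
  (hR.isKet π ξ).adjoint_comp hR.continuous (hR.memL1Δ_braket ξ ξ.2 η η.2).1 (hR.isKet π η)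

/-- On kets, |ξ⟩|η⟩*|ζ⟩ = |ξ * ⟨⟨η, ζ⟩⟩⟩, which is again a ket of `R`. The closure is then reached
in one variable at a time. -/
theorem Admissible.comp_adjoint_comp_mem {x y z : Lp H 2 μ →L[ℂ] H} (hx : x ∈ hR.ternary π)
    (hy : y ∈ hR.ternary π) (hz : z ∈ hR.ternary π) :
    x ∘L (y.adjoint ∘L z) ∈ hR.ternary π := by
  have hc := hR.isClosed_ternary (π := π)
  refine hR.ternary_induction (p := fun x => x ∘L (y.adjoint ∘L z) ∈ hR.ternary π)
    (hc.preimage (continuous_comp_right _)) (fun ξ => ?_) hx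
  refine hR.ternary_induction (p := fun z => hR.ket π ξ ∘L (y.adjoint ∘L z) ∈ hR.ternary π)
    (hc.preimage (continuous_comp_left (hR.ket π ξ ∘L y.adjoint))) (fun ζ => ?_) hz
  refine hR.ternary_induction
    (p := fun y => (hR.ket π ξ ∘L y.adjoint) ∘L hR.ket π ζ ∈ hR.ternary π)
    (hc.preimage ((continuous_comp_right _).comp (continuous_comp_adjoint _))) (fun η => ?_) hy
  rw [ContinuousLinearMap.comp_assoc, hR.ket_comp ξ (hR.memL1Δ_braket η η.2 ζ ζ.2)
    (hR.isRegularOp_braket η ζ)]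
  exact hR.ket_mem_ternary _

theorem Admissible.adjoint_comp_mem {x y : Lp H 2 μ →L[ℂ] H} (hx : x ∈ hR.ternary π)
    (hy : y ∈ hR.ternary π) : x.adjoint ∘L y ∈ reducedCrossedProduct α μ π := by
  have hc : IsClosed (reducedCrossedProduct α μ π : Set (Lp H 2 μ →L[ℂ] Lp H 2 μ)) :=
    NonUnitalStarSubalgebra.isClosed_topologicalClosure _
  refine hR.ternary_induction (p := fun y => x.adjoint ∘L y ∈ reducedCrossedProduct α μ π)
    (hc.preimage (continuous_comp_left x.adjoint)) (fun η => ?_) hy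
  refine hR.ternary_induction
    (p := fun x => x.adjoint ∘L hR.ket π η ∈ reducedCrossedProduct α μ π)
    (hc.preimage (continuous_adjoint_comp (hR.ket π η))) (fun ξ => ?_) hx
  exact (hR.isRegularOp_braket ξ η).mem hR.continuous (hR.memL1Δ_braket ξ ξ.2 η η.2).1

theorem Admissible.comp_regularOp_mem {φ : G → A} (hφ : Continuous φ) (hφc : HasCompactSupport φ)
    {T : Lp H 2 μ →L[ℂ] Lp H 2 μ} (hT : IsRegularOp α μ π φ T) {x : Lp H 2 μ →L[ℂ] H}
    (hx : x ∈ hR.ternary π) : x ∘L T ∈ hR.ternary π :=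
  hR.ternary_induction (p := fun x => x ∘L T ∈ hR.ternary π)
    (hR.isClosed_ternary.preimage (continuous_comp_right _)) (fun ξ => by
      rw [hR.ket_comp ξ (memL1Δ_of_cc hφ hφc) hT]
      exact hR.ket_mem_ternary _) hx

/-- If `x λ_φ ∈ N` for all `x ∈ E` and `φ ∈ C_c(G, A)`, then `E C ⊆ N` for the reduced crossed
product `C`. -/
theorem Admissible.comp_mem_of_forall_regularOp {N : Submodule ℂ (Lp H 2 μ →L[ℂ] H)}
    (hN : IsClosed (N : Set (Lp H 2 μ →L[ℂ] H))) (hNE : N ≤ hR.ternary π)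
    (hgen : ∀ φ : G → A, Continuous φ → HasCompactSupport φ → ∀ T, IsRegularOp α μ π φ T →
      ∀ x ∈ hR.ternary π, x ∘L T ∈ N)
    {x : Lp H 2 μ →L[ℂ] H} (hx : x ∈ hR.ternary π) {c : Lp H 2 μ →L[ℂ] Lp H 2 μ}
    (hc : c ∈ reducedCrossedProduct α μ π) : x ∘L c ∈ N := by
  have hcl : IsClosed {c : Lp H 2 μ →L[ℂ] Lp H 2 μ | x ∘L c ∈ N} :=
    hN.preimage (continuous_comp_left x)
  refine hcl.closure_subset_iff.2 (fun c hc => ?_) hc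
  -- The generated algebra involves adjoints, so the induction carries c and c* together; the
  -- adjoint of a generator is a generator. Quantifying over x handles products.
  suffices h : (∀ x ∈ hR.ternary π, x ∘L c ∈ N) ∧
      ∀ x ∈ hR.ternary π, x ∘L star c ∈ N from h.1 x hx
  clear hx hcl x
  replace hc : c ∈ NonUnitalStarAlgebra.adjoin ℂ {T : Lp H 2 μ →L[ℂ] Lp H 2 μ | ∃ φ : G → A,
    Continuous φ ∧ HasCompactSupport φ ∧ IsRegularOp α μ π φ T} := hc
  induction hc using NonUnitalStarAlgebra.adjoin_induction with
  | mem T hT =>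
    obtain ⟨φ, hφ, hφc, hT⟩ := hT
    obtain ⟨ψ, hψ, hψc, hTs⟩ := isRegularOp_adjoint hR.continuous hφ hφc hT
    exact ⟨fun x hx => hgen φ hφ hφc T hT x hx, fun x hx => hgen ψ hψ hψc _ hTs x hx⟩
  | add c d _ _ h h' =>
    refine ⟨fun x hx => ?_, fun x hx => ?_⟩
    · rw [ContinuousLinearMap.comp_add]
      exact add_mem (h.1 x hx) (h'.1 x hx)
    · rw [star_add, ContinuousLinearMap.comp_add]
      exact add_mem (h.2 x hx) (h'.2 x hx)
  | zero => simp
  | mul c d _ _ h h' =>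
    refine ⟨fun x hx => ?_, fun x hx => ?_⟩
    · rw [ContinuousLinearMap.mul_def, ← ContinuousLinearMap.comp_assoc]
      exact h'.1 _ (hNE (h.1 x hx))
    · rw [star_mul, ContinuousLinearMap.mul_def, ← ContinuousLinearMap.comp_assoc]
      exact h.2 _ (hNE (h'.2 x hx))
  | smul r c _ h =>
    refine ⟨fun x hx => ?_, fun x hx => ?_⟩
    · rw [ContinuousLinearMap.comp_smul]
      exact Submodule.smul_mem _ _ (h.1 x hx)
    · rw [star_smul, ContinuousLinearMap.comp_smul]
      exact Submodule.smul_mem _ _ (h.2 x hx)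
  | star c _ h => exact ⟨h.2, by simpa only [star_star] using h.1⟩

theorem Admissible.comp_reducedCrossedProduct_mem {x : Lp H 2 μ →L[ℂ] H}
    (hx : x ∈ hR.ternary π) {c : Lp H 2 μ →L[ℂ] Lp H 2 μ}
    (hc : c ∈ reducedCrossedProduct α μ π) : x ∘L c ∈ hR.ternary π :=
  hR.comp_mem_of_forall_regularOp hR.isClosed_ternary le_rfl
    (fun _ hφ hφc _ hT _ hx => hR.comp_regularOp_mem hφ hφc hT hx) hx hc

end FixedPoint

end RieffelProper

namespace RieffelProper

theorem span_subset_adjoin {M : Type*} [NonUnitalCStarAlgebra M] (s : Set M) :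
    (Submodule.span ℂ s : Set M) ⊆ NonUnitalStarAlgebra.adjoin ℂ s := fun x hx => by
  replace hx : x ∈ Submodule.span ℂ s := hx
  induction hx using Submodule.span_induction with
  | mem x hx => exact NonUnitalStarAlgebra.subset_adjoin ℂ s hx
  | zero => exact zero_mem (NonUnitalStarAlgebra.adjoin ℂ s)
  | add x y _ _ hx hy => exact add_mem (S := NonUnitalStarSubalgebra ℂ M) hx hy
  | smul c x _ hx => exact SMulMemClass.smul_mem (S := NonUnitalStarSubalgebra ℂ M) c hx

/-! ### The fixed-point algebra as the closed span of EE* -/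

section FixedPointAlgebra

variable {G : Type uG} [Group G] [TopologicalSpace G] [IsTopologicalGroup G]
  [LocallyCompactSpace G] [T2Space G] [MeasurableSpace G] [BorelSpace G] {μ : Measure G}
  [μ.IsHaarMeasure] [μ.Regular]
variable {A : Type uA} [NonUnitalCStarAlgebra A]
variable {H : Type uH} [NormedAddCommGroup H] [InnerProductSpace ℂ H] [CompleteSpace H]
variable {α : G →* (A ≃⋆ₐ[ℂ] A)} {π : A →⋆ₙₐ[ℂ] (H →L[ℂ] H)}
variable {R : Submodule ℂ A} (hR : Admissible α μ R)

theorem isometry_multiplierRep (hπ : Function.Injective π) : Isometry (multiplierRep π) :=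
  NonUnitalStarAlgHom.isometry _ (multiplierRep_injective hπ)

/-- The closed linear span of the multipliers `∫^su α_t(ξ η*) dt` with `ξ, η ∈ S`. -/
noncomputable def leftSpan (α : G →* (A ≃⋆ₐ[ℂ] A)) (μ : Measure G) (S : Submodule ℂ A) :
    Submodule ℂ 𝓜(ℂ, A) :=
  (Submodule.span ℂ (leftInners α μ S)).topologicalClosure

variable {S : Submodule ℂ A} (hS : S ≤ R)

include hR hS in
-- The extension of π is isometric, so the image of `leftSpan α μ S` is closed; it contains the
-- products of kets of S, hence by density the whole closed span of EE*.
theorem Admissible.exists_multiplierRep_eq (hπ : Function.Injective π)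
    (hd : (hR.ketSpace π S).topologicalClosure = hR.ternary π) {p : H →L[ℂ] H}
    (hp : p ∈ outerSpan (hR.ternary π)) : ∃ m ∈ leftSpan α μ S, multiplierRep π m = p := by
  have hle : outerSpan (hR.ternary π) ≤ (leftSpan α μ S).map
      (multiplierRep π : 𝓜(ℂ, A) →ₗ[ℂ] (H →L[ℂ] H)) := by
    rw [← hd]
    refine outerSpan_le_of_dense ((isometry_multiplierRep hπ).isClosedEmbedding.isClosedMap _
      (Submodule.isClosed_topologicalClosure _)) ?_
    rintro _ ⟨ξ, hξ, rfl⟩ _ ⟨η, hη, rfl⟩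
    obtain ⟨m, hm, hm'⟩ := hR.exists_hasStrictIntegral hπ ξ η
    exact ⟨m, Submodule.le_topologicalClosure _
      (Submodule.subset_span ⟨ξ, hξ, η, hη, hm⟩), hm'⟩
  exact hle hp

include hR hS in
-- The condition on the right does not mention S. This is why the three coefficient algebras
-- coincide.
theorem Admissible.mem_leftSpan_iff (hπ : Function.Injective π)
    (hd : (hR.ketSpace π S).topologicalClosure = hR.ternary π) {m : 𝓜(ℂ, A)} :
    m ∈ leftSpan α μ S ↔ multiplierRep π m ∈ outerSpan (hR.ternary π) := by
  constructor
  · have hle : leftSpan α μ S ≤ (outerSpan (hR.ternary π)).comap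
        (multiplierRep π : 𝓜(ℂ, A) →ₗ[ℂ] (H →L[ℂ] H)) := by
      refine Submodule.topologicalClosure_minimal _ (Submodule.span_le.2 ?_)
        (IsClosed.preimage (isometry_multiplierRep hπ).continuous
          (Submodule.isClosed_topologicalClosure _))
      rintro m ⟨ξ, hξ, η, hη, hm⟩
      change multiplierRep π m ∈ outerSpan (hR.ternary π)
      rw [hR.multiplierRep_eq hπ ⟨ξ, hS hξ⟩ ⟨η, hS hη⟩ hm]
      exact comp_adjoint_mem_outerSpan (hR.ket_mem_ternary _) (hR.ket_mem_ternary _)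
    exact fun hm => hle hm
  · intro hm
    obtain ⟨m', hm', h⟩ := hR.exists_multiplierRep_eq hS hπ hd hm
    rwa [← multiplierRep_injective hπ h]

include hR in
theorem Admissible.mul_mem_outerSpan {p q : H →L[ℂ] H} (hp : p ∈ outerSpan (hR.ternary π))
    (hq : q ∈ outerSpan (hR.ternary π)) : p * q ∈ outerSpan (hR.ternary π) :=
  RieffelProper.mul_mem_outerSpan (E := hR.ternary π) hR.isClosed_ternary
    (fun _ hx _ hy _ hz => hR.comp_adjoint_comp_mem hx hy hz) hp hq

include hR in
theorem Admissible.outerSpan_comp_mem {p : H →L[ℂ] H} (hp : p ∈ outerSpan (hR.ternary π))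
    {x : Lp H 2 μ →L[ℂ] H} (hx : x ∈ hR.ternary π) : p ∘L x ∈ hR.ternary π :=
  RieffelProper.outerSpan_comp_mem (E := hR.ternary π) hR.isClosed_ternary
    (fun _ hx _ hy _ hz => hR.comp_adjoint_comp_mem hx hy hz) hp hx

include hR hS in
-- The closed span of EE* is closed under products and adjoints, and these properties pull back to
-- the closed span of the left inner products. It is therefore already the generated C*-algebra.
theorem Admissible.coe_fixedPointAlgebra (hπ : Function.Injective π)
    (hd : (hR.ketSpace π S).topologicalClosure = hR.ternary π) :
    (fixedPointAlgebra α μ S : Set 𝓜(ℂ, A)) = leftSpan α μ S := by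
  have hmul : ∀ a b, a ∈ leftSpan α μ S → b ∈ leftSpan α μ S → a * b ∈ leftSpan α μ S := by
    intro a b ha hb
    rw [hR.mem_leftSpan_iff hS hπ hd] at *
    rw [map_mul]
    exact hR.mul_mem_outerSpan ha hb
  have hstar : ∀ a, a ∈ leftSpan α μ S → star a ∈ leftSpan α μ S := by
    intro a ha
    rw [hR.mem_leftSpan_iff hS hπ hd] at *
    rw [map_star]
    exact star_mem_outerSpan ha
  let N : NonUnitalStarSubalgebra ℂ 𝓜(ℂ, A) :=
    { leftSpan α μ S with
      mul_mem' := hmul _ _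
      star_mem' := hstar _ }
  refine Set.Subset.antisymm ?_ ?_
  · have hle : fixedPointAlgebra α μ S ≤ N :=
      NonUnitalStarSubalgebra.topologicalClosure_minimal _
        (NonUnitalStarAlgebra.adjoin_le fun m hm =>
          Submodule.le_topologicalClosure _ (Submodule.subset_span hm))
        (Submodule.isClosed_topologicalClosure _)
    exact hle
  · exact closure_mono (span_subset_adjoin _)

include hR hS in
theorem Admissible.mem_fixedPointAlgebra_iff (hπ : Function.Injective π)
    (hd : (hR.ketSpace π S).topologicalClosure = hR.ternary π) {m : 𝓜(ℂ, A)} :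
    m ∈ fixedPointAlgebra α μ S ↔ multiplierRep π m ∈ outerSpan (hR.ternary π) := by
  rw [← hR.mem_leftSpan_iff hS hπ hd, ← SetLike.mem_coe, hR.coe_fixedPointAlgebra hS hπ hd]
  rfl

theorem continuous_ketInt_left (hα : ∀ a : A, Continuous fun t => α t a) (f : ccSubmodule G H) :
    Continuous fun ξ : A => ketInt α μ π ξ f := by
  let L : A →ₗ[ℂ] H :=
    ⟨⟨fun ξ => ketInt α μ π ξ f, fun ξ η => ketInt_add_left hα ξ η f⟩,
      fun c ξ => ketInt_smul_left c ξ f⟩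
  exact AddMonoidHomClass.continuous_of_bound L (∫ u, modularRoot u * ‖(f : G → H) u‖ ∂μ)
    fun ξ => (norm_ketInt_le ξ f).trans_eq (mul_comm _ _)

theorem continuous_multiplier_fst (a : A) : Continuous fun m : 𝓜(ℂ, A) => m.fst a := by
  let L : 𝓜(ℂ, A) →ₗ[ℂ] A := ⟨⟨fun m => m.fst a, fun _ _ => rfl⟩, fun _ _ => rfl⟩
  exact AddMonoidHomClass.continuous_of_bound L ‖a‖
    fun m => (norm_multiplier_fst_le m a).trans_eq (mul_comm _ _)

/-- `m |ξ⟩ = |m ξ⟩`. -/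
theorem Admissible.isKet_multiplier (hπ : Function.Injective π) (ξ : R) {m : 𝓜(ℂ, A)}
    (hm : m ∈ leftSpan α μ R) :
    IsKet α μ π (m.fst (ξ : A)) (multiplierRep π m ∘L hR.ket π ξ) := by
  let N : Submodule ℂ 𝓜(ℂ, A) :=
    { carrier := {m | ∀ f : ccSubmodule G H, multiplierRep π m (hR.ket π ξ (ccToLp μ f)) =
        ketInt α μ π (m.fst (ξ : A)) f}
      add_mem' := fun {m m'} h h' f => by
        rw [map_add, add_apply, h f, h' f, DoubleCentralizer.add_fst, add_apply,
          ketInt_add_left hR.continuous]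
      zero_mem' := fun f => by
        simp [ketInt]
      smul_mem' := fun c m h f => by
        rw [map_smul, smul_apply, h f, DoubleCentralizer.smul_fst, smul_apply,
          ketInt_smul_left] }
  have hN : IsClosed (N : Set 𝓜(ℂ, A)) := by
    change IsClosed {m : 𝓜(ℂ, A) | ∀ f : ccSubmodule G H, _}
    rw [Set.ofPred_forall]
    refine isClosed_iInter fun f => isClosed_eq ?_ ?_
    · exact (ContinuousLinearMap.apply ℂ H (hR.ket π ξ (ccToLp μ f))).continuous.comp
        (isometry_multiplierRep hπ).continuous
    · exact (continuous_ketInt_left hR.continuous f).comp (continuous_multiplier_fst _)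
  have hle : leftSpan α μ R ≤ N := by
    refine Submodule.topologicalClosure_minimal _ (Submodule.span_le.2 ?_) hN
    rintro m ⟨ζ, hζ, η, hη, hm⟩ f
    -- For m = ∫^su α_t(ζη*) dt the claim is |ζ⟩|η⟩*|ξ⟩ = |ζ * ⟨⟨η, ξ⟩⟩⟩.
    rw [hR.fst_eq_conv (ξ := ⟨ζ, hζ⟩) (η := ⟨η, hη⟩) hm ξ.2,
      hR.multiplierRep_eq hπ ⟨ζ, hζ⟩ ⟨η, hη⟩ hm]
    exact (hR.isKet π ⟨ζ, hζ⟩).comp hR.continuous (hR.memL1Δ_braket η hη ξ ξ.2)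
      (hR.isRegularOp_braket ⟨η, hη⟩ ξ) f
  exact hle hm

end FixedPointAlgebra

end RieffelProper

namespace RieffelProper

theorem eq_norm_of_sq_eq {K : Type*} [NormedAddCommGroup K] [InnerProductSpace ℂ K]
    [CompleteSpace K] {H : Type*} [NormedAddCommGroup H] [InnerProductSpace ℂ H] [CompleteSpace H]
    {T : K →L[ℂ] H} {r : ℝ} (hr : 0 ≤ r) (h : r ^ 2 = ‖T.adjoint ∘L T‖) : r = ‖T‖ := by
  rw [ContinuousLinearMap.norm_adjoint_comp_self, ← sq] at h
  exact (sq_eq_sq₀ hr (norm_nonneg T)).1 h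

/-! ### Construction of the completions -/

section Completion

variable {G : Type uG} [Group G] [TopologicalSpace G] [IsTopologicalGroup G]
  [LocallyCompactSpace G] [T2Space G] [MeasurableSpace G] [BorelSpace G] {μ : Measure G}
  [μ.IsHaarMeasure] [μ.Regular]
variable {A : Type uA} [NonUnitalCStarAlgebra A]
variable {H : Type uH} [NormedAddCommGroup H] [InnerProductSpace ℂ H] [CompleteSpace H]
variable {α : G →* (A ≃⋆ₐ[ℂ] A)}

/-- A submodule, as a type to be given the seminorm pulled back along a linear map. -/
def Renormed {V W : Type*} [AddCommGroup V] [Module ℂ V] [NormedAddCommGroup W] [NormedSpace ℂ W]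
    (_ : V →ₗ[ℂ] W) : Type _ := V

namespace Renormed

variable {V W : Type*} [AddCommGroup V] [Module ℂ V] [NormedAddCommGroup W] [NormedSpace ℂ W]
  (f : V →ₗ[ℂ] W)

instance : AddCommGroup (Renormed f) := inferInstanceAs (AddCommGroup V)

instance : Module ℂ (Renormed f) := inferInstanceAs (Module ℂ V)

/-- The map defining the seminorm. -/
def map : Renormed f →ₗ[ℂ] W := f

noncomputable instance : SeminormedAddCommGroup (Renormed f) :=
  SeminormedAddCommGroup.induced (Renormed f) W (map f)

noncomputable instance : NormedSpace ℂ (Renormed f) :=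
  NormedSpace.induced ℂ (Renormed f) W (map f)

/-- The canonical map into the completion. -/
noncomputable def toCompletion : Renormed f →ₗ[ℂ] UniformSpace.Completion (Renormed f) :=
  (UniformSpace.Completion.toComplₗᵢ (𝕜 := ℂ) (E := Renormed f)).toLinearMap

theorem denseRange_toCompletion : DenseRange (toCompletion f) :=
  UniformSpace.Completion.denseRange_coe

theorem norm_toCompletion (v : Renormed f) : ‖toCompletion f v‖ = ‖map f v‖ :=
  UniformSpace.Completion.norm_coe v

theorem exists_extension [CompleteSpace W] :
    ∃ J : UniformSpace.Completion (Renormed f) →ₗᵢ[ℂ] W, ∀ v, J (toCompletion f v) = map f v := by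
  have hb : ∀ v, ‖map f v‖ ≤ 1 * ‖toCompletion f v‖ := fun v => by rw [norm_toCompletion, one_mul]
  have hJ : ∀ v, (map f).extendOfNorm (toCompletion f) (toCompletion f v) = map f v := fun v =>
    LinearMap.extendOfNorm_eq (denseRange_toCompletion f) ⟨1, hb⟩ v
  refine ⟨⟨((map f).extendOfNorm (toCompletion f)).toLinearMap, fun x => ?_⟩, hJ⟩
  exact congrFun ((denseRange_toCompletion f).equalizer
    ((map f).extendOfNorm (toCompletion f)).continuous.norm continuous_norm (funext fun v => by
      simp only [Function.comp_apply]
      rw [hJ, norm_toCompletion])) x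

/-- Completing V itself, rather than closing the range of f in W, keeps the space in the universe of
V, as `FModule` demands. -/
theorem exists_completion {V : Type uA} {W : Type*} [AddCommGroup V] [Module ℂ V]
    [NormedAddCommGroup W] [NormedSpace ℂ W] [CompleteSpace W] (f : V →ₗ[ℂ] W) :
    ∃ (E : Type uA) (_ : NormedAddCommGroup E) (_ : NormedSpace ℂ E) (_ : CompleteSpace E)
      (ι : V →ₗ[ℂ] E) (J : E →ₗᵢ[ℂ] W), DenseRange ι ∧
      (∀ v, J (ι v) = f v) ∧ ∀ x, x ∈ closure (Set.range f) ↔ ∃ z, J z = x := by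
  obtain ⟨J, hJ⟩ := exists_extension f
  refine ⟨UniformSpace.Completion (Renormed f), inferInstance, inferInstance, inferInstance,
    toCompletion f, J, denseRange_toCompletion f, hJ, fun x => ⟨fun hx => ?_, ?_⟩⟩
  · have hcl : IsClosed (Set.range J) := J.isometry.isClosedEmbedding.isClosed_range
    refine hcl.closure_subset_iff.2 ?_ hx
    rintro _ ⟨v, rfl⟩
    exact ⟨_, hJ v⟩
  · rintro ⟨z, rfl⟩
    have hcl : IsClosed {z | J z ∈ closure (Set.range f)} := isClosed_closure.preimage J.continuous
    refine (hcl.closure_subset_iff.2 ?_) (denseRange_toCompletion f z)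
    rintro _ ⟨v, rfl⟩
    exact subset_closure ⟨v, (hJ v).symm⟩

end Renormed

variable {R : Submodule ℂ A} (hR : Admissible α μ R) {π : A →⋆ₙₐ[ℂ] (H →L[ℂ] H)}
variable {S : Submodule ℂ A} (hS : S ≤ R)

include hR hS

theorem Admissible.closure_range_ket
    (hd : (hR.ketSpace π S).topologicalClosure = hR.ternary π) :
    closure (Set.range (hR.ket π ∘ₗ Submodule.inclusion hS)) = hR.ternary π := by
  rw [← hd, Submodule.topologicalClosure_coe]
  congr 1
  ext x
  constructor
  · rintro ⟨ξ, rfl⟩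
    exact hR.ket_mem_ketSpace _ ξ.2
  · rintro ⟨ξ, hξ, rfl⟩
    exact ⟨⟨ξ, hξ⟩, rfl⟩

/-- The completion of S in the ket norm is isometric to E, and the bimodule structure is pulled back
from there. -/
theorem Admissible.nonempty_fModule (hπ : Function.Injective π)
    (hd : (hR.ketSpace π S).topologicalClosure = hR.ternary π) :
    Nonempty (FModule α μ π S) := by
  obtain ⟨E, _, _, _, ι, J, hι, hJ, hE⟩ := Renormed.exists_completion (W := Lp H 2 μ →L[ℂ] H)
    (hR.ket π ∘ₗ Submodule.inclusion hS)
  simp only [hR.closure_range_ket hS hd, SetLike.mem_coe] at hE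
  simp only [LinearMap.comp_apply] at hJ
  have hρ := multiplierRep_injective hπ
  have hm := fun z => (hE (J z)).2 ⟨z, rfl⟩
  have hB := fun m => hR.mem_fixedPointAlgebra_iff hS hπ hd (m := m)
  obtain ⟨X, hX1, hX2, hX3, hX4⟩ := exists_hilbertBimodule (B := fixedPointAlgebra α μ S)
    (C := reducedCrossedProduct α μ π) (multiplierRep π) hρ
    (NonUnitalStarSubalgebra.isClosed_topologicalClosure _)
    (NonUnitalStarSubalgebra.isClosed_topologicalClosure _) J
    (fun x y => hR.adjoint_comp_mem (hm x) (hm y))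
    (fun x y => by
      obtain ⟨m, -, h⟩ := hR.exists_multiplierRep_eq hS hπ hd
        (comp_adjoint_mem_outerSpan (hm x) (hm y))
      exact ⟨m, (hB m).2 (h ▸ comp_adjoint_mem_outerSpan (hm x) (hm y)), h⟩)
    (fun x c hc => (hE _).1 (hR.comp_reducedCrossedProduct_mem (hm x) hc))
    (fun b hb x => (hE _).1 (hR.outerSpan_comp_mem ((hB b).1 hb) (hm x)))
  refine ⟨⟨E, X, ι, hι, fun ξ η => ?_, fun ξ η => ?_, fun ξ φ T hφ hT h => ?_, fun m ξ h => ?_⟩⟩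
  · rw [hX1, hJ, hJ]
    exact hR.isRegularOp_braket _ _
  · obtain ⟨m, h1, h2⟩ := hR.exists_hasStrictIntegral hπ (Submodule.inclusion hS ξ)
      (Submodule.inclusion hS η)
    rw [← hJ, ← hJ, ← hX2] at h2
    rw [← hρ h2]
    exact h1
  · apply J.injective
    rw [hX3, hJ, hJ, hR.ket_comp _ hφ hT]
    rfl
  · apply J.injective
    rw [hX4, hJ, hJ]
    exact (hR.isKet_multiplier hπ (Submodule.inclusion hS ξ)
      ((hR.mem_leftSpan_iff le_rfl hπ rfl).2 ((hB m).1 m.2))).unique (hR.isKet π _)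

theorem Admissible.fixedPointAlgebra_eq (hπ : Function.Injective π)
    (hd : (hR.ketSpace π S).topologicalClosure = hR.ternary π) :
    fixedPointAlgebra α μ S = fixedPointAlgebra α μ R :=
  SetLike.ext fun m => by
    rw [hR.mem_fixedPointAlgebra_iff hS hπ hd, hR.mem_fixedPointAlgebra_iff le_rfl hπ rfl]

/-- In any completion the norm of ι(ξ) is the operator norm of |ξ⟩, so density among kets transfers
to it. -/
theorem Admissible.denseRange_ι {S' : Submodule ℂ A} (h : S ≤ S') (hS' : S' ≤ R)
    (hd : (hR.ketSpace π S).topologicalClosure = hR.ternary π) (X : FModule α μ π S') :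
    DenseRange fun ξ : S => X.ι ⟨ξ, h ξ.2⟩ := by
  have hn : ∀ ξ : S', ‖X.ι ξ‖ = ‖hR.ket π (Submodule.inclusion hS' ξ)‖ := fun ξ =>
    eq_norm_of_sq_eq (norm_nonneg _)
      (X.norm_ι_sq ξ (hR.isRegularOp_braket (Submodule.inclusion hS' ξ) _))
  refine dense_closure.1 (X.dense_ι.mono (Set.range_subset_iff.2 fun η => ?_))
  refine Metric.mem_closure_iff.2 fun ε hε => ?_
  have hη : hR.ket π (Submodule.inclusion hS' η) ∈
      closure (hR.ketSpace π S : Set (Lp H 2 μ →L[ℂ] H)) := by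
    rw [← Submodule.topologicalClosure_coe, hd]
    exact hR.ket_mem_ternary _
  obtain ⟨_, ⟨ξ, hξ, rfl⟩, hlt⟩ := Metric.mem_closure_iff (α := Lp H 2 μ →L[ℂ] H).1 hη ε hε
  refine ⟨_, ⟨⟨ξ, hξ⟩, rfl⟩, ?_⟩
  have h1 : dist (X.ι η) (X.ι ⟨ξ, h hξ⟩) =
      ‖hR.ket π (Submodule.inclusion hS' η) - hR.ket π ξ‖ := by
    rw [dist_eq_norm, ← map_sub, hn, map_sub, map_sub]
    rfl
  exact (h1.trans (dist_eq_norm (E := Lp H 2 μ →L[ℂ] H) _ _).symm).trans_lt hlt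

end Completion

end RieffelProper

namespace RieffelProper

/-! ### Density of the kets of A₀ -/

section Density

/-- With y = x*x, (xe − x)*(xe − x) = e*(ye − y) − (ye − y); the C*-identity does the rest. An
approximate unit of C thus approximates x as soon as x*x ∈ C. -/
theorem norm_comp_sub_sq_le {K : Type*} [NormedAddCommGroup K] [InnerProductSpace ℂ K]
    [CompleteSpace K] {H : Type*} [NormedAddCommGroup H] [InnerProductSpace ℂ H] [CompleteSpace H]
    (x : K →L[ℂ] H) {e : K →L[ℂ] K} (he : ‖e‖ ≤ 1) :
    ‖x ∘L e - x‖ ^ 2 ≤ 2 * ‖(x.adjoint ∘L x) * e - x.adjoint ∘L x‖ := by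
  have h := ContinuousLinearMap.norm_adjoint_comp_self (x ∘L e - x)
  rw [← sq] at h
  have h2 : (x ∘L e - x).adjoint ∘L (x ∘L e - x) =
      star e * ((x.adjoint ∘L x) * e - x.adjoint ∘L x) -
        ((x.adjoint ∘L x) * e - x.adjoint ∘L x) := by
    rw [map_sub, ContinuousLinearMap.adjoint_comp, ContinuousLinearMap.star_eq_adjoint]
    ext v
    simp only [ContinuousLinearMap.comp_apply, ContinuousLinearMap.mul_def, sub_apply, map_sub]
    abel
  rw [← h, h2]
  refine (norm_sub_le _ _).trans ?_
  have h3 := norm_mul_le (star e) ((x.adjoint ∘L x) * e - x.adjoint ∘L x)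
  rw [norm_star] at h3
  nlinarith [norm_nonneg ((x.adjoint ∘L x) * e - x.adjoint ∘L x)]

theorem exists_norm_comp_sub_lt {K : Type*} [NormedAddCommGroup K] [InnerProductSpace ℂ K]
    [CompleteSpace K] {H : Type*} [NormedAddCommGroup H] [InnerProductSpace ℂ H] [CompleteSpace H]
    {C : NonUnitalStarSubalgebra ℂ (K →L[ℂ] K)} (hC : IsClosed (C : Set (K →L[ℂ] K)))
    {x : K →L[ℂ] H} (hx : x.adjoint ∘L x ∈ C) {ε : ℝ} (hε : 0 < ε) :
    ∃ e ∈ C, ‖x ∘L e - x‖ < ε := by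
  obtain ⟨l, hl, -, hl1, hl2⟩ := exists_approximateUnit C
  obtain ⟨e, he1, he2⟩ := (hl2.and ((tendsto_iff_norm_sub_tendsto_zero.1
    (hl1 ⟨x.adjoint ∘L x, hx⟩)).eventually (gt_mem_nhds (show 0 < ε ^ 2 / 2 by positivity)))).exists
  refine ⟨e, e.2, lt_of_pow_lt_pow_left₀ 2 hε.le ?_⟩
  have h : ‖(x.adjoint ∘L x) * (e : K →L[ℂ] K) - x.adjoint ∘L x‖ < ε ^ 2 / 2 := he2
  have h2 : ‖x ∘L (e : K →L[ℂ] K) - x‖ ^ 2 ≤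
      2 * ‖(x.adjoint ∘L x) * (e : K →L[ℂ] K) - x.adjoint ∘L x‖ := norm_comp_sub_sq_le x he1
  linarith

variable {A : Type uA} [NonUnitalCStarAlgebra A]

/-- A dense subset of a C*-algebra contains approximate right units for compact sets. -/
theorem exists_approxUnit_of_dense {D : Set A} (hD : Dense D) {K : Set A} (hK : IsCompact K)
    {ε : ℝ} (hε : 0 < ε) : ∃ a ∈ D, ∀ k ∈ K, ‖k * a - k‖ ≤ ε := by
  obtain ⟨t, -, htf, hKt⟩ := hK.finite_cover_balls (e := ε / 4) (by positivity)
  obtain ⟨l, hl, -, hl1, hl2⟩ := exists_approximateUnit A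
  -- The bound ‖e‖ ≤ 1 is relaxed to ‖e‖ < 2 so that the conditions are open and a dense set meets
  -- them. The three error terms are then at most ε/2, ε/4 and ε/4.
  have hne : ∃ e : A, ‖e‖ < 2 ∧ ∀ x ∈ t, ‖x * e - x‖ < ε / 4 := by
    have h1 : ∀ᶠ e in l, ∀ x ∈ t, ‖x * e - x‖ < ε / 4 :=
      (eventually_all_finite htf).2 fun x _ =>
        (tendsto_iff_norm_sub_tendsto_zero.1 (hl1 x)).eventually (gt_mem_nhds (by positivity))
    obtain ⟨e, he1, he2⟩ := (hl2.and h1).exists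
    exact ⟨e, he1.trans_lt one_lt_two, he2⟩
  have hopen : IsOpen {e : A | ‖e‖ < 2 ∧ ∀ x ∈ t, ‖x * e - x‖ < ε / 4} := by
    have h1 : {e : A | ‖e‖ < 2 ∧ ∀ x ∈ t, ‖x * e - x‖ < ε / 4} =
        {e : A | ‖e‖ < 2} ∩ ⋂ x ∈ t, {e : A | ‖x * e - x‖ < ε / 4} := by
      ext e
      simp
    rw [h1]
    refine (isOpen_lt continuous_norm continuous_const).inter (htf.isOpen_biInter fun x _ => ?_)
    exact isOpen_lt ((continuous_const_mul x).sub continuous_const).norm continuous_const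
  obtain ⟨a, ⟨ha1, ha2⟩, haD⟩ := hD.inter_open_nonempty _ hopen hne
  refine ⟨a, haD, fun k hk => ?_⟩
  obtain ⟨x, hx, hkx⟩ := Set.mem_iUnion₂.1 (hKt hk)
  rw [mem_ball_iff_norm] at hkx
  have h1 : k * a - k = (k - x) * a + (x * a - x) + (x - k) := by
    rw [sub_mul]
    abel
  have h2 : ‖(k - x) * a‖ ≤ ε / 4 * 2 :=
    (norm_mul_le _ _).trans (mul_le_mul hkx.le ha1.le (norm_nonneg _) (by positivity))
  have h3 := ha2 x hx
  have h4 := norm_add₃_le (a := (k - x) * a) (b := x * a - x) (c := x - k)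
  rw [norm_sub_rev x k] at h4
  rw [h1]
  linarith

variable {G : Type uG} [Group G] [TopologicalSpace G] [IsTopologicalGroup G]
  [LocallyCompactSpace G] [T2Space G] [MeasurableSpace G] [BorelSpace G] {μ : Measure G}
  [μ.IsHaarMeasure] [μ.Regular]
variable {H : Type uH} [NormedAddCommGroup H] [InnerProductSpace ℂ H] [CompleteSpace H]
variable {α : G →* (A ≃⋆ₐ[ℂ] A)}
variable {R : Submodule ℂ A} (hR : Admissible α μ R) {π : A →⋆ₙₐ[ℂ] (H →L[ℂ] H)}

include hR

theorem Admissible.spanConv_le : spanConv α μ R ≤ R := by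
  refine Submodule.span_le.2 ?_
  rintro _ ⟨ξ, hξ, φ, hφ, rfl⟩
  exact hR.conv_mem ξ hξ φ hφ

theorem Admissible.mul_mem_spanConv {ξ : A} (hξ : ξ ∈ spanConv α μ R) (a : A) :
    ξ * a ∈ spanConv α μ R := by
  have hle : spanConv α μ R ≤ (spanConv α μ R).comap (LinearMap.mulRight ℂ a) := by
    refine Submodule.span_le.2 ?_
    rintro _ ⟨ξ, hξ, φ, hφ, rfl⟩
    exact Submodule.subset_span
      ⟨ξ, hξ, _, hφ.mul_action hR.continuous a, conv_mul hR.continuous hφ ξ a⟩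
  exact hle hξ

theorem Admissible.spanMulStar_le : spanMulStar (spanConv α μ R) ≤ spanConv α μ R := by
  refine Submodule.span_le.2 ?_
  rintro _ ⟨ξ, hξ, η, -, rfl⟩
  exact hR.mul_mem_spanConv hξ _

/-- For φ(t) = ψ(t⁻¹)a with ψ a bump at the identity, ξ * φ is the ψ-average of Δ(t)^{-1/2} α_t(ξa),
hence close to ξa. -/
theorem Admissible.mul_mem_closure_spanConv {ξ : A} (hξ : ξ ∈ R) (a : A) :
    ξ * a ∈ closure (spanConv α μ R : Set A) := by
  refine Metric.mem_closure_iff.2 fun ε hε => ?_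
  have hF : Continuous fun t : G => modularRoot t • α t (ξ * a) :=
    continuous_modularRoot.smul (hR.continuous _)
  have hF1 : modularRoot (1 : G) • α (1 : G) (ξ * a) = ξ * a := by
    rw [modularRoot_one, one_smul, action_one]
  have hnear : ∀ᶠ t in 𝓝 (1 : G),
      ‖modularRoot t • α t (ξ * a) - modularRoot (1 : G) • α (1 : G) (ξ * a)‖ ≤ ε / 2 := by
    filter_upwards [Metric.tendsto_nhds.1 (hF.tendsto 1) (ε / 2) (half_pos hε)] with u hu
    rw [dist_eq_norm] at hu
    exact hu.le
  obtain ⟨ψ, hψ, hψc, h0, hψU, h1⟩ := exists_bump μ hnear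
  have hle := norm_integral_smul_sub_le hF (fun t ht => ht) hψ hψc h0 hψU h1
  have hm : MemL1Δ μ fun t : G => ψ t⁻¹ • a := by
    refine memL1Δ_of_cc ((hψ.comp continuous_inv).smul continuous_const)
      (HasCompactSupport.intro (hasCompactSupport_comp_inv (g := ψ) hψc) fun t ht => ?_)
    have h0 : ψ t⁻¹ = 0 := image_eq_zero_of_notMem_tsupport (f := fun t => ψ t⁻¹) ht
    rw [h0, zero_smul]
  refine ⟨conv α μ ξ fun t => ψ t⁻¹ • a, Submodule.subset_span ⟨ξ, hξ, _, hm, rfl⟩, ?_⟩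
  have hc : conv α μ ξ (fun t => ψ t⁻¹ • a) = ∫ t, ψ t • (modularRoot t • α t (ξ * a)) ∂μ := by
    refine integral_congr_ae (Eventually.of_forall fun t => ?_)
    simp only [inv_inv, mul_smul_comm, action_real_smul]
    rw [smul_comm]
    rfl
  rw [hF1] at hle
  rw [dist_comm, dist_eq_norm, hc]
  exact hle.trans_lt (half_lt_self hε)

theorem Admissible.dense_spanConv : Dense (spanConv α μ R : Set A) := by
  refine dense_closure.1 (hR.dense.mono fun ξ hξ => ?_)
  obtain ⟨l, hl, -, hl1, -⟩ := exists_approximateUnit A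
  rw [← closure_closure]
  exact mem_closure_of_tendsto (hl1 ξ)
    (Eventually.of_forall fun e => hR.mul_mem_closure_spanConv hξ e)

/-- With φ'(t) = φ(t) α_t(η*) and η in R̃, |ζ⟩ λ_{φ'} = |(ζ*φ)η*⟩ is a ket of A₀. The error ‖φ'(t) −
φ(t)‖ equals ‖kη* − k‖ for k = α_{t⁻¹}(φ(t)), which is uniformly small on the support because R̃* is
dense in A. -/
theorem Admissible.ket_conv_mem (ζ : R) {φ : G → A} (hφ : Continuous φ) (hφc : HasCompactSupport φ)
    {T : Lp H 2 μ →L[ℂ] Lp H 2 μ} (hT : IsRegularOp α μ π φ T) :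
    hR.ket π ζ ∘L T ∈
      (hR.ketSpace π (spanMulStar (spanConv α μ R))).topologicalClosure := by
  have hα := hR.continuous
  have hD : Dense (star '' (spanConv α μ R : Set A)) :=
    star_involutive.surjective.denseRange.dense_image continuous_star hR.dense_spanConv
  have hK : IsCompact ((fun t => α t⁻¹ (φ t)) '' tsupport φ) :=
    IsCompact.image hφc (continuous_action hα continuous_inv hφ)
  have hm := memL1Δ_of_cc (μ := μ) hφ hφc
  refine (Metric.mem_closure_iff (α := Lp H 2 μ →L[ℂ] H)).2 fun ε hε => ?_
  set c := (‖hR.ket π ζ‖ + 1) * (μ.real (tsupport φ) + 1) with hc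
  have hc0 : 0 < c := by positivity
  obtain ⟨_, ⟨η, hη, rfl⟩, ha⟩ := exists_approxUnit_of_dense hD hK (div_pos hε hc0)
  have hma := hm.mul_action hα (star η)
  obtain ⟨T', -, hT', -⟩ := exists_isRegularOp (π := π) hα hma.1
  refine ⟨hR.ket π ζ ∘L T', ?_, ?_⟩
  · rw [hR.ket_comp ζ hma hT']
    refine hR.ket_mem_ketSpace _ (Submodule.subset_span ?_)
    exact ⟨conv α μ (ζ : A) φ, Submodule.subset_span ⟨ζ, ζ.2, φ, hm, rfl⟩, η, hη,
      (conv_mul hα hm _ _).symm⟩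
  · have h1 : ‖T' - T‖ ≤ ε / c * μ.real (tsupport φ) := by
      refine ((hT'.sub hα hma.1 hm.1 hT).norm_le hα (hma.1.sub hm.1)).trans ?_
      rw [← setIntegral_eq_integral_of_forall_compl_eq_zero (s := tsupport φ) fun t ht => by
        rw [Pi.sub_apply, image_eq_zero_of_notMem_tsupport ht, zero_mul, sub_zero, norm_zero]]
      refine (setIntegral_mono_on (g := fun _ => ε / c) (hma.1.sub hm.1).norm.integrableOn
        (integrableOn_const (IsCompact.measure_ne_top hφc)) (isClosed_tsupport φ).measurableSet
        fun t ht => ?_).trans_eq (by rw [setIntegral_const, smul_eq_mul, mul_comm])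
      have h2 := ha _ ⟨t, ht, rfl⟩
      rw [← norm_action α t, map_sub, map_mul, ← action_mul, mul_inv_cancel, action_one] at h2
      exact h2
    rw [dist_comm]
    refine (dist_eq_norm (E := Lp H 2 μ →L[ℂ] H) _ _).trans_lt ?_
    rw [← ContinuousLinearMap.comp_sub]
    calc ‖hR.ket π ζ ∘L (T' - T)‖ ≤ ‖hR.ket π ζ‖ * (ε / c * μ.real (tsupport φ)) :=
          (ContinuousLinearMap.opNorm_comp_le _ _).trans (by gcongr)
      _ = ε / c * (‖hR.ket π ζ‖ * μ.real (tsupport φ)) := by ring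
      _ < ε / c * c := by
          gcongr
          rw [hc]
          have : 0 ≤ μ.real (tsupport φ) := measureReal_nonneg
          nlinarith [norm_nonneg (hR.ket π ζ)]
      _ = ε := div_mul_cancel₀ _ hc0.ne'

theorem Admissible.ketSpace_le_ternary (S : Submodule ℂ A) :
    (hR.ketSpace π S).topologicalClosure ≤ hR.ternary π := by
  refine Submodule.topologicalClosure_mono ?_
  rintro _ ⟨ξ, hξ, rfl⟩
  exact hR.ket_mem_ketSpace ξ ξ.2

/-- For x in E the products xc with c in C lie in the closure of the kets of A₀, and x is a limit of
such products since x*x ∈ C. -/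
theorem Admissible.closure_ketSpace_spanMulStar :
    (hR.ketSpace π (spanMulStar (spanConv α μ R))).topologicalClosure = hR.ternary π := by
  have hle := hR.ketSpace_le_ternary (π := π) (spanMulStar (spanConv α μ R))
  refine le_antisymm hle fun x hx => ?_
  set N := (hR.ketSpace π (spanMulStar (spanConv α μ R))).topologicalClosure
  have hN : IsClosed (N : Set (Lp H 2 μ →L[ℂ] H)) := Submodule.isClosed_topologicalClosure _
  have hmem : ∀ c ∈ reducedCrossedProduct α μ π, x ∘L c ∈ N := fun c hc =>
    hR.comp_mem_of_forall_regularOp hN hle (fun φ hφ hφc T hT x hx =>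
      hR.ternary_induction (p := fun x => x ∘L T ∈ N)
        (hN.preimage (continuous_comp_right T)) (fun ζ => hR.ket_conv_mem ζ hφ hφc hT) hx) hx hc
  have hC : IsClosed (reducedCrossedProduct α μ π : Set (Lp H 2 μ →L[ℂ] Lp H 2 μ)) :=
    NonUnitalStarSubalgebra.isClosed_topologicalClosure _
  have hcl : x ∈ closure (N : Set (Lp H 2 μ →L[ℂ] H)) := by
    refine (Metric.mem_closure_iff (α := Lp H 2 μ →L[ℂ] H)).2 fun ε hε => ?_
    obtain ⟨e, he, hlt⟩ := exists_norm_comp_sub_lt hC (hR.adjoint_comp_mem hx hx) hε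
    refine ⟨_, hmem e he, ?_⟩
    rw [dist_comm]
    exact (dist_eq_norm (E := Lp H 2 μ →L[ℂ] H) _ _).trans_lt hlt
  rwa [hN.closure_eq] at hcl

theorem Admissible.closure_ketSpace_eq_of_le {S : Submodule ℂ A}
    (hS : spanMulStar (spanConv α μ R) ≤ S) :
    (hR.ketSpace π S).topologicalClosure = hR.ternary π := by
  refine le_antisymm (hR.ketSpace_le_ternary S) ?_
  rw [← hR.closure_ketSpace_spanMulStar]
  refine Submodule.topologicalClosure_mono ?_
  rintro _ ⟨ξ, hξ, rfl⟩
  exact hR.ket_mem_ketSpace ξ (hS hξ)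

end Density

end RieffelProper
-- The proposition
theorem proposition2p5
    {G : Type uG} [Group G] [TopologicalSpace G] [IsTopologicalGroup G]
    [LocallyCompactSpace G] [T2Space G] [MeasurableSpace G] [BorelSpace G]
    (μ : Measure G) [μ.IsHaarMeasure] [μ.Regular]
    {A : Type uA} [NonUnitalCStarAlgebra A]
    (α : G →* (A ≃⋆ₐ[ℂ] A)) (hα : ∀ a : A, Continuous fun t => α t a)
    {H : Type uH} [NormedAddCommGroup H] [InnerProductSpace ℂ H] [CompleteSpace H]
    (π : A →⋆ₙₐ[ℂ] (H →L[ℂ] H)) (hπ : Function.Injective π)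
    (R : Submodule ℂ A) (hR : Dense (R : Set A))
    (hL1 : ∀ ξ ∈ R, ∀ η ∈ R, RieffelProper.MemL1Δ μ (RieffelProper.braket α ξ η))
    (hconv : ∀ ξ ∈ R, ∀ φ : G → A, RieffelProper.MemL1Δ μ φ →
      RieffelProper.conv α μ ξ φ ∈ R)
    (R' A₀ : Submodule ℂ A) (hR' : R' = RieffelProper.spanConv α μ R)
    (hA₀ : A₀ = RieffelProper.spanMulStar R') :
    -- the three modules exist; the coefficient algebra is the closed span of the inner products
    (Nonempty (RieffelProper.FModule α μ π R) ∧ Nonempty (RieffelProper.FModule α μ π R') ∧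
      Nonempty (RieffelProper.FModule α μ π A₀)) ∧
    (∀ S ∈ ({R, R', A₀} : Set (Submodule ℂ A)),
      (RieffelProper.fixedPointAlgebra α μ S : Set 𝓜(ℂ, A)) =
        closure (Submodule.span ℂ (RieffelProper.leftInners α μ S) : Set 𝓜(ℂ, A))) ∧
    -- the inclusions extend uniquely to isomorphisms of Hilbert bimodules
    ∃ (h₁ : A₀ ≤ R') (h₂ : R' ≤ R),
      ∀ (X : RieffelProper.FModule α μ π R) (Y : RieffelProper.FModule α μ π R')
        (Z : RieffelProper.FModule α μ π A₀),
        (∃! U : Z.E ≃ₗᵢ[ℂ] Y.E, RieffelProper.IsCanonicalIso h₁ Z Y U) ∧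
        (∃! V : Y.E ≃ₗᵢ[ℂ] X.E, RieffelProper.IsCanonicalIso h₂ Y X V) := by
  subst hR' hA₀
  have hadm : RieffelProper.Admissible α μ R := ⟨hα, hR, hL1, hconv⟩
  have h₁ := hadm.spanMulStar_le
  have h₂ := hadm.spanConv_le
  have hd₀ := hadm.closure_ketSpace_spanMulStar (π := π)
  have hd₁ := hadm.closure_ketSpace_eq_of_le (π := π) h₁
  refine ⟨⟨hadm.nonempty_fModule le_rfl hπ rfl, hadm.nonempty_fModule h₂ hπ hd₁,
    hadm.nonempty_fModule (h₁.trans h₂) hπ hd₀⟩, ?_, h₁, h₂, fun X Y Z => ⟨?_, ?_⟩⟩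
  · rintro S (rfl | rfl | rfl)
    · exact hadm.coe_fixedPointAlgebra le_rfl hπ rfl
    · exact hadm.coe_fixedPointAlgebra h₂ hπ hd₁
    · exact hadm.coe_fixedPointAlgebra (h₁.trans h₂) hπ hd₀
  · exact RieffelProper.existsUnique_isCanonicalIso h₁
      ((hadm.fixedPointAlgebra_eq (h₁.trans h₂) hπ hd₀).trans
        (hadm.fixedPointAlgebra_eq h₂ hπ hd₁).symm) Z Y
      (hadm.denseRange_ι (h₁.trans h₂) h₁ h₂ hd₀ Y)
  · exact RieffelProper.existsUnique_isCanonicalIso h₂ (hadm.fixedPointAlgebra_eq h₂ hπ hd₁) Y X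
      (hadm.denseRange_ι h₂ h₂ le_rfl hd₁ X)
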